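/- Let $d\ge 1$, $\alpha\in(0,2)$ and $0<\kappa_0\le\kappa_1<\infty$. For a measurable $\kappa:\mathbb R^d\to\mathbb R$ with $$\kappa(z)=\kappa(-z),\qquad \kappa_0\le\kappa(z)\le\kappa_1\qquad(z\in\mathbb R^d),\tag{1}$$ put $\delta_f(x;z)=f(x+z)+f(x-z)-2f(x)$ and $$\mathscr L^\kappa_\alpha f(x)=\mathrm{p.v.}\!\int_{\mathbb R^d}(f(x+z)-f(x))\frac{\kappa(z)}{|z|^{d+\alpha}}\,dz=\frac12\int_{\mathbb R^d}\delta_f(x;z)\,\kappa(z)|z|^{-d-\alpha}\,dz ,$$ and let $p^\kappa_\alpha(t,x)$ be the heat kernel of $\mathscr L^\kappa_\alpha$, i.e. the transition density of the symmetric Lévy process with generator $\mathscr L^\kappa_\alpha$: $$p^\kappa_\alpha(t,x)=(2\pi)^{-d}\int_{\mathbb R^d}e^{i\xi\cdot x}e^{-t\psi_\kappa(\xi)}\,d\xi,\qquad \psi_\kappa(\xi)=\int_{\mathbb R^d}(1-\cos(\xi\cdot z))\,\kappa(z)|z|^{-d-\alpha}\,dz .$$ For $t>0$, $p^\kappa_\alpha(t,\cdot)$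 is smooth, nonnegative and integrable, $z\mapsto\delta_{p^\kappa_\alpha}(t,x;z)\kappa(z)|z|^{-d-\alpha}$ is integrable for every $x$, and $$\partial_tp^\kappa_\alpha(t,x)=\mathscr L^\kappa_\alpha p^\kappa_\alpha(t,x),\qquad \lim_{t\downarrow0}p^\kappa_\alpha(t,\cdot)=\delta_0 ,$$ the limit being understood as $\int p^\kappa_\alpha(t,x)f(x)\,dx\to f(0)$ for every bounded continuous $f$. For $\beta,\gamma\in\mathbb R$ let $$\varrho^\beta_\gamma(t,x)=t^{\gamma/\alpha}(|x|^\beta\wedge1)(t^{1/\alpha}+|x|)^{-d-\alpha}.$$ Then for every $\gamma\in(0,\alpha\wedge1)$ there is a constant $C=C(d,\alpha,\kappa_0,\kappa_1,\gamma)>0$ such that for all $\kappa,\tilde\kappa$ satisfying (1) and all $(t,x)\in(0,1]\times\mathbb R^d$, $$|p^{\kappa}_\alpha(t,x)-p^{\tilde\kappa}_\alpha(t,x)|\le C\|\kappa-\tilde\kappa\|_\infty(\varrho^0_{\alpha}+\varrho^\gamma_{\alpha-\gamma})(t,x),$$ $$|\nabla p^{\kappa}_\alpha(t,x)-\nabla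 p^{\tilde\kappa}_\alpha(t,x)|\le C\|\kappa-\tilde\kappa\|_\infty\, t^{-1/\alpha}(\varrho^0_{\alpha}+\varrho^\gamma_{\alpha-\gamma})(t,x),$$ $$\int_{\mathbb R^d}|\delta_{p^{\kappa}_\alpha}(t,x;z)-\delta_{p^{\tilde\kappa}_\alpha}(t,x;z)|\,|z|^{-d-\alpha}\,dz\le C\|\kappa-\tilde\kappa\|_\infty(\varrho^0_0+\varrho^\gamma_{-\gamma})(t,x),$$ the last integral being finite. Here $\delta_{p^{\kappa}_\alpha}(t,x;z)$ is $\delta_f(x;z)$ for $f=p^\kappa_\alpha(t,\cdot)$ and $\|\cdot\|_\infty$ is the norm of $L^\infty(\mathbb R^d)$. -/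

import Mathlib

open MeasureTheory Filter Topology
open scoped ContDiff RealInnerProductSpace

namespace StableLike

noncomputable section

/-- The Euclidean space `ℝ^d`. -/
abbrev Sp (d : ℕ) : Type := EuclideanSpace ℝ (Fin d)

/-- The jump weight `|z|^{-d-α}`. -/
def weight {d : ℕ} (α : ℝ) (z : Sp d) : ℝ := ‖z‖ ^ (-(d : ℝ) - α)

/-- A measurable function `κ` on `ℝ^d` with `κ(z) = κ(-z)` and `κ₀ ≤ κ ≤ κ₁`. -/
structure IsKernel {d : ℕ} (κ₀ κ₁ : ℝ) (κ : Sp d → ℝ) : Prop where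
  measurable : Measurable κ
  symm : ∀ z, κ z = κ (-z)
  lower : ∀ z, κ₀ ≤ κ z
  upper : ∀ z, κ z ≤ κ₁

/-- The second difference `δ_f(x;z) = f(x+z) + f(x-z) - 2 f(x)`. -/
def secondDiff {d : ℕ} (f : Sp d → ℝ) (x z : Sp d) : ℝ :=
  f (x + z) + f (x - z) - 2 * f x

/-- The operator `ℒ^κ_α f(x) = ½ ∫ δ_f(x;z) κ(z) |z|^{-d-α} dz`. -/
def levyOp {d : ℕ} (α : ℝ) (κ : Sp d → ℝ) (f : Sp d → ℝ) (x : Sp d) : ℝ :=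
  (1 / 2) * ∫ z, secondDiff f x z * κ z * weight α z

/-- The Lévy exponent `ψ(ξ) = ∫ (1 - cos⟨ξ,z⟩) κ(z) |z|^{-d-α} dz`; the operator `levyOp α κ` is the
Fourier multiplier with symbol `-ψ`. -/
def exponent {d : ℕ} (α : ℝ) (κ : Sp d → ℝ) (ξ : Sp d) : ℝ :=
  ∫ z, (1 - Real.cos ⟪ξ, z⟫) * κ z * weight α z

/-- The heat kernel `p^κ_α(t,x)`, that is, the transition density of the symmetric Lévy process
with generator `levyOp α κ`, as the inverse Fourier transform
`(2π)^{-d} ∫ e^{i⟨ξ,x⟩} e^{-tψ(ξ)} dξ` (whose imaginary part vanishes because `ψ` is even). -/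
def heatKernel {d : ℕ} (α : ℝ) (κ : Sp d → ℝ) (t : ℝ) (x : Sp d) : ℝ :=
  ((2 * Real.pi) ^ d)⁻¹ * ∫ ξ : Sp d, Real.cos ⟪ξ, x⟫ * Real.exp (-t * exponent α κ ξ)

/-- `p` is a heat kernel of `ℒ^κ_α`: it is a classical solution of `∂_t p = ℒ^κ_α p` on
`(0,∞) × ℝ^d`, smooth in space, with `p(t,·) → δ_0` as `t ↓ 0`. -/
structure IsHeatKernel {d : ℕ} (α : ℝ) (κ : Sp d → ℝ) (p : ℝ → Sp d → ℝ) : Prop where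
  smooth : ∀ t > 0, ContDiff ℝ ∞ (p t)
  nonneg : ∀ t > 0, ∀ x, 0 ≤ p t x
  integrable : ∀ t > 0, Integrable (p t)
  integrable_secondDiff : ∀ t > 0, ∀ x, Integrable fun z => secondDiff (p t) x z * κ z * weight α z
  equation : ∀ t > 0, ∀ x, HasDerivAt (fun s => p s x) (levyOp α κ (p t) x) t
  initial : ∀ f : Sp d → ℝ, Continuous f → (∃ M, ∀ x, |f x| ≤ M) →
    Tendsto (fun t => ∫ x, p t x * f x) (𝓝[>] 0) (𝓝 (f 0))

/-- `ϱ^β_γ(t,x) = t^{γ/α} (|x|^β ∧ 1) (t^{1/α} + |x|)^{-d-α}`. -/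
def rho {d : ℕ} (α β γ t : ℝ) (x : Sp d) : ℝ :=
  t ^ (γ / α) * min (‖x‖ ^ β) 1 * (t ^ (1 / α) + ‖x‖) ^ (-(d : ℝ) - α)

/-- The norm `‖f‖_∞` of `L^∞(ℝ^d)`. -/
def supNorm {d : ℕ} (f : Sp d → ℝ) : ℝ := (eLpNorm f ⊤ volume).toReal

end

end StableLike

/-!
The heat kernel `p^κ(t, ·)` is a rescaling of `p^{κ(s·)}(1, ·)` with `s = t^{1/α}`
(`heatKernel_scaling`), and the dilated kernel `κ(s·)` satisfies the same bounds as `κ`. It is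
therefore enough to treat time one, with constants that are uniform over the kernels. There the
profile of all estimates is `tail α x = (1 + |x|)^{-d-α}`, and it turns out that the summand
`ϱ^0_α` alone bounds the differences; the summand with exponent `γ` is nonnegative and plays no
role.

At time one the kernel is the Fourier transform of `e^{-ψ}`, and `ψ` is split into the exponents of
the jumps of size at most one and of the larger jumps.

* The exponent of the small jumps is smooth with derivatives of at most quadratic growth
  (`contDiff_symb_near`), and it is at least `c|ξ|^α` up to a constant, uniformly over the kernels,
  by scaling and compactness of the sphere (`exists_le_exponent`). Hence the Fourier transform of
  its exponential is dominated by `tail`, with all derivatives, and depends on `κ` in a Lipschitz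
  way (`exists_fourier_near_le`, `exists_fourier_near_sub_le`).
* The density of the large jumps is integrable and dominated by `tail`. On the Fourier side the
  exponent of such a density acts by convolution, and `tail` is stable under convolution
  (`integral_tail_mul_tail_le`). So multiplication by the exponent preserves the symbols whose
  Fourier transform is dominated by `tail`, and the exponential series gives the same for the
  exponential, together with a Lipschitz bound (`norm_fourier_exp_symb_sub_one_smul_le`).

Combining the two gives the Lipschitz bound at time one for the kernel and all its derivatives
(`exists_norm_iteratedFDeriv_charOne_sub_le`). The integrated second differences follow by using the
second derivative for small jumps and the size of the function for large ones
(`integrable_and_integral_secondDiff_le`).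

That `p^κ` is a heat kernel is seen as follows. Smoothness and integrability are contained in the
bounds above. Positivity is obtained by approximation with compound Poisson processes, whose
transition operators are exponential series of convolutions with nonnegative functions
(`nonnegFourier_charOne`). The equation is differentiation under the Fourier integral and Fubini's
theorem (`hasDerivAt_heatKernel`). The initial condition follows from scaling, dominated convergence
and the fact that the kernel has mass one, which is Fourier inversion
(`tendsto_integral_heatKernel_mul`).
-/

namespace StableLike

noncomputable section

/-! ### The jump weight and the stable-like profile -/

section Profile

variable {d : ℕ}

/-- The profile `(1 + |x|)^{-d-α}` of a stable-like heat kernel at time one. -/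
def tail (α : ℝ) (x : Sp d) : ℝ := (1 + ‖x‖) ^ (-(d : ℝ) - α)

/-- The jump weight restricted to the closed unit ball. -/
def nearWeight (α : ℝ) : Sp d → ℝ := (Metric.closedBall 0 1).indicator (weight α)

/-- The jump weight restricted to the complement of the closed unit ball. -/
def farWeight (α : ℝ) : Sp d → ℝ := (Metric.closedBall 0 1)ᶜ.indicator (weight α)

theorem weight_nonneg (α : ℝ) (z : Sp d) : 0 ≤ weight α z := by
  unfold weight; positivity

theorem measurable_weight (α : ℝ) : Measurable (weight α : Sp d → ℝ) := by
  unfold weight; fun_prop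

theorem nearWeight_nonneg (α : ℝ) (z : Sp d) : 0 ≤ nearWeight α z :=
  Set.indicator_nonneg (fun z _ => weight_nonneg α z) z

theorem farWeight_nonneg (α : ℝ) (z : Sp d) : 0 ≤ farWeight α z :=
  Set.indicator_nonneg (fun z _ => weight_nonneg α z) z

theorem measurable_nearWeight (α : ℝ) : Measurable (nearWeight α : Sp d → ℝ) :=
  (measurable_weight α).indicator measurableSet_closedBall

theorem measurable_farWeight (α : ℝ) : Measurable (farWeight α : Sp d → ℝ) :=
  (measurable_weight α).indicator measurableSet_closedBall.compl

theorem nearWeight_add_farWeight (α : ℝ) (z : Sp d) :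
    nearWeight α z + farWeight α z = weight α z :=
  Set.indicator_self_add_compl_apply _ _ z

theorem weight_neg (α : ℝ) (z : Sp d) : weight α (-z) = weight α z := by simp [weight]

theorem farWeight_neg (α : ℝ) (z : Sp d) : farWeight α (-z) = farWeight α z := by
  simp [farWeight, Set.indicator, weight_neg]

theorem tail_pos (α : ℝ) (x : Sp d) : 0 < tail α x := by
  unfold tail; positivity

theorem continuous_tail (α : ℝ) : Continuous (tail α : Sp d → ℝ) := by
  unfold tail
  refine Continuous.rpow_const (by fun_prop) fun x => Or.inl ?_
  positivity

theorem tail_neg (α : ℝ) (x : Sp d) : tail α (-x) = tail α x := by simp [tail]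

theorem tail_le_one {α : ℝ} (hα : 0 < α) (x : Sp d) : tail α x ≤ 1 := by
  unfold tail
  refine Real.rpow_le_one_of_one_le_of_nonpos (by linarith [norm_nonneg x]) ?_
  have : (0 : ℝ) ≤ d := Nat.cast_nonneg d
  linarith

theorem integrable_tail {α : ℝ} (hα : 0 < α) : Integrable (tail α : Sp d → ℝ) := by
  have h := integrable_one_add_norm (E := Sp d) (μ := volume) (r := d + α) (by simp [hα])
  refine h.congr (ae_of_all _ fun x => ?_)
  simp only [tail]
  congr 1; ring

/-- If `(1+|x|) ≤ c (1+|y|)` then `tail y ≤ c^{d+α} tail x`. -/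
theorem tail_le_of_le {α : ℝ} (hα : 0 < α) {c : ℝ} (hc : 0 < c) {x y : Sp d}
    (h : 1 + ‖x‖ ≤ c * (1 + ‖y‖)) : tail α y ≤ c ^ ((d : ℝ) + α) * tail α x := by
  unfold tail
  have h0 : -(d : ℝ) - α = -((d : ℝ) + α) := by ring
  have hp : (0 : ℝ) ≤ d + α := by positivity
  rw [h0, Real.rpow_neg (by positivity), Real.rpow_neg (by positivity), ← div_eq_mul_inv,
    inv_eq_one_div, div_le_div_iff₀ (by positivity) (by positivity), one_mul,
    ← Real.mul_rpow hc.le (by positivity)]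
  exact Real.rpow_le_rpow (by positivity) h hp

theorem farWeight_le_tail {α : ℝ} (hα : 0 < α) (z : Sp d) :
    farWeight α z ≤ 2 ^ ((d : ℝ) + α) * tail α z := by
  unfold farWeight
  refine Set.indicator_apply_le' (fun hz => ?_) (fun _ => ?_)
  · have hz' : 1 < ‖z‖ := by simpa using hz
    have h0 : -(d : ℝ) - α = -((d : ℝ) + α) := by ring
    have hp : (0 : ℝ) ≤ d + α := by positivity
    unfold weight tail
    rw [h0, Real.rpow_neg (by positivity), Real.rpow_neg (by positivity), ← div_eq_mul_inv,
      inv_eq_one_div, div_le_div_iff₀ (by positivity) (by positivity), one_mul,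
      ← Real.mul_rpow (by norm_num) (by positivity)]
    exact Real.rpow_le_rpow (by positivity) (by linarith) hp
  · exact mul_nonneg (by positivity) (tail_pos α z).le

theorem integrable_farWeight {α : ℝ} (hα : 0 < α) : Integrable (farWeight α : Sp d → ℝ) := by
  refine ((integrable_tail hα).const_mul (2 ^ ((d : ℝ) + α))).mono'
    (measurable_farWeight α).aestronglyMeasurable (ae_of_all _ fun z => ?_)
  rw [Real.norm_of_nonneg (farWeight_nonneg α z)]
  exact farWeight_le_tail hα z

/-- One of the points `z` and `x + z` is at distance at least `|x|/2` from the origin. -/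
theorem tail_mul_tail_le {α : ℝ} (hα : 0 < α) (x z : Sp d) :
    tail α z * tail α (x + z) ≤
      2 ^ ((d : ℝ) + α) * tail α x * (tail α z + tail α (x + z)) := by
  have h1 := (tail_pos α z).le
  have h2 := (tail_pos α (x + z)).le
  have h3 := (tail_pos α x).le
  have hc : (0 : ℝ) ≤ 2 ^ ((d : ℝ) + α) := by positivity
  have htri : ‖x‖ ≤ ‖x + z‖ + ‖z‖ := by simpa using norm_sub_le (x + z) z
  rcases le_total ‖z‖ ‖x + z‖ with h | h
  · have := tail_le_of_le hα two_pos (x := x) (y := x + z) (by linarith)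
    nlinarith [mul_nonneg (mul_nonneg hc h3) h2]
  · have := tail_le_of_le hα two_pos (x := x) (y := z) (by linarith)
    nlinarith [mul_nonneg (mul_nonneg hc h3) h1]

theorem integrable_tail_add {α : ℝ} (hα : 0 < α) (x : Sp d) :
    Integrable (fun z => tail α (x + z)) := (integrable_tail hα).comp_add_left x

theorem integrable_tail_mul_tail {α : ℝ} (hα : 0 < α) (x : Sp d) :
    Integrable (fun z => tail α z * tail α (x + z)) := by
  refine (integrable_tail hα).mono' (((continuous_tail α).mul
    ((continuous_tail α).comp (by fun_prop))).aestronglyMeasurable) (ae_of_all _ fun z => ?_)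
  rw [Real.norm_of_nonneg (mul_nonneg (tail_pos α z).le (tail_pos α _).le)]
  exact mul_le_of_le_one_right (tail_pos α z).le (tail_le_one hα _)

/-- The profile `tail` is, up to a constant, stable under convolution. -/
theorem integral_tail_mul_tail_le {α : ℝ} (hα : 0 < α) (x : Sp d) :
    ∫ z, tail α z * tail α (x + z) ≤
      2 ^ ((d : ℝ) + α) * (2 * ∫ z : Sp d, tail α z) * tail α x := by
  calc ∫ z, tail α z * tail α (x + z)
      ≤ ∫ z, 2 ^ ((d : ℝ) + α) * tail α x * (tail α z + tail α (x + z)) :=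
        integral_mono (integrable_tail_mul_tail hα x)
          (((integrable_tail hα).add (integrable_tail_add hα x)).const_mul _)
          (fun z => tail_mul_tail_le hα x z)
    _ = _ := by
        rw [integral_const_mul, integral_add (integrable_tail hα) (integrable_tail_add hα x),
          integral_add_left_eq_self (tail α) x]
        ring

theorem integrable_sq_mul_nearWeight (hd : 1 ≤ d) {α : ℝ} (hα : α < 2) :
    Integrable (fun z : Sp d => ‖z‖ ^ 2 * nearWeight α z) := by
  have : Nonempty (Fin d) := ⟨⟨0, hd⟩⟩
  have h1 : IntegrableOn (fun y : ℝ => y ^ (Module.finrank ℝ (Sp d) - 1) •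
      (y ^ 2 * y ^ (-(d : ℝ) - α))) (Set.Ioo 0 2) := by
    have h2 : IntegrableOn (fun y : ℝ => y ^ (1 - α)) (Set.Ioo 0 2) :=
      (intervalIntegral.integrableOn_Ioo_rpow_iff (by norm_num)).2 (by linarith)
    refine h2.congr_fun (fun y hy => ?_) measurableSet_Ioo
    have hy0 : 0 < y := hy.1
    simp only [finrank_euclideanSpace, Fintype.card_fin, smul_eq_mul]
    rw [← Real.rpow_natCast, ← Real.rpow_natCast, ← Real.rpow_add hy0, ← Real.rpow_add hy0,
      Nat.cast_sub hd]
    congr 1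
    push_cast
    ring
  have h3 := (integrableOn_fun_norm_addHaar (E := Sp d) volume
    (f := fun y : ℝ => y ^ 2 * y ^ (-(d : ℝ) - α)) (r := 2)).2 h1
  have h4 : IntegrableOn (fun z : Sp d => ‖z‖ ^ 2 * weight α z) (Metric.closedBall 0 1) :=
    h3.mono_set (Metric.closedBall_subset_ball (by norm_num))
  rw [← integrable_indicator_iff measurableSet_closedBall] at h4
  refine h4.congr (ae_of_all _ fun z => ?_)
  simp only [nearWeight, Set.indicator]
  split_ifs <;> simp

end Profile

/-! ### Smoothness of Lévy exponents with bounded jumps -/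

section BoundedJumps

section ParametricIntegral

variable {A E G : Type*} [MeasurableSpace A] {μ : Measure A}
  [NormedAddCommGroup E] [NormedSpace ℝ E] [NormedAddCommGroup G] [NormedSpace ℝ G]
  [CompleteSpace G]

/-- Smoothness of a parametric integral whose integrand is smooth in the parameter, all parameter
derivatives being dominated by integrable functions locally uniformly in the parameter. -/
theorem hasFTaylorSeriesUpTo_integral {F : E → A → G} {B : ℕ → E → A → ℝ}
    (hF : ∀ a, ContDiff ℝ ∞ fun x => F x a)
    (hmeas : ∀ n x, AEStronglyMeasurable (fun a => iteratedFDeriv ℝ n (fun y => F y a) x) μ)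
    (hB : ∀ n x₀, Integrable (B n x₀) μ)
    (hbound : ∀ n x₀, ∀ᵐ a ∂μ, ∀ x ∈ Metric.ball x₀ 1,
      ‖iteratedFDeriv ℝ n (fun y => F y a) x‖ ≤ B n x₀ a) :
    HasFTaylorSeriesUpTo ∞ (fun x => ∫ a, F x a ∂μ)
      (fun x n => ∫ a, iteratedFDeriv ℝ n (fun y => F y a) x ∂μ) := by
  have hint : ∀ n x, Integrable (fun a => iteratedFDeriv ℝ n (fun y => F y a) x) μ :=
    fun n x => (hB n x).mono' (hmeas n x)
      ((hbound n x).mono fun a ha => ha x (Metric.mem_ball_self one_pos))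
  have key : ∀ (n : ℕ) x, HasFDerivAt
      (fun x => ∫ a, iteratedFDeriv ℝ n (fun y => F y a) x ∂μ)
      (∫ a, iteratedFDeriv ℝ (n + 1) (fun y => F y a) x ∂μ).curryLeft x := by
    intro n x
    have hd : ∀ a y, HasFDerivAt (iteratedFDeriv ℝ n (fun y => F y a))
        (iteratedFDeriv ℝ (n + 1) (fun y => F y a) y).curryLeft y := by
      intro a y
      have h := ((hF a).differentiable_iteratedFDeriv (m := n) (by
        exact_mod_cast ENat.natCast_lt_top n) y).hasFDerivAt
      convert h using 1
      ext v m
      simp [iteratedFDeriv_succ_apply_left]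
    have h := hasFDerivAt_integral_of_dominated_of_fderiv_le (𝕜 := ℝ) (μ := μ)
      (F := fun x a => iteratedFDeriv ℝ n (fun y => F y a) x)
      (F' := fun x a => (iteratedFDeriv ℝ (n + 1) (fun y => F y a) x).curryLeft)
      (bound := B (n + 1) x)
      (Metric.ball_mem_nhds x one_pos) (Eventually.of_forall (hmeas n)) (hint n x)
      ((continuousMultilinearCurryLeftEquiv ℝ (fun _ : Fin (n + 1) => E) G).continuous
        |>.comp_aestronglyMeasurable (hmeas (n + 1) x))
      ((hbound (n + 1) x).mono fun a ha y hy => by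
        rw [ContinuousMultilinearMap.curryLeft_norm]; exact ha y hy)
      (hB (n + 1) x) (ae_of_all _ fun a y _ => hd a y)
    let L : (E [×(n + 1)]→L[ℝ] G) →L[ℝ] (E →L[ℝ] E [×n]→L[ℝ] G) :=
      (continuousMultilinearCurryLeftEquiv ℝ (fun _ : Fin (n + 1) => E) G
        ).toContinuousLinearEquiv.toContinuousLinearMap
    have e : (∫ a, iteratedFDeriv ℝ (n + 1) (fun y => F y a) x ∂μ).curryLeft =
        ∫ a, (iteratedFDeriv ℝ (n + 1) (fun y => F y a) x).curryLeft ∂μ :=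
      (ContinuousLinearMap.integral_comp_comm (𝕜 := ℝ) (Fₗ := E →L[ℝ] E [×n]→L[ℝ] G) L
        (hint (n + 1) x)).symm
    rw [e]
    exact h
  refine ⟨fun x => ?_, fun n _ x => key n x, fun n _ => ?_⟩
  · have h := (ContinuousMultilinearMap.apply ℝ (fun _ : Fin 0 => E) G 0).integral_comp_comm
      (hint 0 x)
    exact h.symm
  · exact continuous_iff_continuousAt.2 fun x => (key n x).continuousAt

end ParametricIntegral

variable {d : ℕ}

/-- The Lévy exponent `∫ (1 - cos (2π⟨z,ξ⟩)) k(z) dz` of a jump density `k`, in the frequency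
normalisation of Mathlib's Fourier transform. -/
def symb (k : Sp d → ℝ) (ξ : Sp d) : ℝ := ∫ z, (1 - Real.cos (2 * Real.pi * ⟪z, ξ⟫)) * k z

theorem abs_one_sub_cos_le_sq (u : ℝ) : |1 - Real.cos u| ≤ u ^ 2 / 2 := by
  rw [abs_of_nonneg (by linarith [Real.cos_le_one u])]
  linarith [Real.one_sub_sq_div_two_le_cos (x := u)]

theorem abs_one_sub_cos_le_two (u : ℝ) : |1 - Real.cos u| ≤ 2 := by
  rw [abs_of_nonneg (by linarith [Real.cos_le_one u])]
  linarith [Real.neg_one_le_cos u]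

theorem norm_iteratedDeriv_one_sub_cos_le (n : ℕ) (u : ℝ) :
    ‖iteratedDeriv n (fun u => 1 - Real.cos u) u‖ ≤
      if n = 0 then u ^ 2 else if n = 1 then |u| else 1 := by
  rcases Nat.eq_zero_or_pos n with rfl | hn
  · simp only [iteratedDeriv_zero, if_true, Real.norm_eq_abs]
    exact (abs_one_sub_cos_le_sq u).trans (by linarith [sq_nonneg u])
  · rw [iteratedDeriv_const_sub hn, iteratedDeriv_neg, norm_neg, Real.norm_eq_abs,
      if_neg hn.ne']
    split_ifs with h
    · subst h
      simp only [iteratedDeriv_one, Real.deriv_cos, abs_neg]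
      exact Real.abs_sin_le_abs
    · exact Real.abs_iteratedDeriv_cos_le_one n u

/-- The functional `ξ ↦ 2π⟨z,ξ⟩`. -/
def phase (z : Sp d) : Sp d →L[ℝ] ℝ := (2 * Real.pi) • innerSL ℝ z

theorem phase_apply (z ξ : Sp d) : phase z ξ = 2 * Real.pi * ⟪z, ξ⟫ := by simp [phase]

theorem norm_phase (z : Sp d) : ‖phase z‖ = 2 * Real.pi * ‖z‖ := by
  rw [phase, norm_smul, innerSL_apply_norm, Real.norm_of_nonneg (by positivity)]

theorem continuous_phase : Continuous (phase : Sp d → Sp d →L[ℝ] ℝ) := by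
  unfold phase; fun_prop

theorem contDiff_one_sub_cos {n : WithTop ℕ∞} : ContDiff ℝ n fun u : ℝ => 1 - Real.cos u :=
  contDiff_const.sub Real.contDiff_cos

theorem iteratedFDeriv_one_sub_cos_phase (n : ℕ) (z ξ : Sp d) :
    iteratedFDeriv ℝ n (fun ξ => 1 - Real.cos (phase z ξ)) ξ =
      (iteratedFDeriv ℝ n (fun u : ℝ => 1 - Real.cos u) (phase z ξ)).compContinuousLinearMap
        fun _ => phase z :=
  (phase z).iteratedFDeriv_comp_right contDiff_one_sub_cos ξ le_rfl

theorem norm_iteratedFDeriv_one_sub_cos_phase_le (n : ℕ) {z : Sp d} (hz : ‖z‖ ≤ 1) (ξ : Sp d) :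
    ‖iteratedFDeriv ℝ n (fun ξ => 1 - Real.cos (phase z ξ)) ξ‖ ≤
      (2 * Real.pi) ^ (n + 2) * (1 + ‖ξ‖) ^ 2 * ‖z‖ ^ 2 := by
  have hx := norm_nonneg ξ
  have hz0 := norm_nonneg z
  have hpi : 1 ≤ 2 * Real.pi := by linarith [Real.pi_gt_three]
  have hx1 : 1 ≤ (1 + ‖ξ‖) ^ 2 := by nlinarith
  have hu : |phase z ξ| ≤ 2 * Real.pi * ‖z‖ * ‖ξ‖ := by
    rw [← norm_phase, ← Real.norm_eq_abs]; exact (phase z).le_opNorm ξ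
  rw [iteratedFDeriv_one_sub_cos_phase]
  refine (ContinuousMultilinearMap.norm_compContinuousLinearMap_le _ _).trans ?_
  rw [norm_iteratedFDeriv_eq_norm_iteratedDeriv, Finset.prod_const, Finset.card_univ,
    Fintype.card_fin, norm_phase]
  have h := norm_iteratedDeriv_one_sub_cos_le n (phase z ξ)
  rcases n with _ | _ | n
  · simp only [if_true] at h
    rw [pow_zero, mul_one]
    refine h.trans ?_
    rw [← sq_abs]
    calc |phase z ξ| ^ 2 ≤ (2 * Real.pi * ‖z‖ * ‖ξ‖) ^ 2 := by gcongr
      _ = (2 * Real.pi) ^ (0 + 2) * ‖ξ‖ ^ 2 * ‖z‖ ^ 2 := by ring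
      _ ≤ _ := by gcongr; linarith
  · simp only [zero_add, one_ne_zero, if_true, if_false] at h ⊢
    calc _ ≤ (2 * Real.pi * ‖z‖ * ‖ξ‖) * (2 * Real.pi * ‖z‖) ^ 1 := by
          gcongr; exact h.trans hu
      _ = (2 * Real.pi) ^ 2 * ‖ξ‖ * ‖z‖ ^ 2 := by ring
      _ ≤ _ := by
        gcongr
        · norm_num
        · nlinarith
  · simp only [Nat.add_eq_zero_iff, if_false, one_ne_zero, and_false] at h
    rw [if_neg (by omega)] at h
    calc _ ≤ 1 * (2 * Real.pi * ‖z‖) ^ (n + 1 + 1) := by gcongr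
      _ = (2 * Real.pi) ^ (n + 1 + 1) * 1 * ‖z‖ ^ (n + 1 + 1) := by ring
      _ ≤ (2 * Real.pi) ^ (n + 1 + 1 + 2) * (1 + ‖ξ‖) ^ 2 * ‖z‖ ^ 2 := by
        gcongr ?_ * ?_ * ?_
        · exact pow_le_pow_right₀ hpi (by omega)
        · exact pow_le_pow_of_le_one hz0 hz (by omega)

theorem continuous_iteratedFDeriv_one_sub_cos_phase (n : ℕ) (ξ : Sp d) :
    Continuous fun z : Sp d => iteratedFDeriv ℝ n (fun ξ => 1 - Real.cos (phase z ξ)) ξ := by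
  simp_rw [iteratedFDeriv_one_sub_cos_phase]
  have h1 : Continuous fun z : Sp d =>
      iteratedFDeriv ℝ n (fun u : ℝ => 1 - Real.cos u) (phase z ξ) :=
    (contDiff_one_sub_cos.continuous_iteratedFDeriv (m := n) le_rfl).comp
      (continuous_phase.clm_apply continuous_const)
  have h2 : Continuous fun z : Sp d =>
      (ContinuousMultilinearMap.compContinuousLinearMapContinuousMultilinear ℝ
        (fun _ : Fin n => Sp d) (fun _ : Fin n => ℝ) ℝ) fun _ => phase z :=
    (ContinuousMultilinearMap.cont _).comp (continuous_pi fun _ => continuous_phase)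
  exact h2.clm_apply h1

/-- The second moment of the jump weight in the unit ball. -/
def nearMoment (d : ℕ) (α : ℝ) : ℝ := ∫ z : Sp d, ‖z‖ ^ 2 * nearWeight α z

theorem nearMoment_nonneg (α : ℝ) : 0 ≤ nearMoment d α :=
  integral_nonneg fun z => mul_nonneg (by positivity) (nearWeight_nonneg α z)

/-- The exponent of a jump density living in the unit ball is smooth, and its derivatives grow at
most quadratically, with constants proportional to the density. -/
theorem contDiff_symb_near (hd : 1 ≤ d) {α : ℝ} (hα : α < 2) {k : Sp d → ℝ} (hk : Measurable k)
    {B : ℝ} (hkB : ∀ᵐ z, |k z| ≤ B * nearWeight α z) :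
    ContDiff ℝ ∞ (symb k) ∧ ∀ (n : ℕ) (ξ : Sp d), ‖iteratedFDeriv ℝ n (symb k) ξ‖ ≤
      B * ((2 * Real.pi) ^ (n + 2) * nearMoment d α) * (1 + ‖ξ‖) ^ 2 := by
  have hsm : ∀ z : Sp d, ContDiff ℝ ∞ fun ξ => 1 - Real.cos (phase z ξ) := fun z =>
    contDiff_one_sub_cos.comp (phase z).contDiff
  have hD : ∀ (n : ℕ) (z ξ : Sp d),
      iteratedFDeriv ℝ n (fun ξ => k z * (1 - Real.cos (phase z ξ))) ξ =
        k z • iteratedFDeriv ℝ n (fun ξ => 1 - Real.cos (phase z ξ)) ξ := fun n z ξ =>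
    iteratedFDeriv_const_smul_apply (a := k z) (f := fun ξ => 1 - Real.cos (phase z ξ))
      ((hsm z).of_le (by exact_mod_cast le_top)).contDiffAt
  have hbd : ∀ (n : ℕ), ∀ᵐ z : Sp d, ∀ ξ : Sp d,
      ‖iteratedFDeriv ℝ n (fun ξ => k z * (1 - Real.cos (phase z ξ))) ξ‖ ≤
        B * ((2 * Real.pi) ^ (n + 2) * (1 + ‖ξ‖) ^ 2) * (‖z‖ ^ 2 * nearWeight α z) := by
    intro n
    filter_upwards [hkB] with z hz ξ
    rw [hD, norm_smul, Real.norm_eq_abs]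
    by_cases hz1 : ‖z‖ ≤ 1
    · calc _ ≤ (B * nearWeight α z) * ((2 * Real.pi) ^ (n + 2) * (1 + ‖ξ‖) ^ 2 * ‖z‖ ^ 2) := by
            gcongr
            · exact (abs_nonneg _).trans hz
            · exact norm_iteratedFDeriv_one_sub_cos_phase_le n hz1 ξ
        _ = _ := by ring
    · have h0 : nearWeight α z = 0 := by
        simp [nearWeight, Set.indicator, hz1]
      rw [h0, mul_zero] at hz
      rw [h0, le_antisymm hz (abs_nonneg _)]
      simp
  have hI : ∀ c : ℝ, Integrable fun z : Sp d => c * (‖z‖ ^ 2 * nearWeight α z) := fun c =>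
    (integrable_sq_mul_nearWeight hd hα).const_mul c
  have hB0 : ∀ᵐ z, 0 ≤ B * nearWeight α (z : Sp d) := by
    filter_upwards [hkB] with z hz using (abs_nonneg _).trans hz
  have hT := hasFTaylorSeriesUpTo_integral (μ := volume)
    (F := fun ξ z : Sp d => k z * (1 - Real.cos (phase z ξ)))
    (B := fun n ξ z => B * ((2 * Real.pi) ^ (n + 2) * (2 + ‖ξ‖) ^ 2) * (‖z‖ ^ 2 * nearWeight α z))
    (fun z => contDiff_const.mul (hsm z))
    (fun n ξ => by
      simp_rw [hD]
      exact hk.aestronglyMeasurable.smul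
        (continuous_iteratedFDeriv_one_sub_cos_phase n ξ).aestronglyMeasurable)
    (fun n ξ => hI _)
    (fun n ξ => by
      filter_upwards [hbd n, hB0] with z hz hB0 η hη
      refine (hz η).trans ?_
      have h1 : ‖η‖ ≤ 1 + ‖ξ‖ := by
        have := norm_sub_norm_le η ξ
        have h2 : ‖η - ξ‖ < 1 := by simpa [dist_eq_norm] using hη
        linarith
      have e : ∀ c : ℝ, B * ((2 * Real.pi) ^ (n + 2) * c) * (‖z‖ ^ 2 * nearWeight α z) =
        (B * nearWeight α z) * ((2 * Real.pi) ^ (n + 2) * c * ‖z‖ ^ 2) := fun c => by ring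
      rw [e, e]
      gcongr ?_ * (?_ * ?_ * ?_)
      exact pow_le_pow_left₀ (by positivity) (by linarith) 2)
  have hs : symb k = fun ξ => ∫ z, k z * (1 - Real.cos (phase z ξ)) := by
    funext ξ; simp only [symb, phase_apply, mul_comm]
  rw [← hs] at hT
  refine ⟨hT.contDiff, fun n ξ => ?_⟩
  rw [← hT.eq_iteratedFDeriv (m := n) (by exact_mod_cast le_top) ξ]
  refine (norm_integral_le_of_norm_le (hI _) ((hbd n).mono fun z hz => hz ξ)).trans ?_
  rw [integral_const_mul, nearMoment]
  apply le_of_eq; ring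

end BoundedJumps

/-! ### Derivative bounds for families of functions -/

section DerivativeBounds

section DerivBound

variable {ι E F : Type*} [NormedAddCommGroup E] [NormedSpace ℝ E] [NormedAddCommGroup F]
  [NormedSpace ℝ F]

/-- The members of the family `f` are smooth, and their derivatives of order at most `N` are bounded
by the gauge `G`, up to a constant and a polynomial weight which do not depend on the member. -/
def DerivBound (N : ℕ) (f : ι → E → F) (G : ι → E → ℝ) : Prop :=
  (∀ i, ContDiff ℝ ∞ (f i)) ∧ ∀ n ≤ N, ∃ (C : ℝ) (q : ℕ), 0 ≤ C ∧
    ∀ i ξ, ‖iteratedFDeriv ℝ n (f i) ξ‖ ≤ C * (1 + ‖ξ‖) ^ q * G i ξ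

theorem natCast_le_infty (n : ℕ) : ((n : ℕ∞) : WithTop ℕ∞) ≤ (∞ : WithTop ℕ∞) := by
  exact_mod_cast le_top

theorem DerivBound.mono {N : ℕ} {f : ι → E → F} {G H : ι → E → ℝ} (h : DerivBound N f G)
    {A : ℝ} (hA : 0 ≤ A) (hGH : ∀ i ξ, G i ξ ≤ A * H i ξ) : DerivBound N f H := by
  refine ⟨h.1, fun n hn => ?_⟩
  obtain ⟨C, q, hC, hb⟩ := h.2 n hn
  refine ⟨C * A, q, by positivity, fun i ξ => (hb i ξ).trans ?_⟩
  calc C * (1 + ‖ξ‖) ^ q * G i ξ ≤ C * (1 + ‖ξ‖) ^ q * (A * H i ξ) := by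
        gcongr; exact hGH i ξ
    _ = _ := by ring

theorem DerivBound.neg {N : ℕ} {f : ι → E → F} {G : ι → E → ℝ} (h : DerivBound N f G) :
    DerivBound N (fun i ξ => -f i ξ) G := by
  refine ⟨fun i => (h.1 i).neg, fun n hn => ?_⟩
  obtain ⟨C, q, hC, hb⟩ := h.2 n hn
  refine ⟨C, q, hC, fun i ξ => ?_⟩
  have : iteratedFDeriv ℝ n (fun ξ => -f i ξ) ξ = -iteratedFDeriv ℝ n (f i) ξ :=
    iteratedFDeriv_neg_apply
  rw [this, norm_neg]
  exact hb i ξ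

theorem DerivBound.add {N : ℕ} {f g : ι → E → F} {G : ι → E → ℝ} (hG : ∀ i ξ, 0 ≤ G i ξ)
    (hf : DerivBound N f G) (hg : DerivBound N g G) :
    DerivBound N (fun i ξ => f i ξ + g i ξ) G := by
  refine ⟨fun i => (hf.1 i).add (hg.1 i), fun n hn => ?_⟩
  obtain ⟨C, q, hC, hb⟩ := hf.2 n hn
  obtain ⟨C', q', hC', hb'⟩ := hg.2 n hn
  refine ⟨C + C', q + q', by positivity, fun i ξ => ?_⟩
  have he : iteratedFDeriv ℝ n (fun ξ => f i ξ + g i ξ) ξ =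
      iteratedFDeriv ℝ n (f i) ξ + iteratedFDeriv ℝ n (g i) ξ :=
    iteratedFDeriv_add_apply ((hf.1 i).of_le (natCast_le_infty n)).contDiffAt
      ((hg.1 i).of_le (natCast_le_infty n)).contDiffAt
  have h1 : (1 : ℝ) ≤ 1 + ‖ξ‖ := by linarith [norm_nonneg ξ]
  rw [he]
  calc _ ≤ C * (1 + ‖ξ‖) ^ q * G i ξ + C' * (1 + ‖ξ‖) ^ q' * G i ξ :=
        (norm_add_le _ _).trans (add_le_add (hb i ξ) (hb' i ξ))
    _ ≤ C * (1 + ‖ξ‖) ^ (q + q') * G i ξ + C' * (1 + ‖ξ‖) ^ (q + q') * G i ξ := by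
        have := hG i ξ
        gcongr <;> first | exact h1 | omega
    _ = _ := by ring

theorem DerivBound.smul {N : ℕ} {f : ι → E → ℝ} {g : ι → E → F} {G H : ι → E → ℝ}
    (hG : ∀ i ξ, 0 ≤ G i ξ) (hH : ∀ i ξ, 0 ≤ H i ξ)
    (hf : DerivBound N f G) (hg : DerivBound N g H) :
    DerivBound N (fun i ξ => f i ξ • g i ξ) (fun i ξ => G i ξ * H i ξ) := by
  refine ⟨fun i => (hf.1 i).smul (hg.1 i), fun n hn => ?_⟩
  have hf' : ∀ m, ∃ (C : ℝ) (q : ℕ), 0 ≤ C ∧ (m ≤ N →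
    ∀ i ξ, ‖iteratedFDeriv ℝ m (f i) ξ‖ ≤ C * (1 + ‖ξ‖) ^ q * G i ξ) := fun m => by
    by_cases hm : m ≤ N
    · obtain ⟨C, q, hC, hb⟩ := hf.2 m hm; exact ⟨C, q, hC, fun _ => hb⟩
    · exact ⟨0, 0, le_rfl, fun h => absurd h hm⟩
  have hg' : ∀ m, ∃ (C : ℝ) (q : ℕ), 0 ≤ C ∧ (m ≤ N →
    ∀ i ξ, ‖iteratedFDeriv ℝ m (g i) ξ‖ ≤ C * (1 + ‖ξ‖) ^ q * H i ξ) := fun m => by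
    by_cases hm : m ≤ N
    · obtain ⟨C, q, hC, hb⟩ := hg.2 m hm; exact ⟨C, q, hC, fun _ => hb⟩
    · exact ⟨0, 0, le_rfl, fun h => absurd h hm⟩
  choose A p hA hAb using hf'
  choose B r hB hBb using hg'
  refine ⟨∑ m ∈ Finset.range (n + 1), (n.choose m : ℝ) * A m * B (n - m),
    ∑ m ∈ Finset.range (n + 1), (p m + r (n - m)),
    Finset.sum_nonneg fun m _ => mul_nonneg (mul_nonneg (Nat.cast_nonneg _) (hA _)) (hB _),
    fun i ξ => ?_⟩
  refine (norm_iteratedFDeriv_smul_le (hf.1 i) (hg.1 i) ξ (natCast_le_infty n)).trans ?_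
  rw [Finset.sum_mul, Finset.sum_mul]
  refine Finset.sum_le_sum fun m hm => ?_
  have hmn : m ≤ n := Nat.lt_succ_iff.1 (Finset.mem_range.1 hm)
  have h1 : (1 : ℝ) ≤ 1 + ‖ξ‖ := by linarith [norm_nonneg ξ]
  have hq : p m + r (n - m) ≤ ∑ m ∈ Finset.range (n + 1), (p m + r (n - m)) :=
    Finset.single_le_sum (f := fun m => p m + r (n - m)) (fun _ _ => Nat.zero_le _) hm
  have hG' := hG i ξ
  have hH' := hH i ξ
  have hA' := hA m
  have hB' := hB (n - m)
  calc _ ≤ (n.choose m : ℝ) * (A m * (1 + ‖ξ‖) ^ p m * G i ξ) *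
          (B (n - m) * (1 + ‖ξ‖) ^ r (n - m) * H i ξ) := by
        gcongr
        · exact hAb m (hmn.trans hn) i ξ
        · exact hBb (n - m) ((Nat.sub_le _ _).trans hn) i ξ
    _ = (n.choose m : ℝ) * A m * B (n - m) * (1 + ‖ξ‖) ^ (p m + r (n - m)) *
          (G i ξ * H i ξ) := by ring
    _ ≤ _ := by gcongr

theorem DerivBound.fderiv_family {N : ℕ} {f : ι → E → F} {G : ι → E → ℝ}
    (h : DerivBound (N + 1) f G) : DerivBound N (fun i => fderiv ℝ (f i)) G := by
  refine ⟨fun i => (h.1 i).fderiv_right (by norm_cast), fun n hn => ?_⟩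
  obtain ⟨C, q, hC, hb⟩ := h.2 (n + 1) (by omega)
  exact ⟨C, q, hC, fun i ξ => by rw [norm_iteratedFDeriv_fderiv]; exact hb i ξ⟩

/-- Together with `DerivBound.fderiv_family`, this allows induction on the number of derivatives. -/
theorem DerivBound.of_fderiv {N : ℕ} {f : ι → E → F} {G : ι → E → ℝ}
    (h0 : DerivBound 0 f G) (h : DerivBound N (fun i => fderiv ℝ (f i)) G) :
    DerivBound (N + 1) f G := by
  refine ⟨h0.1, fun n hn => ?_⟩
  rcases n with _ | n
  · exact h0.2 0 le_rfl
  · obtain ⟨C, q, hC, hb⟩ := h.2 n (by omega)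
    exact ⟨C, q, hC, fun i ξ => by rw [← norm_iteratedFDeriv_fderiv]; exact hb i ξ⟩

/-- Derivatives of `e^{-a}` are of size `e^{-a}` up to polynomial weights. -/
theorem DerivBound.exp_neg {a : ι → E → ℝ} (ha : ∀ N, DerivBound N a fun _ _ => 1) (N : ℕ) :
    DerivBound N (fun i ξ => Real.exp (-a i ξ)) fun i ξ => Real.exp (-a i ξ) := by
  have hs : ∀ i, ContDiff ℝ ∞ fun ξ => Real.exp (-a i ξ) := fun i => ((ha 0).1 i).neg.exp
  have h0 : DerivBound 0 (fun i ξ => Real.exp (-a i ξ)) fun i ξ => Real.exp (-a i ξ) := by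
    refine ⟨hs, fun n hn => ⟨1, 0, zero_le_one, fun i ξ => ?_⟩⟩
    obtain rfl := Nat.le_zero.1 hn
    simp
  induction N with
  | zero => exact h0
  | succ N ih =>
    refine h0.of_fderiv ?_
    have h := ih.smul (fun _ _ => (Real.exp_pos _).le) (fun _ _ => zero_le_one)
      (ha (N + 1)).fderiv_family.neg
    have hd : (fun i => fderiv ℝ fun ξ => Real.exp (-a i ξ)) =
        fun i ξ => Real.exp (-a i ξ) • -fderiv ℝ (a i) ξ := by
      funext i ξ
      have hda : DifferentiableAt ℝ (a i) ξ := ((ha 0).1 i).differentiable (by simp) ξ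
      exact hda.hasFDerivAt.neg.exp.fderiv
    rw [hd]
    simpa using h

/-- The bound `e^{-u} - e^{-v} ≤ (v - u) e^{-u}` for `u ≤ v`, in a symmetric form. -/
theorem abs_exp_neg_sub_exp_neg_le (u v : ℝ) :
    |Real.exp (-u) - Real.exp (-v)| ≤ |u - v| * (Real.exp (-u) + Real.exp (-v)) := by
  wlog h : u ≤ v generalizing u v
  · rw [abs_sub_comm, abs_sub_comm u v, add_comm]; exact this v u (le_of_not_ge h)
  have h1 : Real.exp (-v) ≤ Real.exp (-u) := Real.exp_le_exp.2 (by linarith)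
  rw [abs_of_nonneg (by linarith), abs_of_nonpos (by linarith)]
  have h2 : Real.exp (-v) = Real.exp (-u) * Real.exp (u - v) := by
    rw [← Real.exp_add]; ring_nf
  have h3 := Real.add_one_le_exp (u - v)
  have h4 := Real.exp_pos (-u)
  have h5 := Real.exp_pos (-v)
  nlinarith [mul_nonneg (sub_nonneg.2 h) h5.le]

/-- Lipschitz dependence of `e^{-a}` and its derivatives on `a`. -/
theorem DerivBound.exp_neg_sub {a b : ι → E → ℝ} {ε : ι → ℝ} {G : E → ℝ}
    (hε : ∀ i, 0 ≤ ε i) (hG : ∀ ξ, 0 ≤ G ξ)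
    (ha : ∀ N, DerivBound N a fun _ _ => 1) (hb : ∀ N, DerivBound N b fun _ _ => 1)
    (hab : ∀ N, DerivBound N (fun i ξ => a i ξ - b i ξ) fun i _ => ε i)
    (haG : ∀ i ξ, Real.exp (-a i ξ) ≤ G ξ) (hbG : ∀ i ξ, Real.exp (-b i ξ) ≤ G ξ) (N : ℕ) :
    DerivBound N (fun i ξ => Real.exp (-a i ξ) - Real.exp (-b i ξ)) fun i ξ => ε i * G ξ := by
  have hεG : ∀ i ξ, 0 ≤ ε i * G ξ := fun i ξ => mul_nonneg (hε i) (hG ξ)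
  have h0 : DerivBound 0 (fun i ξ => Real.exp (-a i ξ) - Real.exp (-b i ξ))
      fun i ξ => ε i * G ξ := by
    obtain ⟨C, q, hC, hb'⟩ := (hab 0).2 0 le_rfl
    refine ⟨fun i => ((ha 0).1 i).neg.exp.sub ((hb 0).1 i).neg.exp,
      fun n hn => ⟨C * 2, q, by positivity, fun i ξ => ?_⟩⟩
    obtain rfl := Nat.le_zero.1 hn
    have h := hb' i ξ
    rw [norm_iteratedFDeriv_zero, Real.norm_eq_abs] at h ⊢
    calc _ ≤ |a i ξ - b i ξ| * (Real.exp (-a i ξ) + Real.exp (-b i ξ)) :=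
          abs_exp_neg_sub_exp_neg_le _ _
      _ ≤ (C * (1 + ‖ξ‖) ^ q * ε i) * (G ξ + G ξ) := by
          have := hε i
          gcongr
          · exact haG i ξ
          · exact hbG i ξ
      _ = _ := by ring
  induction N with
  | zero => exact h0
  | succ N ih =>
    refine h0.of_fderiv ?_
    have hE : DerivBound N (fun i ξ => Real.exp (-a i ξ)) fun _ ξ => G ξ :=
      (DerivBound.exp_neg ha N).mono zero_le_one fun i ξ => by rw [one_mul]; exact haG i ξ
    have h1 := hE.smul (fun _ ξ => hG ξ) (fun i _ => hε i) (hab (N + 1)).fderiv_family.neg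
    have h2 := ih.smul hεG (fun _ _ => zero_le_one) (hb (N + 1)).fderiv_family.neg
    have h1' := h1.mono (H := fun i ξ => ε i * G ξ) zero_le_one fun i ξ => by linarith
    have h2' := h2.mono (H := fun i ξ => ε i * G ξ) zero_le_one fun i ξ => by linarith
    have h := h1'.add hεG h2'
    -- `D(e^{-a} - e^{-b}) = e^{-a} D(b - a) + (e^{-a} - e^{-b}) D(-b)`
    convert h using 1
    funext i ξ
    have hda : DifferentiableAt ℝ (a i) ξ := ((ha 0).1 i).differentiable (by simp) ξ
    have hdb : DifferentiableAt ℝ (b i) ξ := ((hb 0).1 i).differentiable (by simp) ξ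
    have e1 := (hda.hasFDerivAt.neg.exp.sub hdb.hasFDerivAt.neg.exp).fderiv
    have e2 : fderiv ℝ (fun ξ => a i ξ - b i ξ) ξ =
      fderiv ℝ (a i) ξ - fderiv ℝ (b i) ξ :=
      (hda.hasFDerivAt.sub hdb.hasFDerivAt).fderiv
    refine e1.trans ?_
    rw [e2]
    module

end DerivBound

end DerivativeBounds

/-! ### The Lévy exponent: regularity, scaling, coercivity -/

section LevyExponent

variable {d : ℕ}

/-- `(|z|² ∧ 1) |z|^{-d-α}`: an integrable weight that dominates the integrands of Lévy
exponents. -/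
def levyWeight (α : ℝ) (z : Sp d) : ℝ := ‖z‖ ^ 2 * nearWeight α z + farWeight α z

theorem levyWeight_nonneg (α : ℝ) (z : Sp d) : 0 ≤ levyWeight α z :=
  add_nonneg (mul_nonneg (by positivity) (nearWeight_nonneg α z)) (farWeight_nonneg α z)

theorem integrable_levyWeight (hd : 1 ≤ d) {α : ℝ} (hα : α ∈ Set.Ioo (0 : ℝ) 2) :
    Integrable (levyWeight α : Sp d → ℝ) :=
  (integrable_sq_mul_nearWeight hd hα.2).add (integrable_farWeight hα.1)

theorem abs_one_sub_cos_mul_weight_le (α : ℝ) (ξ z : Sp d) :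
    |1 - Real.cos ⟪ξ, z⟫| * weight α z ≤ (‖ξ‖ ^ 2 + 2) * levyWeight α z := by
  rw [← nearWeight_add_farWeight, levyWeight]
  have hn := nearWeight_nonneg α z
  have hf := farWeight_nonneg α z
  have h1 : |1 - Real.cos ⟪ξ, z⟫| ≤ ‖ξ‖ ^ 2 * ‖z‖ ^ 2 := by
    refine (abs_one_sub_cos_le_sq _).trans ?_
    have : ⟪ξ, z⟫ ^ 2 ≤ (‖ξ‖ * ‖z‖) ^ 2 := by
      rw [← sq_abs]
      exact pow_le_pow_left₀ (abs_nonneg _) (abs_real_inner_le_norm ξ z) 2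
    nlinarith [sq_nonneg ⟪ξ, z⟫]
  have h2 := abs_one_sub_cos_le_two ⟪ξ, z⟫
  have h3 : 0 ≤ ‖ξ‖ ^ 2 := by positivity
  have h4 : 0 ≤ ‖z‖ ^ 2 * nearWeight α z := by positivity
  nlinarith [mul_le_mul_of_nonneg_right h1 hn, mul_le_mul_of_nonneg_right h2 hf,
    mul_nonneg h3 hf]

theorem IsKernel.pos {κ₀ κ₁ : ℝ} {κ : Sp d → ℝ} (h : IsKernel κ₀ κ₁ κ) (h0 : 0 < κ₀) (z : Sp d) :
    0 < κ z := h0.trans_le (h.lower z)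

theorem IsKernel.abs_le {κ₀ κ₁ : ℝ} {κ : Sp d → ℝ} (h : IsKernel κ₀ κ₁ κ) (h0 : 0 < κ₀)
    (z : Sp d) : |κ z| ≤ κ₁ := by
  rw [abs_of_pos (h.pos h0 z)]; exact h.upper z

theorem IsKernel.comp_smul {κ₀ κ₁ : ℝ} {κ : Sp d → ℝ} (h : IsKernel κ₀ κ₁ κ) (s : ℝ) :
    IsKernel κ₀ κ₁ fun z => κ (s • z) :=
  ⟨h.measurable.comp (measurable_const_smul s), fun z => by rw [smul_neg]; exact h.symm _,
    fun z => h.lower _, fun z => h.upper _⟩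

theorem isKernel_one : IsKernel 1 1 (fun _ : Sp d => (1 : ℝ)) :=
  ⟨measurable_const, fun _ => rfl, fun _ => le_rfl, fun _ => le_rfl⟩

section Exponent

variable {α κ₀ κ₁ : ℝ} {κ : Sp d → ℝ}

theorem norm_exponent_integrand_le (h0 : 0 < κ₀) (h : IsKernel κ₀ κ₁ κ) (ξ z : Sp d) :
    ‖(1 - Real.cos ⟪ξ, z⟫) * κ z * weight α z‖ ≤ κ₁ * ((‖ξ‖ ^ 2 + 2) * levyWeight α z) := by
  rw [norm_mul, norm_mul, Real.norm_eq_abs, Real.norm_eq_abs, Real.norm_of_nonneg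
    (weight_nonneg α z)]
  calc _ = |κ z| * (|1 - Real.cos ⟪ξ, z⟫| * weight α z) := by ring
    _ ≤ _ := mul_le_mul (h.abs_le h0 z) (abs_one_sub_cos_mul_weight_le α ξ z)
        (mul_nonneg (abs_nonneg _) (weight_nonneg α z)) ((abs_nonneg _).trans (h.abs_le h0 z))

theorem measurable_exponent_integrand (h : IsKernel κ₀ κ₁ κ) (ξ : Sp d) :
    Measurable fun z => (1 - Real.cos ⟪ξ, z⟫) * κ z * weight α z := by
  have h1 := h.measurable
  have h2 := measurable_weight (d := d) α
  fun_prop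

theorem integrable_exponent_integrand (hd : 1 ≤ d) (hα : α ∈ Set.Ioo (0 : ℝ) 2) (h0 : 0 < κ₀)
    (h : IsKernel κ₀ κ₁ κ) (ξ : Sp d) :
    Integrable fun z => (1 - Real.cos ⟪ξ, z⟫) * κ z * weight α z :=
  (((integrable_levyWeight hd hα).const_mul _).const_mul _).mono'
    (measurable_exponent_integrand h ξ).aestronglyMeasurable
    (ae_of_all _ fun z => norm_exponent_integrand_le h0 h ξ z)

theorem continuous_exponent (hd : 1 ≤ d) (hα : α ∈ Set.Ioo (0 : ℝ) 2) (h0 : 0 < κ₀)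
    (h : IsKernel κ₀ κ₁ κ) : Continuous (exponent α κ) := by
  have hκ₁ : 0 ≤ κ₁ := (abs_nonneg _).trans (h.abs_le h0 0)
  refine continuous_iff_continuousAt.2 fun ξ => ?_
  refine continuousAt_of_dominated
    (bound := fun z => κ₁ * (((‖ξ‖ + 1) ^ 2 + 2) * levyWeight α z))
    (Eventually.of_forall fun η => (measurable_exponent_integrand h η).aestronglyMeasurable)
    ?_ (((integrable_levyWeight hd hα).const_mul _).const_mul _)
    (ae_of_all _ fun z => by fun_prop)
  filter_upwards [Metric.ball_mem_nhds ξ one_pos] with η hη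
  refine ae_of_all _ fun z => (norm_exponent_integrand_le h0 h η z).trans ?_
  have := levyWeight_nonneg α z
  have h2 : ‖η - ξ‖ < 1 := by simpa [dist_eq_norm] using hη
  have h3 : ‖η‖ ≤ ‖ξ‖ + 1 := by linarith [norm_sub_norm_le η ξ]
  gcongr

theorem exponent_nonneg (h0 : 0 < κ₀) (h : IsKernel κ₀ κ₁ κ) (ξ : Sp d) : 0 ≤ exponent α κ ξ :=
  integral_nonneg fun z => mul_nonneg (mul_nonneg (by linarith [Real.cos_le_one ⟪ξ, z⟫])
    (h.pos h0 z).le) (weight_nonneg α z)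

theorem exponent_le (hd : 1 ≤ d) (hα : α ∈ Set.Ioo (0 : ℝ) 2) (h0 : 0 < κ₀)
    (h : IsKernel κ₀ κ₁ κ) (ξ : Sp d) :
    exponent α κ ξ ≤ κ₁ * ((‖ξ‖ ^ 2 + 2) * ∫ z : Sp d, levyWeight α z) := by
  rw [← integral_const_mul, ← integral_const_mul]
  refine integral_mono (integrable_exponent_integrand hd hα h0 h ξ)
    (((integrable_levyWeight hd hα).const_mul _).const_mul _) fun z => ?_
  exact (le_abs_self _).trans (norm_exponent_integrand_le h0 h ξ z)

theorem weight_smul {s : ℝ} (hs : 0 < s) (z : Sp d) :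
    weight α (s • z) = s ^ (-(d : ℝ) - α) * weight α z := by
  unfold weight
  rw [norm_smul, Real.norm_of_nonneg hs.le, Real.mul_rpow hs.le (norm_nonneg z)]

theorem integral_comp_smul_pos (f : Sp d → ℝ) {s : ℝ} (hs : 0 < s) :
    ∫ z, f (s • z) = s ^ (-(d : ℝ)) * ∫ z, f z := by
  rw [Measure.integral_comp_smul, finrank_euclideanSpace, Fintype.card_fin, smul_eq_mul,
    abs_of_pos (by positivity), Real.rpow_neg hs.le, Real.rpow_natCast]

/-- Scaling of the Lévy exponent. -/
theorem exponent_smul {s : ℝ} (hs : 0 < s) (κ : Sp d → ℝ) (ξ : Sp d) :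
    exponent α (fun z => κ (s • z)) (s • ξ) = s ^ α * exponent α κ ξ := by
  have h := integral_comp_smul_pos (fun z => (1 - Real.cos ⟪ξ, z⟫) * κ z * weight α z) hs
  have h2 : ∀ z : Sp d, (1 - Real.cos ⟪ξ, s • z⟫) * κ (s • z) * weight α (s • z) =
      s ^ (-(d : ℝ) - α) * ((1 - Real.cos ⟪s • ξ, z⟫) * κ (s • z) * weight α z) := fun z => by
    rw [weight_smul hs, inner_smul_right, inner_smul_left]
    simp only [conj_trivial]
    ring
  simp_rw [h2] at h
  rw [integral_const_mul] at h
  have h3 : s ^ (-(d : ℝ) - α) * s ^ α = s ^ (-(d : ℝ)) := by rw [← Real.rpow_add hs]; ring_nf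
  have h4 : 0 < s ^ (-(d : ℝ) - α) := by positivity
  have h5 : s ^ (-(d : ℝ) - α) * exponent α (fun z => κ (s • z)) (s • ξ) =
      s ^ (-(d : ℝ) - α) * (s ^ α * exponent α κ ξ) := by
    rw [← mul_assoc, h3]; exact h
  exact mul_left_cancel₀ h4.ne' h5

theorem exponent_one_pos (hd : 1 ≤ d) (hα : α ∈ Set.Ioo (0 : ℝ) 2) {ξ : Sp d} (hξ : ξ ≠ 0) :
    0 < exponent α (fun _ => 1) ξ := by
  have hnn : 0 ≤ fun z : Sp d => (1 - Real.cos ⟪ξ, z⟫) * 1 * weight α z := fun z =>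
    mul_nonneg (mul_nonneg (by linarith [Real.cos_le_one ⟪ξ, z⟫]) zero_le_one) (weight_nonneg α z)
  refine (integral_pos_iff_support_of_nonneg hnn
    (integrable_exponent_integrand hd hα one_pos isKernel_one ξ)).2 ?_
  -- a nonempty open set on which the integrand is positive
  let U : Set (Sp d) := {z | 0 < ⟪ξ, z⟫} ∩ {z | ⟪ξ, z⟫ < 1}
  have hU : IsOpen U := (isOpen_lt continuous_const (by fun_prop)).inter
    (isOpen_lt (by fun_prop) continuous_const)
  have hne : U.Nonempty := by
    have hn : ‖ξ‖ ≠ 0 := norm_ne_zero_iff.2 hξ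
    have : ⟪ξ, ((1 / 2 : ℝ) * (‖ξ‖ ^ 2)⁻¹) • ξ⟫ = 1 / 2 := by
      rw [inner_smul_right, real_inner_self_eq_norm_sq]
      field_simp
    refine ⟨((1 / 2 : ℝ) * (‖ξ‖ ^ 2)⁻¹) • ξ, ?_, ?_⟩
    · rw [Set.mem_ofPred_eq, this]; norm_num
    · rw [Set.mem_ofPred_eq, this]; norm_num
  refine (hU.measure_pos volume hne).trans_le (measure_mono fun z hz => ?_)
  have hz1 : 0 < ⟪ξ, z⟫ := hz.1
  have hz2 : ⟪ξ, z⟫ < 1 := hz.2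
  have hz0 : z ≠ 0 := by rintro rfl; simp at hz1
  have hc : Real.cos ⟪ξ, z⟫ < 1 := by
    rw [← Real.cos_zero]
    exact Real.cos_lt_cos_of_nonneg_of_le_pi le_rfl (by linarith [Real.pi_gt_three]) hz1
  have hw : 0 < weight α z := by
    unfold weight; exact Real.rpow_pos_of_pos (norm_pos_iff.2 hz0) _
  exact (mul_pos (mul_pos (by linarith) one_pos) hw).ne'

/-- Coercivity of the exponent, uniformly over the kernels: by monotonicity it is enough to treat
`κ = 1`, and by scaling the unit sphere, which is compact. -/
theorem exists_le_exponent (hd : 1 ≤ d) (hα : α ∈ Set.Ioo (0 : ℝ) 2) (h0 : 0 < κ₀) (κ₁ : ℝ) :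
    ∃ c > 0, ∀ κ : Sp d → ℝ, IsKernel κ₀ κ₁ κ → ∀ ξ, c * ‖ξ‖ ^ α ≤ exponent α κ ξ := by
  have : Nonempty (Fin d) := ⟨⟨0, hd⟩⟩
  have hcont := continuous_exponent (κ := fun _ : Sp d => (1 : ℝ)) hd hα one_pos isKernel_one
  obtain ⟨e, he, hmin⟩ := (isCompact_sphere (0 : Sp d) 1).exists_isMinOn
    (NormedSpace.sphere_nonempty.2 zero_le_one) hcont.continuousOn
  have he0 : e ≠ 0 := by
    rintro rfl; simp at he
  refine ⟨κ₀ * exponent α (fun _ => 1) e, mul_pos h0 (exponent_one_pos hd hα he0),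
    fun κ h ξ => ?_⟩
  have h1 : exponent α (fun _ => 1) e * ‖ξ‖ ^ α ≤ exponent α (fun _ => 1) ξ := by
    rcases eq_or_ne ξ 0 with rfl | hξ
    · simp [Real.zero_rpow hα.1.ne', exponent]
    · have hn : 0 < ‖ξ‖ := norm_pos_iff.2 hξ
      have hs := exponent_smul (α := α) (inv_pos.2 hn) (fun _ : Sp d => (1 : ℝ)) ξ
      have hm : exponent α (fun _ => 1) e ≤ exponent α (fun _ => 1) (‖ξ‖⁻¹ • ξ) :=
        hmin (by simp [norm_smul, hn.ne'])
      rw [hs, Real.inv_rpow hn.le] at hm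
      have hp : 0 < ‖ξ‖ ^ α := by positivity
      calc _ ≤ (‖ξ‖ ^ α)⁻¹ * exponent α (fun _ => 1) ξ * ‖ξ‖ ^ α := by gcongr
        _ = _ := by field_simp
  have h2 : κ₀ * exponent α (fun _ => 1) ξ ≤ exponent α κ ξ := by
    unfold exponent
    rw [← integral_const_mul]
    refine integral_mono
      ((integrable_exponent_integrand hd hα one_pos isKernel_one ξ).const_mul κ₀)
      (integrable_exponent_integrand hd hα h0 h ξ) fun z => ?_
    have hc : 0 ≤ 1 - Real.cos ⟪ξ, z⟫ := by linarith [Real.cos_le_one ⟪ξ, z⟫]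
    have := mul_le_mul_of_nonneg_right (mul_le_mul_of_nonneg_left (h.lower z) hc)
      (weight_nonneg α z)
    simp only
    linarith
  calc _ = κ₀ * (exponent α (fun _ => 1) e * ‖ξ‖ ^ α) := by ring
    _ ≤ _ := (mul_le_mul_of_nonneg_left h1 h0.le).trans h2

end Exponent

/-- Stretched exponentials beat polynomials. -/
theorem exists_pow_mul_exp_le {α c : ℝ} (hα : 0 < α) (hc : 0 < c) (N : ℕ) :
    ∃ C, 0 ≤ C ∧ ∀ r : ℝ, 0 ≤ r → (1 + r) ^ N * Real.exp (-(c * r ^ α)) ≤ C := by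
  obtain ⟨n, hn⟩ := exists_nat_ge ((N : ℝ) / α)
  have hn' : (N : ℝ) ≤ α * n := by rw [div_le_iff₀ hα] at hn; linarith
  refine ⟨2 ^ N * (1 + (n.factorial : ℝ) / c ^ n), by positivity, fun r hr => ?_⟩
  have he : Real.exp (-(c * r ^ α)) ≤ 1 := Real.exp_le_one_iff.2 (by
    have : 0 ≤ c * r ^ α := by positivity
    linarith)
  have hf : (0 : ℝ) ≤ (n.factorial : ℝ) / c ^ n := by positivity
  rcases le_total r 1 with h | h
  · calc _ ≤ (2 : ℝ) ^ N * 1 := by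
          gcongr; linarith
      _ ≤ _ := by gcongr; linarith
  · have h1 : r ^ N ≤ (r ^ α) ^ n := by
      rw [← Real.rpow_natCast, ← Real.rpow_natCast, ← Real.rpow_mul hr]
      exact Real.rpow_le_rpow_of_exponent_le h hn'
    have h2 := Real.pow_div_factorial_le_exp (x := c * r ^ α) (by positivity) n
    have h3 : (r ^ α) ^ n * Real.exp (-(c * r ^ α)) ≤ (n.factorial : ℝ) / c ^ n := by
      rw [Real.exp_neg, ← div_eq_mul_inv, div_le_div_iff₀ (Real.exp_pos _) (by positivity)]
      rw [div_le_iff₀ (by positivity), mul_pow] at h2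
      linarith
    calc _ ≤ (2 * r) ^ N * Real.exp (-(c * r ^ α)) := by gcongr; linarith
      _ = 2 ^ N * (r ^ N * Real.exp (-(c * r ^ α))) := by rw [mul_pow]; ring
      _ ≤ 2 ^ N * ((r ^ α) ^ n * Real.exp (-(c * r ^ α))) := by gcongr
      _ ≤ 2 ^ N * ((n.factorial : ℝ) / c ^ n) := by gcongr
      _ ≤ _ := by gcongr; linarith

end LevyExponent

/-! ### Fourier transforms of rapidly decreasing symbols, and the small jumps -/

section SmallJumps

open scoped FourierTransform

variable {d : ℕ}

/-- The profile `tail 1` serves as an integrable majorant for functions of the frequency. -/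
theorem exists_exp_mul_pow_le_tail_one (d : ℕ) {α c : ℝ} (hα : 0 < α) (hc : 0 < c) (N : ℕ) :
    ∃ C, 0 ≤ C ∧ ∀ ξ : Sp d, (1 + ‖ξ‖) ^ N * Real.exp (-(c * ‖ξ‖ ^ α)) ≤ C * tail 1 ξ := by
  obtain ⟨C, hC, h⟩ := exists_pow_mul_exp_le hα hc (N + (d + 1))
  refine ⟨C, hC, fun ξ => ?_⟩
  have h0 := norm_nonneg ξ
  have ht : tail 1 ξ = ((1 + ‖ξ‖) ^ (d + 1))⁻¹ := by
    rw [tail, ← Real.rpow_natCast, ← Real.rpow_neg (by positivity)]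
    congr 1; push_cast; ring
  have hp : 0 < (1 + ‖ξ‖) ^ (d + 1) := by positivity
  have h1 := h ‖ξ‖ h0
  rw [ht, ← div_eq_mul_inv, le_div_iff₀ hp]
  calc _ = (1 + ‖ξ‖) ^ (N + (d + 1)) * Real.exp (-(c * ‖ξ‖ ^ α)) := by ring
    _ ≤ C := h1

theorem continuous_exp_neg_rpow {α : ℝ} (hα : 0 < α) (c : ℝ) :
    Continuous fun ξ : Sp d => Real.exp (-(c * ‖ξ‖ ^ α)) := by
  refine Real.continuous_exp.comp (continuous_const.mul ?_).neg
  exact continuous_norm.rpow_const fun _ => Or.inr hα.le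

theorem integrable_pow_mul_exp {α c : ℝ} (hα : 0 < α) (hc : 0 < c) (N : ℕ) :
    Integrable fun ξ : Sp d => (1 + ‖ξ‖) ^ N * Real.exp (-(c * ‖ξ‖ ^ α)) := by
  obtain ⟨C, hC, h⟩ := exists_exp_mul_pow_le_tail_one d hα hc N
  refine ((integrable_tail one_pos).const_mul C).mono'
    ((by fun_prop : Continuous fun ξ : Sp d => (1 + ‖ξ‖) ^ N).mul
      (continuous_exp_neg_rpow hα c)).aestronglyMeasurable (ae_of_all _ fun ξ => ?_)
  rw [Real.norm_of_nonneg (by positivity)]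
  exact h ξ

/-- If all derivatives of `f i` are bounded by `ε i` times a stretched exponential, then all
derivatives of its Fourier transform are bounded by `ε i` times the profile `tail`, uniformly
in `i`. -/
theorem exists_norm_iteratedFDeriv_fourier_le {ι : Type*} {α c A : ℝ} (hα : α ∈ Set.Ioo (0 : ℝ) 2)
    (hc : 0 < c) (hA : 0 ≤ A) {f : ι → Sp d → ℝ} {ε : ι → ℝ} (hε : ∀ i, 0 ≤ ε i)
    (hf : ∀ N, DerivBound N f fun i ξ => ε i * (A * Real.exp (-(c * ‖ξ‖ ^ α)))) (n : ℕ) :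
    ∃ C, 0 ≤ C ∧ ∀ i x, ‖iteratedFDeriv ℝ n (𝓕 fun ξ => (f i ξ : ℂ)) x‖ ≤
      C * ε i * tail α x := by
  have hsm : ∀ i, ContDiff ℝ ∞ fun ξ => (f i ξ : ℂ) := fun i =>
    Complex.ofRealCLM.contDiff.comp ((hf 0).1 i)
  have hno : ∀ i j ξ, ‖iteratedFDeriv ℝ j (fun ξ => (f i ξ : ℂ)) ξ‖ =
      ‖iteratedFDeriv ℝ j (f i) ξ‖ := fun i j ξ =>
    Complex.ofRealLI.norm_iteratedFDeriv_comp_left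
      ((hf 0).1 i).contDiffAt (natCast_le_infty j)
  have hpt : ∀ k j : ℕ, ∃ C, 0 ≤ C ∧ ∀ i (ξ : Sp d),
      ‖ξ‖ ^ k * ‖iteratedFDeriv ℝ j (fun ξ => (f i ξ : ℂ)) ξ‖ ≤ C * ε i * tail 1 ξ := by
    intro k j
    obtain ⟨C, q, hC, hb⟩ := (hf j).2 j le_rfl
    obtain ⟨C', hC', hb'⟩ := exists_exp_mul_pow_le_tail_one d hα.1 hc (k + q)
    refine ⟨C * A * C', by positivity, fun i ξ => ?_⟩
    rw [hno]
    have hε' := hε i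
    calc _ ≤ (1 + ‖ξ‖) ^ k * (C * (1 + ‖ξ‖) ^ q * (ε i * (A * Real.exp (-(c * ‖ξ‖ ^ α))))) := by
          gcongr
          · linarith
          · exact hb i ξ
      _ = C * A * ε i * ((1 + ‖ξ‖) ^ (k + q) * Real.exp (-(c * ‖ξ‖ ^ α))) := by ring
      _ ≤ C * A * ε i * (C' * tail 1 ξ) := mul_le_mul_of_nonneg_left (hb' ξ) (by positivity)
      _ = _ := by ring
  choose C hC hb using hpt
  have hint : ∀ i (k j : ℕ), Integrable fun ξ : Sp d =>
      ‖ξ‖ ^ k * ‖iteratedFDeriv ℝ j (fun ξ => (f i ξ : ℂ)) ξ‖ := by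
    intro i k j
    refine ((integrable_tail one_pos).const_mul (C k j * ε i)).mono' ?_ (ae_of_all _ fun ξ => ?_)
    · exact ((continuous_norm.pow k).mul ((hsm i).continuous_iteratedFDeriv
        (natCast_le_infty j)).norm).aestronglyMeasurable
    · rw [Real.norm_of_nonneg (by positivity)]
      exact hb k j i ξ
  have hI : 0 ≤ ∫ ξ : Sp d, tail 1 ξ := integral_nonneg fun ξ => (tail_pos 1 ξ).le
  have hmain : ∀ m : ℕ, ∃ D, 0 ≤ D ∧ ∀ i (x : Sp d),
      ‖x‖ ^ m * ‖iteratedFDeriv ℝ n (𝓕 fun ξ => (f i ξ : ℂ)) x‖ ≤ D * ε i := by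
    intro m
    refine ⟨(2 * Real.pi) ^ n * (2 * n + 2) ^ m *
      ∑ p ∈ Finset.range (n + 1) ×ˢ Finset.range (m + 1), C p.1 p.2 * ∫ ξ : Sp d, tail 1 ξ,
      mul_nonneg (by positivity) (Finset.sum_nonneg fun p _ => mul_nonneg (hC _ _) hI),
      fun i x => ?_⟩
    refine (Real.pow_mul_norm_iteratedFDeriv_fourier_le (K := ⊤) (N := ⊤) (hsm i)
      (fun k j _ _ => hint i k j) le_top le_top x).trans ?_
    rw [mul_assoc _ _ (ε i), Finset.sum_mul]
    refine mul_le_mul_of_nonneg_left (Finset.sum_le_sum fun p _ => ?_) (by positivity)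
    calc _ ≤ ∫ ξ : Sp d, C p.1 p.2 * ε i * tail 1 ξ :=
          integral_mono (hint i _ _) ((integrable_tail one_pos).const_mul _) (hb p.1 p.2 i)
      _ = _ := by rw [integral_const_mul]; ring
  obtain ⟨D, hD, hDb⟩ := hmain 0
  obtain ⟨D', hD', hDb'⟩ := hmain (d + 2)
  refine ⟨2 ^ (d + 2) * (D + D'), by positivity, fun i x => ?_⟩
  have h0 := norm_nonneg x
  have h1 := hDb i x
  have h2 := hDb' i x
  set u := ‖iteratedFDeriv ℝ n (𝓕 fun ξ => (f i ξ : ℂ)) x‖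
  have hu : 0 ≤ u := norm_nonneg _
  have hε' := hε i
  rw [pow_zero, one_mul] at h1
  -- `d + 2 ≥ d + α`, so the weight `(1 + |x|)^{d+2}` suffices
  have hw : (1 + ‖x‖) ^ (d + 2) * u ≤ 2 ^ (d + 2) * (D + D') * ε i := by
    rcases le_total ‖x‖ 1 with h | h
    · calc _ ≤ (2 : ℝ) ^ (d + 2) * (D * ε i) := by
            gcongr; linarith
        _ ≤ _ := by
            rw [mul_assoc]; gcongr; linarith
    · calc _ ≤ (2 * ‖x‖) ^ (d + 2) * u := by gcongr; linarith
        _ = 2 ^ (d + 2) * (‖x‖ ^ (d + 2) * u) := by ring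
        _ ≤ 2 ^ (d + 2) * (D' * ε i) := by gcongr
        _ ≤ _ := by
            rw [mul_assoc]; gcongr; linarith
  have ht : ((1 + ‖x‖) ^ (d + 2))⁻¹ ≤ tail α x := by
    rw [tail, ← Real.rpow_natCast, ← Real.rpow_neg (by positivity)]
    refine Real.rpow_le_rpow_of_exponent_le (by linarith) ?_
    push_cast
    linarith [hα.2]
  calc u = (1 + ‖x‖) ^ (d + 2) * u * ((1 + ‖x‖) ^ (d + 2))⁻¹ := by field_simp
    _ ≤ (2 ^ (d + 2) * (D + D') * ε i) * tail α x := by gcongr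

section Split

variable {α κ₀ κ₁ : ℝ} {κ : Sp d → ℝ}

theorem nearWeight_le_weight (α : ℝ) (z : Sp d) : nearWeight α z ≤ weight α z := by
  rw [← nearWeight_add_farWeight]; linarith [farWeight_nonneg α z]

theorem farWeight_le_weight (α : ℝ) (z : Sp d) : farWeight α z ≤ weight α z := by
  rw [← nearWeight_add_farWeight]; linarith [nearWeight_nonneg α z]

theorem integrable_symb_integrand (hd : 1 ≤ d) (hα : α ∈ Set.Ioo (0 : ℝ) 2) {k : Sp d → ℝ}
    (hk : Measurable k) {B : ℝ} (hB : 0 ≤ B) (hkB : ∀ z, |k z| ≤ B * weight α z) (ξ : Sp d) :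
    Integrable fun z => (1 - Real.cos (2 * Real.pi * ⟪z, ξ⟫)) * k z := by
  refine (((integrable_levyWeight hd hα).const_mul (‖(2 * Real.pi) • ξ‖ ^ 2 + 2)).const_mul
    B).mono' (by fun_prop) (ae_of_all _ fun z => ?_)
  have h := abs_one_sub_cos_mul_weight_le α ((2 * Real.pi) • ξ) z
  have e : ⟪(2 * Real.pi) • ξ, z⟫ = 2 * Real.pi * ⟪z, ξ⟫ := by
    rw [inner_smul_left, real_inner_comm]; simp
  rw [e] at h
  rw [norm_mul, Real.norm_eq_abs, Real.norm_eq_abs]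
  calc _ ≤ |1 - Real.cos (2 * Real.pi * ⟪z, ξ⟫)| * (B * weight α z) := by
        gcongr; exact hkB z
    _ = B * (|1 - Real.cos (2 * Real.pi * ⟪z, ξ⟫)| * weight α z) := by ring
    _ ≤ _ := by gcongr

theorem exponent_two_pi_smul (κ : Sp d → ℝ) (ξ : Sp d) :
    exponent α κ ((2 * Real.pi) • ξ) = symb (fun z => κ z * weight α z) ξ := by
  unfold exponent symb
  congr 1; funext z
  rw [inner_smul_left, real_inner_comm]
  simp only [conj_trivial]
  ring

theorem symb_add (hd : 1 ≤ d) (hα : α ∈ Set.Ioo (0 : ℝ) 2) {k k' : Sp d → ℝ}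
    (hk : Measurable k) (hk' : Measurable k') {B : ℝ} (hB : 0 ≤ B)
    (hkB : ∀ z, |k z| ≤ B * weight α z) (hkB' : ∀ z, |k' z| ≤ B * weight α z) (ξ : Sp d) :
    symb (fun z => k z + k' z) ξ = symb k ξ + symb k' ξ := by
  unfold symb
  rw [← integral_add (integrable_symb_integrand hd hα hk hB hkB ξ)
    (integrable_symb_integrand hd hα hk' hB hkB' ξ)]
  congr 1; funext z; ring

theorem symb_sub (hd : 1 ≤ d) (hα : α ∈ Set.Ioo (0 : ℝ) 2) {k k' : Sp d → ℝ}
    (hk : Measurable k) (hk' : Measurable k') {B : ℝ} (hB : 0 ≤ B)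
    (hkB : ∀ z, |k z| ≤ B * weight α z) (hkB' : ∀ z, |k' z| ≤ B * weight α z) (ξ : Sp d) :
    symb (fun z => k z - k' z) ξ = symb k ξ - symb k' ξ := by
  unfold symb
  rw [← integral_sub (integrable_symb_integrand hd hα hk hB hkB ξ)
    (integrable_symb_integrand hd hα hk' hB hkB' ξ)]
  congr 1; funext z; ring

/-- The density of the jumps of size at most one. -/
def nearJump (α : ℝ) (κ : Sp d → ℝ) (z : Sp d) : ℝ := κ z * nearWeight α z

/-- The density of the jumps of size larger than one. -/
def farJump (α : ℝ) (κ : Sp d → ℝ) (z : Sp d) : ℝ := κ z * farWeight α z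

theorem measurable_nearJump (h : Measurable κ) : Measurable (nearJump α κ) :=
  h.mul (measurable_nearWeight α)

theorem measurable_farJump (h : Measurable κ) : Measurable (farJump α κ) :=
  h.mul (measurable_farWeight α)

theorem abs_nearJump_le {z : Sp d} {B : ℝ} (h : |κ z| ≤ B) :
    |nearJump α κ z| ≤ B * nearWeight α z := by
  rw [nearJump, abs_mul, abs_of_nonneg (nearWeight_nonneg α z)]
  exact mul_le_mul_of_nonneg_right h (nearWeight_nonneg α z)

theorem abs_farJump_le {z : Sp d} {B : ℝ} (h : |κ z| ≤ B) :
    |farJump α κ z| ≤ B * farWeight α z := by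
  rw [farJump, abs_mul, abs_of_nonneg (farWeight_nonneg α z)]
  exact mul_le_mul_of_nonneg_right h (farWeight_nonneg α z)

theorem IsKernel.le_nonneg (h : IsKernel κ₀ κ₁ κ) (h0 : 0 < κ₀) : 0 ≤ κ₁ :=
  (abs_nonneg _).trans (h.abs_le h0 0)

theorem IsKernel.abs_nearJump_le_weight (h : IsKernel κ₀ κ₁ κ) (h0 : 0 < κ₀) (z : Sp d) :
    |nearJump α κ z| ≤ κ₁ * weight α z :=
  (abs_nearJump_le (h.abs_le h0 z)).trans
    (mul_le_mul_of_nonneg_left (nearWeight_le_weight α z) (h.le_nonneg h0))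

theorem IsKernel.abs_farJump_le_weight (h : IsKernel κ₀ κ₁ κ) (h0 : 0 < κ₀) (z : Sp d) :
    |farJump α κ z| ≤ κ₁ * weight α z :=
  (abs_farJump_le (h.abs_le h0 z)).trans
    (mul_le_mul_of_nonneg_left (farWeight_le_weight α z) (h.le_nonneg h0))

theorem exponent_eq_near_add_far (hd : 1 ≤ d) (hα : α ∈ Set.Ioo (0 : ℝ) 2) (h0 : 0 < κ₀)
    (h : IsKernel κ₀ κ₁ κ) (ξ : Sp d) :
    exponent α κ ((2 * Real.pi) • ξ) = symb (nearJump α κ) ξ + symb (farJump α κ) ξ := by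
  rw [exponent_two_pi_smul, ← symb_add hd hα (measurable_nearJump h.measurable)
    (measurable_farJump h.measurable) (h.le_nonneg h0) (h.abs_nearJump_le_weight h0)
    (h.abs_farJump_le_weight h0)]
  congr 1; funext z
  rw [nearJump, farJump, ← mul_add, nearWeight_add_farWeight]

theorem norm_le_norm_two_pi_smul (ξ : Sp d) : ‖ξ‖ ≤ ‖(2 * Real.pi) • ξ‖ := by
  rw [norm_smul, Real.norm_of_nonneg (by positivity)]
  nlinarith [norm_nonneg ξ, Real.pi_gt_three]

theorem symb_farJump_le (hα : 0 < α) (h0 : 0 < κ₀) (h : IsKernel κ₀ κ₁ κ) (ξ : Sp d) :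
    symb (farJump α κ) ξ ≤ κ₁ * (2 * ∫ z : Sp d, farWeight α z) := by
  rw [← integral_const_mul, ← integral_const_mul]
  have hfw := (((integrable_farWeight (d := d) hα).const_mul 2).const_mul κ₁)
  have hb : ∀ z : Sp d, ‖(1 - Real.cos (2 * Real.pi * ⟪z, ξ⟫)) * farJump α κ z‖ ≤
      κ₁ * (2 * farWeight α z) := fun z => by
    rw [norm_mul, Real.norm_eq_abs, Real.norm_eq_abs]
    calc _ ≤ 2 * (κ₁ * farWeight α z) := mul_le_mul (abs_one_sub_cos_le_two _)
          (abs_farJump_le (h.abs_le h0 z)) (abs_nonneg _) zero_le_two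
      _ = _ := by ring
  have hm := measurable_farJump (α := α) h.measurable
  refine integral_mono (hfw.mono' (by fun_prop) (ae_of_all _ hb)) hfw fun z => ?_
  exact (le_abs_self _).trans (hb z)

/-- The large jumps change the exponent by a bounded amount only, so that the exponent of the small
jumps inherits the coercivity of the full one. -/
theorem exp_neg_symb_near_le (hd : 1 ≤ d) (hα : α ∈ Set.Ioo (0 : ℝ) 2) (h0 : 0 < κ₀)
    (h : IsKernel κ₀ κ₁ κ) {c : ℝ} (hc : 0 < c) (hlow : ∀ ξ, c * ‖ξ‖ ^ α ≤ exponent α κ ξ)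
    (ξ : Sp d) : Real.exp (-symb (nearJump α κ) ξ) ≤
      Real.exp (κ₁ * (2 * ∫ z : Sp d, farWeight α z)) * Real.exp (-(c * ‖ξ‖ ^ α)) := by
  rw [← Real.exp_add]
  refine Real.exp_le_exp.2 ?_
  have h1 := symb_farJump_le hα.1 h0 h ξ
  have h2 := exponent_eq_near_add_far hd hα h0 h ξ
  have h3 := hlow ((2 * Real.pi) • ξ)
  have h4 : c * ‖ξ‖ ^ α ≤ c * ‖(2 * Real.pi) • ξ‖ ^ α :=
    mul_le_mul_of_nonneg_left (Real.rpow_le_rpow (norm_nonneg _) (norm_le_norm_two_pi_smul ξ)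
      hα.1.le) hc.le
  linarith

theorem derivBound_symb_nearJump (hd : 1 ≤ d) (hα : α ∈ Set.Ioo (0 : ℝ) 2) (h0 : 0 < κ₀)
    {ι : Type*} (k : ι → Sp d → ℝ) (hk : ∀ i, IsKernel κ₀ κ₁ (k i)) (N : ℕ) :
    DerivBound N (fun i => symb (nearJump α (k i))) fun _ _ => 1 := by
  have hm := fun i => contDiff_symb_near hd hα.2 (measurable_nearJump (hk i).measurable)
    (ae_of_all _ fun z => abs_nearJump_le ((hk i).abs_le h0 z))
  refine ⟨fun i => (hm i).1, fun n _ => ⟨|κ₁| * ((2 * Real.pi) ^ (n + 2) * nearMoment d α), 2,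
    mul_nonneg (abs_nonneg _) (mul_nonneg (by positivity) (nearMoment_nonneg α)),
    fun i ξ => ?_⟩⟩
  rw [abs_of_nonneg ((hk i).le_nonneg h0), mul_one]
  exact (hm i).2 n ξ

end Split

/-- The transition density at time one of the process with jumps of size at most one, and all its
derivatives, are dominated by `tail`. -/
theorem exists_fourier_near_le (hd : 1 ≤ d) {α κ₀ : ℝ} (hα : α ∈ Set.Ioo (0 : ℝ) 2)
    (h0 : 0 < κ₀) (κ₁ : ℝ) (n : ℕ) :
    ∃ C, 0 ≤ C ∧ ∀ κ : Sp d → ℝ, IsKernel κ₀ κ₁ κ → ∀ x,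
      ‖iteratedFDeriv ℝ n (𝓕 fun ξ => (Real.exp (-symb (nearJump α κ) ξ) : ℂ)) x‖ ≤
        C * tail α x := by
  obtain ⟨c, hc, hlow⟩ := exists_le_exponent hd hα h0 κ₁
  let ι := {κ : Sp d → ℝ // IsKernel κ₀ κ₁ κ}
  have ha := derivBound_symb_nearJump hd hα h0 (fun i : ι => i.1) fun i => i.2
  obtain ⟨C, hC, h⟩ := exists_norm_iteratedFDeriv_fourier_le hα hc
    (Real.exp_pos (κ₁ * (2 * ∫ z : Sp d, farWeight α z))).le
    (f := fun (i : ι) ξ => Real.exp (-symb (nearJump α i.1) ξ)) (ε := fun _ => 1)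
    (fun _ => zero_le_one) (fun N => (DerivBound.exp_neg ha N).mono zero_le_one fun i ξ => by
      rw [one_mul, one_mul]
      exact exp_neg_symb_near_le hd hα h0 i.2 hc (hlow i.1 i.2) ξ) n
  refine ⟨C, hC, fun κ hκ x => ?_⟩
  simpa using h ⟨κ, hκ⟩ x

/-- Lipschitz dependence on the kernel of the transition density of the process with jumps of size
at most one. -/
theorem exists_fourier_near_sub_le (hd : 1 ≤ d) {α κ₀ : ℝ} (hα : α ∈ Set.Ioo (0 : ℝ) 2)
    (h0 : 0 < κ₀) (κ₁ : ℝ) (n : ℕ) :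
    ∃ C, 0 ≤ C ∧ ∀ κ κ' : Sp d → ℝ, IsKernel κ₀ κ₁ κ → IsKernel κ₀ κ₁ κ' → ∀ ε, 0 ≤ ε →
      (∀ᵐ z, |κ z - κ' z| ≤ ε) → ∀ x,
      ‖iteratedFDeriv ℝ n (𝓕 fun ξ => ((Real.exp (-symb (nearJump α κ) ξ) -
        Real.exp (-symb (nearJump α κ') ξ) : ℝ) : ℂ)) x‖ ≤ C * ε * tail α x := by
  obtain ⟨c, hc, hlow⟩ := exists_le_exponent hd hα h0 κ₁
  -- the family is indexed by the pairs of kernels together with a bound for their distance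
  let ι := {p : (Sp d → ℝ) × (Sp d → ℝ) × ℝ // IsKernel κ₀ κ₁ p.1 ∧ IsKernel κ₀ κ₁ p.2.1 ∧
    0 ≤ p.2.2 ∧ ∀ᵐ z, |p.1 z - p.2.1 z| ≤ p.2.2}
  have hsub : ∀ (i : ι) (ξ : Sp d),
      symb (nearJump α i.1.1) ξ - symb (nearJump α i.1.2.1) ξ =
        symb (nearJump α fun z => i.1.1 z - i.1.2.1 z) ξ := fun i ξ => by
    rw [← symb_sub hd hα (measurable_nearJump i.2.1.measurable)
      (measurable_nearJump i.2.2.1.measurable) (i.2.1.le_nonneg h0)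
      (i.2.1.abs_nearJump_le_weight h0) (i.2.2.1.abs_nearJump_le_weight h0)]
    congr 1; funext z; simp only [nearJump]; ring
  have hab : ∀ N, DerivBound N (fun (i : ι) ξ => symb (nearJump α i.1.1) ξ -
      symb (nearJump α i.1.2.1) ξ) fun i _ => i.1.2.2 := fun N => by
    simp_rw [hsub]
    have hm := fun i : ι => contDiff_symb_near hd hα.2
      (measurable_nearJump (α := α) (i.2.1.measurable.sub i.2.2.1.measurable))
      (i.2.2.2.2.mono fun z hz => abs_nearJump_le hz)
    exact ⟨fun i => (hm i).1, fun n _ => ⟨(2 * Real.pi) ^ (n + 2) * nearMoment d α, 2,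
      mul_nonneg (by positivity) (nearMoment_nonneg α), fun i ξ =>
        ((hm i).2 n ξ).trans (le_of_eq (by ring))⟩⟩
  obtain ⟨C, hC, h⟩ := exists_norm_iteratedFDeriv_fourier_le hα hc
    (Real.exp_pos (κ₁ * (2 * ∫ z : Sp d, farWeight α z))).le
    (f := fun (i : ι) ξ => Real.exp (-symb (nearJump α i.1.1) ξ) -
      Real.exp (-symb (nearJump α i.1.2.1) ξ)) (ε := fun i => i.1.2.2)
    (fun i => i.2.2.2.1) (fun N => DerivBound.exp_neg_sub (fun i => i.2.2.2.1)
      (fun ξ => by positivity)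
      (derivBound_symb_nearJump hd hα h0 (fun i : ι => i.1.1) fun i => i.2.1)
      (derivBound_symb_nearJump hd hα h0 (fun i : ι => i.1.2.1) fun i => i.2.2.1) hab
      (fun i ξ => exp_neg_symb_near_le hd hα h0 i.2.1 hc (hlow _ i.2.1) ξ)
      (fun i ξ => exp_neg_symb_near_le hd hα h0 i.2.2.1 hc (hlow _ i.2.2.1) ξ) N) n
  exact ⟨C, hC, fun κ κ' hκ hκ' ε hε hae x => h ⟨(κ, κ', ε), hκ, hκ', hε, hae⟩ x⟩

end SmallJumps

/-! ### Exponentials of compound Poisson symbols -/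

section CompoundPoisson

open scoped FourierTransform

variable {d : ℕ}

/-- The cosine transform `∫ cos (2π⟨z,ξ⟩) f(z) dz`, which is the Fourier transform of `f` when `f`
is even. -/
def cosTransform (f : Sp d → ℝ) (ξ : Sp d) : ℝ := ∫ z, Real.cos (2 * Real.pi * ⟪z, ξ⟫) * f z

section CosTransform

variable {f : Sp d → ℝ}

theorem integrable_cos_mul (hf : Integrable f) (ξ : Sp d) :
    Integrable fun z => Real.cos (2 * Real.pi * ⟪z, ξ⟫) * f z :=
  hf.bdd_mul (c := 1) (by fun_prop) (ae_of_all _ fun z => Real.abs_cos_le_one _)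

theorem abs_cosTransform_le (hf : Integrable f) (ξ : Sp d) :
    |cosTransform f ξ| ≤ ∫ z, |f z| := by
  rw [← Real.norm_eq_abs]
  refine norm_integral_le_of_norm_le hf.abs (ae_of_all _ fun z => ?_)
  rw [norm_mul]
  exact mul_le_of_le_one_left (abs_nonneg _) (Real.abs_cos_le_one _)

theorem continuous_cosTransform (hf : Integrable f) : Continuous (cosTransform f) := by
  refine continuous_of_dominated (bound := fun z => |f z|)
    (fun ξ => (integrable_cos_mul hf ξ).aestronglyMeasurable) (fun ξ => ae_of_all _ fun z => ?_)
    hf.abs (ae_of_all _ fun z => by fun_prop)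
  rw [norm_mul]
  exact mul_le_of_le_one_left (abs_nonneg _) (Real.abs_cos_le_one _)

theorem symb_eq_sub_cosTransform (hf : Integrable f) (ξ : Sp d) :
    symb f ξ = (∫ z, f z) - cosTransform f ξ := by
  rw [symb, cosTransform, ← integral_sub hf (integrable_cos_mul hf ξ)]
  congr 1; funext z; ring

theorem ofReal_cosTransform (hf : Integrable f) (heven : ∀ z, f (-z) = f z) (ξ : Sp d) :
    (cosTransform f ξ : ℂ) = 𝓕 (fun z => (f z : ℂ)) ξ := by
  have hI : ∀ η : Sp d, Integrable fun z =>
      Complex.exp (↑(-2 * Real.pi * ⟪z, η⟫) * Complex.I) • (f z : ℂ) := fun η =>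
    hf.ofReal.bdd_mul (c := 1) (by fun_prop)
      (ae_of_all _ fun z => by rw [Complex.norm_exp_ofReal_mul_I])
  have h1 : 𝓕 (fun z => (f z : ℂ)) (-ξ) = 𝓕 (fun z => (f z : ℂ)) ξ := by
    rw [Real.fourier_eq', Real.fourier_eq', ← integral_neg_eq_self]
    congr 1; funext z
    rw [heven, inner_neg_neg]
  have h2 : 𝓕 (fun z => (f z : ℂ)) ξ + 𝓕 (fun z => (f z : ℂ)) (-ξ) =
      2 * (cosTransform f ξ : ℂ) := by
    rw [Real.fourier_eq', Real.fourier_eq', ← integral_add (hI ξ) (hI (-ξ)), cosTransform,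
      ← integral_complex_ofReal, ← integral_const_mul]
    congr 1; funext z
    rw [inner_neg_right, smul_eq_mul, smul_eq_mul, ← add_mul]
    push_cast
    rw [Complex.cos]
    ring_nf
  rw [h1, ← two_mul] at h2
  exact (mul_left_cancel₀ two_ne_zero h2).symm

variable {F : Type*} [NormedAddCommGroup F] [NormedSpace ℂ F] {m : Sp d → F}

theorem integrable_character_smul (hm : Integrable m) (x : Sp d) :
    Integrable fun ξ => Real.fourierChar (-⟪ξ, x⟫) • m ξ :=
  (Real.fourierIntegral_convergent_iff x).2 hm

theorem norm_fourier_le (m : Sp d → F) (x : Sp d) : ‖𝓕 m x‖ ≤ ∫ ξ, ‖m ξ‖ := by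
  rw [Real.fourier_eq]
  refine (norm_integral_le_integral_norm _).trans (le_of_eq ?_)
  simp_rw [Circle.norm_smul]

theorem continuous_fourier (hm : Integrable m) : Continuous (𝓕 m) :=
  VectorFourier.fourierIntegral_continuous Real.continuous_fourierChar
    (by exact continuous_inner) hm

theorem integrable_smul_of_bounded {g : Sp d → ℝ} (hg : Continuous g) {M : ℝ}
    (hM : ∀ ξ, |g ξ| ≤ M) (hm : Integrable m) : Integrable fun ξ => (g ξ : ℂ) • m ξ :=
  hm.bdd_smul M (Complex.continuous_ofReal.comp hg).aestronglyMeasurable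
    (ae_of_all _ fun ξ => by rw [Complex.norm_real]; exact hM ξ)

/-- Expansion of a bounded exponential multiplier under the Fourier transform. -/
theorem hasSum_fourier_exp_smul {g : Sp d → ℝ} (hg : Continuous g) {M : ℝ}
    (hM : ∀ ξ, |g ξ| ≤ M) (hm : Integrable m) (x : Sp d) :
    HasSum (fun n : ℕ => ((n.factorial : ℂ)⁻¹) • 𝓕 (fun ξ => ((g ξ ^ n : ℝ) : ℂ) • m ξ) x)
      (𝓕 (fun ξ => (Real.exp (g ξ) : ℂ) • m ξ) x) := by
  have hM0 : 0 ≤ M := (abs_nonneg _).trans (hM 0)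
  have hsumM : Summable fun n : ℕ => M ^ n / n.factorial := Real.summable_pow_div_factorial M
  have h := hasSum_integral_of_dominated_convergence (μ := volume)
    (F := fun (n : ℕ) ξ => ((n.factorial : ℂ)⁻¹) • Real.fourierChar (-⟪ξ, x⟫) •
      ((g ξ ^ n : ℝ) : ℂ) • m ξ)
    (f := fun ξ => Real.fourierChar (-⟪ξ, x⟫) • (Real.exp (g ξ) : ℂ) • m ξ)
    (fun n ξ => M ^ n / n.factorial * ‖m ξ‖)
    (fun n => (((integrable_character_smul (integrable_smul_of_bounded (hg.pow n)
      (M := M ^ n) (fun ξ => by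
        rw [Pi.pow_apply, abs_pow]; exact pow_le_pow_left₀ (abs_nonneg _) (hM ξ) n) hm) x).smul
          ((n.factorial : ℂ)⁻¹)).aestronglyMeasurable))
    (fun n => ae_of_all _ fun ξ => ?_)
    (ae_of_all _ fun ξ => hsumM.mul_right _) ?_ (ae_of_all _ fun ξ => ?_)
  · simp_rw [integral_smul] at h
    exact h
  · rw [norm_smul, Circle.norm_smul, norm_smul, norm_inv, Complex.norm_natCast, Complex.norm_real,
      norm_pow, Real.norm_eq_abs, div_eq_inv_mul, ← mul_assoc]
    gcongr
    exact hM ξ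
  · simp_rw [tsum_mul_right]
    exact hm.norm.const_mul _
  · have he : HasSum (fun n : ℕ => ((n.factorial : ℂ)⁻¹) * ((g ξ ^ n : ℝ) : ℂ))
        (Real.exp (g ξ) : ℂ) := by
      have := NormedSpace.expSeries_div_hasSum_exp (g ξ)
      rw [← Real.exp_eq_exp_ℝ] at this
      have h2 := Complex.hasSum_ofReal.2 this
      refine h2.congr_fun fun n => ?_
      push_cast
      ring
    have h3 := (he.smul_const (m ξ)).const_smul (Real.fourierChar (-⟪ξ, x⟫))
    refine h3.congr_fun fun n => ?_
    rw [smul_comm, smul_smul]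

theorem fourier_sub_apply {m' : Sp d → F} (hm : Integrable m) (hm' : Integrable m') (x : Sp d) :
    𝓕 (fun ξ => m ξ - m' ξ) x = 𝓕 m x - 𝓕 m' x := by
  rw [Real.fourier_eq, Real.fourier_eq, Real.fourier_eq,
    ← integral_sub (integrable_character_smul hm x) (integrable_character_smul hm' x)]
  simp_rw [smul_sub]

variable [CompleteSpace F]

/-- Multiplication of a symbol by the transform of `f` amounts to averaging translates against
`f`. -/
theorem fourier_cosTransform_smul (hf : Integrable f) (heven : ∀ z, f (-z) = f z)
    (hm : Integrable m) (x : Sp d) :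
    𝓕 (fun ξ => (cosTransform f ξ : ℂ) • m ξ) x = ∫ z, (f z : ℂ) • 𝓕 m (x + z) := by
  have h := VectorFourier.integral_fourierIntegral_smul_eq_flip (μ := volume) (ν := volume)
    (L := innerₗ (Sp d)) (f := fun z => (f z : ℂ))
    (g := fun ξ => Real.fourierChar (-⟪ξ, x⟫) • m ξ) Real.continuous_fourierChar
    (by exact continuous_inner) hf.ofReal (integrable_character_smul hm x)
  have e1 : ∀ ξ, VectorFourier.fourierIntegral Real.fourierChar volume (innerₗ (Sp d))
      (fun z => (f z : ℂ)) ξ = (cosTransform f ξ : ℂ) := fun ξ =>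
    (ofReal_cosTransform hf heven ξ).symm
  have e2 : ∀ z, VectorFourier.fourierIntegral Real.fourierChar volume (innerₗ (Sp d)).flip
      (fun ξ => Real.fourierChar (-⟪ξ, x⟫) • m ξ) z = 𝓕 m (x + z) := fun z => by
    rw [flip_innerₗ, Real.fourier_eq]
    show ∫ ξ, Real.fourierChar (-⟪ξ, z⟫) • Real.fourierChar (-⟪ξ, x⟫) • m ξ = _
    congr 1; funext ξ
    rw [smul_smul, ← AddChar.map_add_eq_mul, inner_add_right]
    congr 3; ring
  simp_rw [e1, e2] at h
  rw [← h, Real.fourier_eq]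
  congr 1; funext ξ
  rw [smul_comm]

theorem fourier_symb_smul (hf : Integrable f) (heven : ∀ z, f (-z) = f z)
    (hm : Integrable m) (x : Sp d) :
    𝓕 (fun ξ => (symb f ξ : ℂ) • m ξ) x = ∫ z, (f z : ℂ) • (𝓕 m x - 𝓕 m (x + z)) := by
  have hc : Integrable fun ξ => (cosTransform f ξ : ℂ) • m ξ :=
    hm.bdd_smul (∫ z, |f z|) (Complex.continuous_ofReal.comp
      (continuous_cosTransform hf)).aestronglyMeasurable
      (ae_of_all _ fun ξ => by
        rw [Complex.norm_real]; exact abs_cosTransform_le hf ξ)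
  have h1 : Integrable fun z => (f z : ℂ) • 𝓕 m (x + z) :=
    hf.ofReal.smul_bdd (∫ ξ, ‖m ξ‖)
      ((continuous_fourier hm).comp (continuous_const.add continuous_id)).aestronglyMeasurable
      (ae_of_all _ fun z => norm_fourier_le m _)
  simp_rw [symb_eq_sub_cosTransform hf, smul_sub]
  have h2 : Integrable fun z => (f z : ℂ) • 𝓕 m x := hf.ofReal.smul_const _
  have h3 : Integrable fun ξ =>
      ((∫ z, f z : ℝ) : ℂ) • Real.fourierChar (-⟪ξ, x⟫) • m ξ :=
    (integrable_character_smul hm x).smul _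
  rw [integral_sub h2 h1, ← fourier_cosTransform_smul hf heven hm,
    integral_smul_const, integral_complex_ofReal, Real.fourier_eq, Real.fourier_eq,
    Real.fourier_eq, ← integral_smul,
    ← integral_sub h3 (integrable_character_smul hc x)]
  congr 1; funext ξ
  rw [smul_comm _ (Real.fourierChar _), ← smul_sub, Complex.ofReal_sub, sub_smul]

theorem continuous_symb (hf : Integrable f) : Continuous (symb f) := by
  rw [funext (symb_eq_sub_cosTransform hf)]
  exact continuous_const.sub (continuous_cosTransform hf)

theorem abs_symb_le (hf : Integrable f) (ξ : Sp d) : |symb f ξ| ≤ 2 * ∫ z, |f z| := by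
  rw [symb_eq_sub_cosTransform hf, two_mul]
  exact (abs_sub _ _).trans (add_le_add abs_integral_le_integral_abs (abs_cosTransform_le hf ξ))

/-- The norm, up to the size of the jump density, of the convolution operators on the space of
functions dominated by `tail`. -/
def tailConst (d : ℕ) (α : ℝ) : ℝ :=
  (∫ z : Sp d, tail α z) + 2 ^ ((d : ℝ) + α) * (2 * ∫ z : Sp d, tail α z)

theorem tailConst_nonneg (d : ℕ) (α : ℝ) : 0 ≤ tailConst d α := by
  have h : 0 ≤ ∫ z : Sp d, tail α z := integral_nonneg fun z => (tail_pos α z).le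
  unfold tailConst; positivity

section TailBound

variable {α K : ℝ}

theorem integrable_of_abs_le_tail (hα : 0 < α) (hfm : AEStronglyMeasurable f)
    (hfK : ∀ᵐ z, |f z| ≤ K * tail α z) : Integrable f :=
  ((integrable_tail hα).const_mul K).mono' hfm hfK

/-- Multiplication by `symb f` acts on Fourier transforms as convolution with `f` and subtraction,
and `tail` is stable under convolution. -/
theorem norm_fourier_symb_smul_le (hα : 0 < α) (hfm : AEStronglyMeasurable f)
    (heven : ∀ z, f (-z) = f z) (hfK : ∀ᵐ z, |f z| ≤ K * tail α z)
    (hm : Integrable m) {A : ℝ} (hA : ∀ x, ‖𝓕 m x‖ ≤ A * tail α x) (x : Sp d) :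
    ‖𝓕 (fun ξ => (symb f ξ : ℂ) • m ξ) x‖ ≤ K * tailConst d α * A * tail α x := by
  have hf := integrable_of_abs_le_tail hα hfm hfK
  have hK : 0 ≤ K := by
    obtain ⟨z, hz⟩ := hfK.exists
    exact nonneg_of_mul_nonneg_left ((abs_nonneg _).trans hz) (tail_pos α z)
  have hA0 : 0 ≤ A := nonneg_of_mul_nonneg_left ((norm_nonneg _).trans (hA 0)) (tail_pos α 0)
  have h1 := ((integrable_tail (d := d) hα).const_mul (tail α x)).add
    (integrable_tail_mul_tail hα x)
  rw [fourier_symb_smul hf heven hm]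
  calc _ ≤ ∫ z, K * A * (tail α x * tail α z + tail α z * tail α (x + z)) := by
        refine norm_integral_le_of_norm_le (h1.const_mul _) (hfK.mono fun z hz => ?_)
        rw [norm_smul, Complex.norm_real, Real.norm_eq_abs]
        calc _ ≤ (K * tail α z) * (A * tail α x + A * tail α (x + z)) := by
              have := tail_pos α z
              gcongr
              exact (norm_sub_le _ _).trans (add_le_add (hA x) (hA _))
          _ = _ := by ring
    _ = K * A * (tail α x * (∫ z : Sp d, tail α z) + ∫ z, tail α z * tail α (x + z)) := by
        rw [integral_const_mul, integral_add ((integrable_tail hα).const_mul _)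
          (integrable_tail_mul_tail hα x), integral_const_mul]
    _ ≤ K * A * (tail α x * (∫ z : Sp d, tail α z) +
          2 ^ ((d : ℝ) + α) * (2 * ∫ z : Sp d, tail α z) * tail α x) := by
        gcongr
        exact integral_tail_mul_tail_le hα x
    _ = _ := by rw [tailConst]; ring

theorem norm_fourier_symb_pow_smul_le (hα : 0 < α) (hfm : AEStronglyMeasurable f)
    (heven : ∀ z, f (-z) = f z) (hfK : ∀ᵐ z, |f z| ≤ K * tail α z)
    (hm : Integrable m) {A : ℝ} (hA : ∀ x, ‖𝓕 m x‖ ≤ A * tail α x) (n : ℕ) (x : Sp d) :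
    ‖𝓕 (fun ξ => ((symb f ξ ^ n : ℝ) : ℂ) • m ξ) x‖ ≤
      (K * tailConst d α) ^ n * A * tail α x := by
  have hf := integrable_of_abs_le_tail hα hfm hfK
  induction n generalizing x with
  | zero => simpa using hA x
  | succ n ih =>
    have hi : Integrable fun ξ => ((symb f ξ ^ n : ℝ) : ℂ) • m ξ :=
      integrable_smul_of_bounded ((continuous_symb hf).pow n) (M := (2 * ∫ z, |f z|) ^ n)
        (fun ξ => by
          rw [abs_pow]
          exact pow_le_pow_left₀ (abs_nonneg _) (abs_symb_le hf ξ) n) hm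
    have h := norm_fourier_symb_smul_le hα hfm heven hfK hi ih x
    calc _ = ‖𝓕 (fun ξ => (symb f ξ : ℂ) • ((symb f ξ ^ n : ℝ) : ℂ) • m ξ) x‖ := by
          refine congrArg (fun g : Sp d → F => ‖𝓕 g x‖) (funext fun ξ => ?_)
          rw [smul_smul, pow_succ', Complex.ofReal_mul]
      _ ≤ _ := h
      _ = _ := by ring

/-- Since multiplication by `symb f` preserves symbols whose Fourier transform is dominated by
`tail`, so does multiplication by `exp (symb f) - 1`, with a constant that is small with `f`. -/
theorem norm_fourier_exp_symb_sub_one_smul_le (hα : 0 < α) (hfm : AEStronglyMeasurable f)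
    (heven : ∀ z, f (-z) = f z) (hfK : ∀ᵐ z, |f z| ≤ K * tail α z)
    (hm : Integrable m) {A : ℝ} (hA : ∀ x, ‖𝓕 m x‖ ≤ A * tail α x) (x : Sp d) :
    ‖𝓕 (fun ξ => ((Real.exp (symb f ξ) - 1 : ℝ) : ℂ) • m ξ) x‖ ≤
      (Real.exp (K * tailConst d α) - 1) * (A * tail α x) := by
  have hf := integrable_of_abs_le_tail hα hfm hfK
  have h := hasSum_fourier_exp_smul (continuous_symb hf) (abs_symb_le hf) hm x
  have h1 := (hasSum_nat_add_iff' 1).2 h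
  have h2 : HasSum (fun n : ℕ => (K * tailConst d α) ^ n / n.factorial)
      (Real.exp (K * tailConst d α)) := by
    rw [Real.exp_eq_exp_ℝ]; exact NormedSpace.expSeries_div_hasSum_exp _
  have h3 := ((hasSum_nat_add_iff' 1).2 h2).mul_right (A * tail α x)
  have h4 := h1.norm_le_of_bounded h3 fun n => by
    rw [norm_smul, norm_inv, Complex.norm_natCast]
    calc _ ≤ ((n + 1).factorial : ℝ)⁻¹ * ((K * tailConst d α) ^ (n + 1) * A * tail α x) := by
          gcongr
          exact norm_fourier_symb_pow_smul_le hα hfm heven hfK hm hA (n + 1) x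
      _ = _ := by ring
  simp only [Finset.sum_range_one, Nat.factorial_zero, Nat.cast_one, inv_one, pow_zero, one_smul,
    Complex.ofReal_one, div_one] at h4
  have hi : Integrable fun ξ => (Real.exp (symb f ξ) : ℂ) • m ξ :=
    integrable_smul_of_bounded (Real.continuous_exp.comp (continuous_symb hf))
      (M := Real.exp (2 * ∫ z, |f z|)) (fun ξ => by
        show |Real.exp (symb f ξ)| ≤ _
        rw [Real.abs_exp]
        exact Real.exp_le_exp.2 ((le_abs_self _).trans (abs_symb_le hf ξ))) hm
  have e : 𝓕 (fun ξ => ((Real.exp (symb f ξ) - 1 : ℝ) : ℂ) • m ξ) x =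
      𝓕 (fun ξ => (Real.exp (symb f ξ) : ℂ) • m ξ) x - 𝓕 m x := by
    rw [← fourier_sub_apply hi hm]
    refine congrArg (fun g : Sp d → F => 𝓕 g x) (funext fun ξ => ?_)
    rw [Complex.ofReal_sub, sub_smul, Complex.ofReal_one, one_smul]
  rw [e]
  exact h4

theorem norm_fourier_exp_symb_smul_le (hα : 0 < α) (hfm : AEStronglyMeasurable f)
    (heven : ∀ z, f (-z) = f z) (hfK : ∀ᵐ z, |f z| ≤ K * tail α z)
    (hm : Integrable m) {A : ℝ} (hA : ∀ x, ‖𝓕 m x‖ ≤ A * tail α x) (x : Sp d) :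
    ‖𝓕 (fun ξ => (Real.exp (symb f ξ) : ℂ) • m ξ) x‖ ≤
      Real.exp (K * tailConst d α) * (A * tail α x) := by
  have hf := integrable_of_abs_le_tail hα hfm hfK
  have h := hasSum_fourier_exp_smul (continuous_symb hf) (abs_symb_le hf) hm x
  have h2 : HasSum (fun n : ℕ => (K * tailConst d α) ^ n / n.factorial)
      (Real.exp (K * tailConst d α)) := by
    rw [Real.exp_eq_exp_ℝ]; exact NormedSpace.expSeries_div_hasSum_exp _
  refine h.norm_le_of_bounded (h2.mul_right (A * tail α x)) fun n => ?_
  rw [norm_smul, norm_inv, Complex.norm_natCast]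
  calc _ ≤ (n.factorial : ℝ)⁻¹ * ((K * tailConst d α) ^ n * A * tail α x) := by
        gcongr
        exact norm_fourier_symb_pow_smul_le hα hfm heven hfK hm hA n x
    _ = _ := by ring

end TailBound

end CosTransform

end CompoundPoisson

/-! ### The transition density at time one -/

section TimeOne

open scoped FourierTransform
open VectorFourier

variable {d : ℕ} {α κ₀ κ₁ : ℝ} {κ κ' : Sp d → ℝ}

/-- The characteristic function `e^{-ψ}` at time one, at the frequency `2πξ`. -/
def charOne (α : ℝ) (κ : Sp d → ℝ) (ξ : Sp d) : ℂ :=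
  (Real.exp (-exponent α κ ((2 * Real.pi) • ξ)) : ℂ)

/-- The contribution to `charOne` of the jumps of size at most one. -/
def charNear (α : ℝ) (κ : Sp d → ℝ) (ξ : Sp d) : ℂ := (Real.exp (-symb (nearJump α κ) ξ) : ℂ)

/-- The contribution to `charOne` of the jumps of size larger than one. -/
def charFar (α : ℝ) (κ : Sp d → ℝ) (ξ : Sp d) : ℂ := (Real.exp (-symb (farJump α κ) ξ) : ℂ)

theorem charOne_eq (hd : 1 ≤ d) (hα : α ∈ Set.Ioo (0 : ℝ) 2) (h0 : 0 < κ₀)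
    (h : IsKernel κ₀ κ₁ κ) (ξ : Sp d) : charOne α κ ξ = charFar α κ ξ * charNear α κ ξ := by
  rw [charOne, charFar, charNear, exponent_eq_near_add_far hd hα h0 h, ← Complex.ofReal_mul,
    ← Real.exp_add]
  congr 2; ring

theorem continuous_charOne (hd : 1 ≤ d) (hα : α ∈ Set.Ioo (0 : ℝ) 2) (h0 : 0 < κ₀)
    (h : IsKernel κ₀ κ₁ κ) : Continuous (charOne α κ) :=
  Complex.continuous_ofReal.comp (Real.continuous_exp.comp
    ((continuous_exponent hd hα h0 h).comp (continuous_const_smul _)).neg)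

theorem continuous_charNear (hd : 1 ≤ d) (hα : α ∈ Set.Ioo (0 : ℝ) 2) (h0 : 0 < κ₀)
    (h : IsKernel κ₀ κ₁ κ) : Continuous (charNear α κ) :=
  Complex.continuous_ofReal.comp (Real.continuous_exp.comp
    (contDiff_symb_near hd hα.2 (measurable_nearJump h.measurable)
      (ae_of_all _ fun z => abs_nearJump_le (h.abs_le h0 z))).1.continuous.neg)

theorem integrable_pow_mul_of_norm_le {m : Sp d → ℂ} (hm : Continuous m) {A c : ℝ} (hα : 0 < α)
    (hc : 0 < c) (h : ∀ ξ, ‖m ξ‖ ≤ A * Real.exp (-(c * ‖ξ‖ ^ α))) (n : ℕ) :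
    Integrable fun ξ => ‖ξ‖ ^ n * ‖m ξ‖ := by
  refine ((integrable_pow_mul_exp hα hc n).const_mul A).mono'
    ((continuous_norm.pow n).mul hm.norm).aestronglyMeasurable (ae_of_all _ fun ξ => ?_)
  rw [Real.norm_of_nonneg (by positivity)]
  calc _ ≤ (1 + ‖ξ‖) ^ n * (A * Real.exp (-(c * ‖ξ‖ ^ α))) := by
        gcongr
        · linarith
        · exact h ξ
    _ = _ := by ring

theorem integrable_pow_mul_charOne (hd : 1 ≤ d) (hα : α ∈ Set.Ioo (0 : ℝ) 2) (h0 : 0 < κ₀)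
    (h : IsKernel κ₀ κ₁ κ) (n : ℕ) : Integrable fun ξ => ‖ξ‖ ^ n * ‖charOne α κ ξ‖ := by
  obtain ⟨c, hc, hlow⟩ := exists_le_exponent hd hα h0 κ₁
  refine integrable_pow_mul_of_norm_le (continuous_charOne hd hα h0 h) (A := 1) hα.1 hc
    (fun ξ => ?_) n
  rw [charOne, Complex.norm_real, Real.norm_eq_abs, Real.abs_exp, one_mul]
  refine Real.exp_le_exp.2 (neg_le_neg ((mul_le_mul_of_nonneg_left
    (Real.rpow_le_rpow (norm_nonneg _) (norm_le_norm_two_pi_smul ξ) hα.1.le) hc.le).trans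
    (hlow κ h _)))

theorem integrable_pow_mul_charNear (hd : 1 ≤ d) (hα : α ∈ Set.Ioo (0 : ℝ) 2) (h0 : 0 < κ₀)
    (h : IsKernel κ₀ κ₁ κ) (n : ℕ) : Integrable fun ξ => ‖ξ‖ ^ n * ‖charNear α κ ξ‖ := by
  obtain ⟨c, hc, hlow⟩ := exists_le_exponent hd hα h0 κ₁
  refine integrable_pow_mul_of_norm_le (continuous_charNear hd hα h0 h) hα.1 hc
    (fun ξ => ?_) n (A := Real.exp (κ₁ * (2 * ∫ z : Sp d, farWeight α z)))
  rw [charNear, Complex.norm_real, Real.norm_eq_abs, Real.abs_exp]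
  exact exp_neg_symb_near_le hd hα h0 h hc (hlow κ h) ξ

theorem integrable_charOne (hd : 1 ≤ d) (hα : α ∈ Set.Ioo (0 : ℝ) 2) (h0 : 0 < κ₀)
    (h : IsKernel κ₀ κ₁ κ) : Integrable (charOne α κ) := by
  have h1 := integrable_pow_mul_charOne hd hα h0 h 0
  simp only [pow_zero, one_mul] at h1
  exact (integrable_norm_iff (continuous_charOne hd hα h0 h).aestronglyMeasurable).1 h1

/-- The symbol of the `n`-th derivative of the Fourier transform of `charNear`. -/
def derivNear (α : ℝ) (κ : Sp d → ℝ) (n : ℕ) (ξ : Sp d) : Sp d [×n]→L[ℝ] ℂ :=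
  fourierPowSMulRight (innerSL ℝ) (charNear α κ) ξ n

theorem integrable_derivNear (hd : 1 ≤ d) (hα : α ∈ Set.Ioo (0 : ℝ) 2) (h0 : 0 < κ₀)
    (h : IsKernel κ₀ κ₁ κ) (n : ℕ) : Integrable (derivNear α κ n) :=
  integrable_fourierPowSMulRight (innerSL ℝ) (integrable_pow_mul_charNear hd hα h0 h n)
    (continuous_charNear hd hα h0 h).aestronglyMeasurable

theorem fourier_derivNear (hd : 1 ≤ d) (hα : α ∈ Set.Ioo (0 : ℝ) 2) (h0 : 0 < κ₀)
    (h : IsKernel κ₀ κ₁ κ) (n : ℕ) :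
    𝓕 (derivNear α κ n) = iteratedFDeriv ℝ n (𝓕 (charNear α κ)) :=
  (Real.iteratedFDeriv_fourier (N := ⊤)
    (fun k _ => integrable_pow_mul_charNear hd hα h0 h k)
    (continuous_charNear hd hα h0 h).aestronglyMeasurable le_top).symm

/-- Derivatives of the transition density may be taken on its small jump part alone. -/
theorem iteratedFDeriv_fourier_charOne (hd : 1 ≤ d) (hα : α ∈ Set.Ioo (0 : ℝ) 2) (h0 : 0 < κ₀)
    (h : IsKernel κ₀ κ₁ κ) (n : ℕ) (x : Sp d) :
    iteratedFDeriv ℝ n (𝓕 (charOne α κ)) x =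
      𝓕 (fun ξ => charFar α κ ξ • derivNear α κ n ξ) x := by
  rw [Real.iteratedFDeriv_fourier (N := ⊤)
    (fun k _ => integrable_pow_mul_charOne hd hα h0 h k)
    (continuous_charOne hd hα h0 h).aestronglyMeasurable le_top]
  refine congrArg (fun g : Sp d → Sp d [×n]→L[ℝ] ℂ => 𝓕 g x) (funext fun ξ => ?_)
  ext v
  simp only [derivNear, fourierPowSMulRight_apply, smul_apply,
    charOne_eq hd hα h0 h, smul_eq_mul, Complex.real_smul]
  ring

theorem contDiff_fourier_charOne (hd : 1 ≤ d) (hα : α ∈ Set.Ioo (0 : ℝ) 2) (h0 : 0 < κ₀)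
    (h : IsKernel κ₀ κ₁ κ) : ContDiff ℝ ∞ (𝓕 (charOne α κ)) :=
  Real.contDiff_fourier (N := ⊤) fun k _ => integrable_pow_mul_charOne hd hα h0 h k

theorem farJump_neg (h : IsKernel κ₀ κ₁ κ) (z : Sp d) : farJump α κ (-z) = farJump α κ z := by
  rw [farJump, farJump, farWeight_neg, ← h.symm]

theorem abs_farJump_le_tail (hα : 0 < α) {z : Sp d} {B : ℝ} (h : |κ z| ≤ B) :
    |farJump α κ z| ≤ B * 2 ^ ((d : ℝ) + α) * tail α z := by
  rw [mul_assoc]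
  exact (abs_farJump_le h).trans (mul_le_mul_of_nonneg_left (farWeight_le_tail hα z)
    ((abs_nonneg _).trans h))

theorem symb_neg_fun (k : Sp d → ℝ) (ξ : Sp d) : symb (fun z => -k z) ξ = -symb k ξ := by
  simp only [symb, mul_neg, integral_neg]

theorem exp_sub_one_le_mul_exp (y : ℝ) : Real.exp y - 1 ≤ y * Real.exp y := by
  have h := Real.add_one_le_exp (-y)
  have h2 : Real.exp (-y) * Real.exp y = 1 := by rw [← Real.exp_add]; simp
  nlinarith [Real.exp_pos y]

section Far

variable {F : Type*} [NormedAddCommGroup F] [NormedSpace ℂ F] {m : Sp d → F}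

theorem abs_neg_farJump_le_tail (hα : 0 < α) (h0 : 0 < κ₀) (h : IsKernel κ₀ κ₁ κ) :
    ∀ᵐ z, |-farJump α κ z| ≤ κ₁ * 2 ^ ((d : ℝ) + α) * tail α z :=
  ae_of_all _ fun z => by rw [abs_neg]; exact abs_farJump_le_tail hα (h.abs_le h0 z)

theorem integrable_farJump (hα : 0 < α) (h0 : 0 < κ₀) (h : IsKernel κ₀ κ₁ κ) :
    Integrable (farJump α κ) :=
  integrable_of_abs_le_tail hα (measurable_farJump h.measurable).aestronglyMeasurable
    (ae_of_all _ fun z => abs_farJump_le_tail hα (h.abs_le h0 z))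

theorem integrable_charFar_smul (hα : 0 < α) (h0 : 0 < κ₀) (h : IsKernel κ₀ κ₁ κ)
    (hm : Integrable m) : Integrable fun ξ => charFar α κ ξ • m ξ := by
  have hf := integrable_farJump (α := α) hα h0 h
  refine integrable_smul_of_bounded (M := Real.exp (2 * ∫ z, |farJump α κ z|))
    (Real.continuous_exp.comp (continuous_symb hf).neg) (fun ξ => ?_) hm
  show |Real.exp (-symb (farJump α κ) ξ)| ≤ _
  rw [Real.abs_exp]
  exact Real.exp_le_exp.2 ((neg_le_abs _).trans (abs_symb_le hf ξ))

/-- The telescoping `e m - e' m' = e (m - m') + (e - e') m'`. -/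
theorem fourier_charFar_smul_sub (hα : 0 < α) (h0 : 0 < κ₀) (h : IsKernel κ₀ κ₁ κ)
    (h' : IsKernel κ₀ κ₁ κ') {m' : Sp d → F} (hm : Integrable m) (hm' : Integrable m') (x : Sp d) :
    𝓕 (fun ξ => charFar α κ ξ • m ξ) x - 𝓕 (fun ξ => charFar α κ' ξ • m' ξ) x =
      𝓕 (fun ξ => charFar α κ ξ • (m ξ - m' ξ)) x +
        𝓕 (fun ξ => (charFar α κ ξ - charFar α κ' ξ) • m' ξ) x := by
  have e1 := integrable_charFar_smul hα h0 h hm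
  have e2 := integrable_charFar_smul hα h0 h hm'
  have e3 := integrable_charFar_smul hα h0 h' hm'
  simp_rw [smul_sub, sub_smul]
  rw [fourier_sub_apply e1 e2, fourier_sub_apply e2 e3]
  abel

variable [CompleteSpace F]

theorem norm_fourier_charFar_smul_le (hα : 0 < α) (h0 : 0 < κ₀) (h : IsKernel κ₀ κ₁ κ)
    (hm : Integrable m) {A : ℝ} (hA : ∀ x, ‖𝓕 m x‖ ≤ A * tail α x) (x : Sp d) :
    ‖𝓕 (fun ξ => charFar α κ ξ • m ξ) x‖ ≤
      Real.exp (κ₁ * 2 ^ ((d : ℝ) + α) * tailConst d α) * (A * tail α x) := by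
  have h1 := norm_fourier_exp_symb_smul_le (f := fun z => -farJump α κ z) hα
    (measurable_farJump h.measurable).neg.aestronglyMeasurable
    (fun z => by rw [farJump_neg h]) (abs_neg_farJump_le_tail hα h0 h) hm hA x
  simp_rw [symb_neg_fun] at h1
  exact h1

theorem norm_fourier_charFar_sub_smul_le (hd : 1 ≤ d) (hα : α ∈ Set.Ioo (0 : ℝ) 2) (h0 : 0 < κ₀)
    (h : IsKernel κ₀ κ₁ κ) (h' : IsKernel κ₀ κ₁ κ') {ε : ℝ} (hε : ε ≤ κ₁)
    (hae : ∀ᵐ z, |κ z - κ' z| ≤ ε)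
    (hm : Integrable m) {A : ℝ} (hA : ∀ x, ‖𝓕 m x‖ ≤ A * tail α x) (x : Sp d) :
    ‖𝓕 (fun ξ => (charFar α κ ξ - charFar α κ' ξ) • m ξ) x‖ ≤
      ε * (2 ^ ((d : ℝ) + α) * tailConst d α *
        Real.exp (κ₁ * 2 ^ ((d : ℝ) + α) * tailConst d α)) *
        (Real.exp (κ₁ * 2 ^ ((d : ℝ) + α) * tailConst d α) * (A * tail α x)) := by
  have hA0 : 0 ≤ A := nonneg_of_mul_nonneg_left ((norm_nonneg _).trans (hA 0)) (tail_pos α 0)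
  have hε0 : 0 ≤ ε := by
    obtain ⟨z, hz⟩ := hae.exists
    exact (abs_nonneg _).trans hz
  have hT := tailConst_nonneg d α
  have h1 := norm_fourier_exp_symb_sub_one_smul_le
    (f := fun z => farJump α κ' z - farJump α κ z) (K := ε * 2 ^ ((d : ℝ) + α)) hα.1
    ((measurable_farJump h'.measurable).sub
      (measurable_farJump h.measurable)).aestronglyMeasurable
    (fun z => by rw [farJump_neg h, farJump_neg h'])
    (hae.mono fun z hz => by
      have := abs_farJump_le_tail (κ := fun z => κ' z - κ z) (B := ε) hα.1
        (by rw [abs_sub_comm]; exact hz)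
      simpa only [farJump, sub_mul] using this)
    (integrable_charFar_smul hα.1 h0 h' hm) (A :=
      Real.exp (κ₁ * 2 ^ ((d : ℝ) + α) * tailConst d α) * A)
    (fun y => by
      rw [mul_assoc]; exact norm_fourier_charFar_smul_le hα.1 h0 h' hm hA y) x
  -- `e^{-a} - e^{-a'} = (e^{a' - a} - 1) e^{-a'}`
  have e : (fun ξ => ((Real.exp (symb (fun z => farJump α κ' z - farJump α κ z) ξ) - 1 : ℝ) : ℂ) •
      charFar α κ' ξ • m ξ) = fun ξ => (charFar α κ ξ - charFar α κ' ξ) • m ξ := by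
    funext ξ
    rw [smul_smul, symb_sub hd hα (measurable_farJump h'.measurable)
      (measurable_farJump h.measurable) (h.le_nonneg h0) (h'.abs_farJump_le_weight h0)
      (h.abs_farJump_le_weight h0)]
    congr 1
    rw [charFar, charFar, ← Complex.ofReal_mul, ← Complex.ofReal_sub, sub_mul, one_mul,
      ← Real.exp_add]
    congr 3; ring
  rw [e] at h1
  refine h1.trans ?_
  rw [mul_assoc _ A]
  have ht := (tail_pos α x).le
  refine mul_le_mul_of_nonneg_right ?_ (by positivity)
  refine (exp_sub_one_le_mul_exp _).trans ?_
  have : Real.exp (ε * 2 ^ ((d : ℝ) + α) * tailConst d α) ≤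
      Real.exp (κ₁ * 2 ^ ((d : ℝ) + α) * tailConst d α) := Real.exp_le_exp.2 (by gcongr)
  calc _ = ε * (2 ^ ((d : ℝ) + α) * tailConst d α *
        Real.exp (ε * 2 ^ ((d : ℝ) + α) * tailConst d α)) := by ring
    _ ≤ _ := by gcongr

end Far

/-- At time one the heat kernel and all its derivatives are dominated by `tail`. -/
theorem exists_norm_iteratedFDeriv_charOne_le (hd : 1 ≤ d) (hα : α ∈ Set.Ioo (0 : ℝ) 2)
    (h0 : 0 < κ₀) (κ₁ : ℝ) (n : ℕ) :
    ∃ C, 0 ≤ C ∧ ∀ κ : Sp d → ℝ, IsKernel κ₀ κ₁ κ → ∀ x,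
      ‖iteratedFDeriv ℝ n (𝓕 (charOne α κ)) x‖ ≤ C * tail α x := by
  obtain ⟨C, hC, hb⟩ := exists_fourier_near_le hd hα h0 κ₁ n
  refine ⟨Real.exp (κ₁ * 2 ^ ((d : ℝ) + α) * tailConst d α) * C, by positivity, fun κ h x => ?_⟩
  rw [iteratedFDeriv_fourier_charOne hd hα h0 h, mul_assoc]
  refine norm_fourier_charFar_smul_le hα.1 h0 h (integrable_derivNear hd hα h0 h n) (fun y => ?_) x
  rw [fourier_derivNear hd hα h0 h]
  exact hb κ h y

/-- At time one the heat kernel and all its derivatives depend on the jump kernel in a Lipschitz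
way, relative to `tail`. -/
theorem exists_norm_iteratedFDeriv_charOne_sub_le (hd : 1 ≤ d) (hα : α ∈ Set.Ioo (0 : ℝ) 2)
    (h0 : 0 < κ₀) (κ₁ : ℝ) (n : ℕ) :
    ∃ C, 0 ≤ C ∧ ∀ κ κ' : Sp d → ℝ, IsKernel κ₀ κ₁ κ → IsKernel κ₀ κ₁ κ' → ∀ ε, ε ≤ κ₁ →
      (∀ᵐ z, |κ z - κ' z| ≤ ε) → ∀ x,
      ‖iteratedFDeriv ℝ n (𝓕 (charOne α κ)) x - iteratedFDeriv ℝ n (𝓕 (charOne α κ')) x‖ ≤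
        C * ε * tail α x := by
  obtain ⟨C, hC, hb⟩ := exists_fourier_near_le hd hα h0 κ₁ n
  obtain ⟨C', hC', hb'⟩ := exists_fourier_near_sub_le hd hα h0 κ₁ n
  have hT := tailConst_nonneg d α
  refine ⟨Real.exp (κ₁ * 2 ^ ((d : ℝ) + α) * tailConst d α) * C' +
    2 ^ ((d : ℝ) + α) * tailConst d α * Real.exp (κ₁ * 2 ^ ((d : ℝ) + α) * tailConst d α) *
      (Real.exp (κ₁ * 2 ^ ((d : ℝ) + α) * tailConst d α) * C), by positivity,
    fun κ κ' h h' ε hε hae x => ?_⟩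
  have hε0 : 0 ≤ ε := by
    obtain ⟨z, hz⟩ := hae.exists
    exact (abs_nonneg _).trans hz
  have hi := integrable_derivNear hd hα h0 h n
  have hi' := integrable_derivNear hd hα h0 h' n
  have e : iteratedFDeriv ℝ n (𝓕 (charOne α κ)) x - iteratedFDeriv ℝ n (𝓕 (charOne α κ')) x =
      𝓕 (fun ξ => charFar α κ ξ • (derivNear α κ n ξ - derivNear α κ' n ξ)) x +
        𝓕 (fun ξ => (charFar α κ ξ - charFar α κ' ξ) • derivNear α κ' n ξ) x := by
    rw [iteratedFDeriv_fourier_charOne hd hα h0 h, iteratedFDeriv_fourier_charOne hd hα h0 h']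
    exact fourier_charFar_smul_sub hα.1 h0 h h' hi hi' x
  have hsub : ∀ y, ‖𝓕 (fun ξ => derivNear α κ n ξ - derivNear α κ' n ξ) y‖ ≤
      C' * ε * tail α y := fun y => by
    have hN : 𝓕 (fun ξ => charNear α κ ξ - charNear α κ' ξ) =
        fun y => 𝓕 (charNear α κ) y - 𝓕 (charNear α κ') y := by
      funext y
      have a0 : ∀ {κ : Sp d → ℝ}, IsKernel κ₀ κ₁ κ → Integrable (charNear α κ) := fun hκ => by
        have := integrable_pow_mul_charNear hd hα h0 hκ 0
        simp only [pow_zero, one_mul] at this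
        exact (integrable_norm_iff
          (continuous_charNear hd hα h0 hκ).aestronglyMeasurable).1 this
      exact fourier_sub_apply (a0 h) (a0 h') y
    have hcd : ∀ {κ : Sp d → ℝ}, IsKernel κ₀ κ₁ κ → ContDiff ℝ n (𝓕 (charNear α κ)) :=
      fun hκ => Real.contDiff_fourier (N := n)
        fun k _ => integrable_pow_mul_charNear hd hα h0 hκ k
    have := hb' κ κ' h h' ε hε0 hae y
    rw [fourier_sub_apply hi hi', fourier_derivNear hd hα h0 h, fourier_derivNear hd hα h0 h',
      ← iteratedFDeriv_sub_apply (hcd h).contDiffAt (hcd h').contDiffAt]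
    simp only [Complex.ofReal_sub] at this
    change ‖iteratedFDeriv ℝ n (𝓕 fun ξ => charNear α κ ξ - charNear α κ' ξ) y‖ ≤ _ at this
    rw [hN] at this
    exact this
  have b1 := norm_fourier_charFar_smul_le hα.1 h0 h (hi.sub hi') hsub x
  have b2 := norm_fourier_charFar_sub_smul_le hd hα h0 h h' hε hae hi' (A := C)
    (fun y => by rw [fourier_derivNear hd hα h0 h']; exact hb κ' h' y) x
  rw [e]
  refine (norm_add_le _ _).trans ((add_le_add b1 b2).trans (le_of_eq ?_))
  ring

end TimeOne

/-! ### Integrated second differences -/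

section SecondDifferences

variable {d : ℕ} {α B : ℝ} {g : Sp d → ℝ}

theorem norm_fderiv_fderiv (g : Sp d → ℝ) (y : Sp d) :
    ‖fderiv ℝ (fderiv ℝ g) y‖ = ‖iteratedFDeriv ℝ 2 g y‖ := by
  rw [← norm_iteratedFDeriv_fderiv, ← norm_iteratedFDeriv_fderiv, norm_iteratedFDeriv_zero]

/-- A second difference is controlled by the second derivative. -/
theorem abs_secondDiff_le (hg : ContDiff ℝ 2 g) {x z : Sp d} {M : ℝ}
    (hM : ∀ y ∈ Metric.closedBall x ‖z‖, ‖iteratedFDeriv ℝ 2 g y‖ ≤ M) :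
    |secondDiff g x z| ≤ M * ‖z‖ ^ 2 := by
  have hg1 : Differentiable ℝ g := hg.differentiable (by norm_num)
  have hg2 : Differentiable ℝ (fderiv ℝ g) :=
    (hg.fderiv_right (m := 1) (by norm_num)).differentiable (by norm_num)
  have hshift : Differentiable ℝ fun y => g (y + z) := hg1.comp (differentiable_id.add_const z)
  have hcv : Convex ℝ (Metric.closedBall x ‖z‖) := convex_closedBall _ _
  have hseg : ∀ y ∈ segment ℝ (x - z) x, y ∈ Metric.closedBall x ‖z‖ ∧
      y + z ∈ Metric.closedBall x ‖z‖ := by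
    intro y hy
    refine ⟨hcv.segment_subset (by simp) (by simp) hy, ?_⟩
    have h1 : y + z ∈ segment ℝ x (x + z) := by
      obtain ⟨a, b, ha, hb, hab, rfl⟩ := hy
      refine ⟨a, b, ha, hb, hab, ?_⟩
      obtain rfl : b = 1 - a := by linarith
      module
    exact hcv.segment_subset (by simp) (by simp) h1
  have hD : ∀ y ∈ segment ℝ (x - z) x,
      ‖fderiv ℝ (fun y => g (y + z) - g y) y‖ ≤ M * ‖z‖ := by
    intro y hy
    have e : fderiv ℝ (fun y => g (y + z) - g y) y = fderiv ℝ g (y + z) - fderiv ℝ g y := by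
      rw [fderiv_fun_sub (hshift _) (hg1 y), fderiv_comp_add_right]
    rw [e]
    have h := hcv.norm_image_sub_le_of_norm_fderiv_le (𝕜 := ℝ) (f := fderiv ℝ g) (C := M)
      (fun w _ => hg2 w) (fun w hw => by rw [norm_fderiv_fderiv]; exact hM w hw)
      (hseg y hy).1 (hseg y hy).2
    simpa using h
  have h := (convex_segment (x - z) x).norm_image_sub_le_of_norm_fderiv_le (𝕜 := ℝ)
    (f := fun y => g (y + z) - g y)
    (fun w _ => (hshift _).sub (hg1 w)) hD
    (left_mem_segment ℝ _ _) (right_mem_segment ℝ _ _)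
  simp only [sub_add_cancel, sub_sub_cancel] at h
  calc |secondDiff g x z| = ‖g (x + z) - g x - (g x - g (x - z))‖ := by
        rw [secondDiff, Real.norm_eq_abs]; congr 1; ring
    _ ≤ M * ‖z‖ * ‖z‖ := h
    _ = _ := by ring

theorem continuous_secondDiff (hg : Continuous g) (x : Sp d) :
    Continuous fun z => secondDiff g x z := by
  unfold secondDiff; fun_prop

/-- The constant in the estimate of integrated second differences. -/
def secondDiffConst (d : ℕ) (α : ℝ) : ℝ :=
  2 ^ ((d : ℝ) + α) * (nearMoment d α + 2 * tailConst d α)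

theorem secondDiffConst_nonneg (d : ℕ) (α : ℝ) : 0 ≤ secondDiffConst d α := by
  have := tailConst_nonneg d α
  have := nearMoment_nonneg (d := d) α
  unfold secondDiffConst; positivity

/-- Small jumps are controlled by the second derivative, large ones by the size of the function
itself. -/
theorem abs_secondDiff_mul_weight_le (hα : 0 < α) (hg : ContDiff ℝ 2 g)
    (hg0 : ∀ x, |g x| ≤ B * tail α x) (hg2 : ∀ x, ‖iteratedFDeriv ℝ 2 g x‖ ≤ B * tail α x)
    (x z : Sp d) : |secondDiff g x z| * weight α z ≤
      B * (2 ^ ((d : ℝ) + α) * (tail α x * (‖z‖ ^ 2 * nearWeight α z) +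
        (tail α z * tail α (x + z) + tail α z * tail α (x - z) + 2 * tail α x * tail α z))) := by
  have hB : 0 ≤ B := nonneg_of_mul_nonneg_left ((abs_nonneg _).trans (hg0 0)) (tail_pos α 0)
  have ht := fun y : Sp d => (tail_pos α y).le
  have hp : (0 : ℝ) ≤ 2 ^ ((d : ℝ) + α) := by positivity
  have hnear : |secondDiff g x z| * nearWeight α z ≤
      B * 2 ^ ((d : ℝ) + α) * tail α x * ‖z‖ ^ 2 * nearWeight α z := by
    by_cases hz : ‖z‖ ≤ 1
    · refine mul_le_mul_of_nonneg_right (abs_secondDiff_le hg fun y hy => ?_)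
        (nearWeight_nonneg α z)
      refine (hg2 y).trans ?_
      rw [mul_assoc]
      refine mul_le_mul_of_nonneg_left (tail_le_of_le hα two_pos ?_) hB
      have h1 : ‖y - x‖ ≤ ‖z‖ := by simpa [dist_eq_norm] using hy
      have h2 := norm_sub_norm_le x y
      rw [norm_sub_rev] at h2
      linarith [norm_nonneg y]
    · have : nearWeight α z = 0 := by simp [nearWeight, Set.indicator, hz]
      simp [this]
  have hfar : |secondDiff g x z| * farWeight α z ≤
      (B * tail α (x + z) + B * tail α (x - z) + 2 * (B * tail α x)) *
        (2 ^ ((d : ℝ) + α) * tail α z) := by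
    have h1 : |secondDiff g x z| ≤
        B * tail α (x + z) + B * tail α (x - z) + 2 * (B * tail α x) := by
      unfold secondDiff
      have a1 := abs_le.1 (hg0 (x + z))
      have a2 := abs_le.1 (hg0 (x - z))
      have a3 := abs_le.1 (hg0 x)
      exact abs_le.2 ⟨by linarith, by linarith⟩
    exact mul_le_mul h1 (farWeight_le_tail hα z) (farWeight_nonneg α z)
      ((abs_nonneg _).trans h1)
  rw [← nearWeight_add_farWeight, mul_add]
  refine (add_le_add hnear hfar).trans (le_of_eq ?_)
  ring

theorem integrable_tail_mul_tail_sub (hα : 0 < α) (x : Sp d) :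
    Integrable (fun z => tail α z * tail α (x - z)) := by
  have h := (integrable_tail_mul_tail hα x).comp_neg
  simpa only [tail_neg, ← sub_eq_add_neg] using h

/-- Integrated second differences of a function dominated by `tail` together with its second
derivative. -/
theorem integrable_and_integral_secondDiff_le (hd : 1 ≤ d) (hα : α ∈ Set.Ioo (0 : ℝ) 2)
    (hg : ContDiff ℝ 2 g) (hg0 : ∀ x, |g x| ≤ B * tail α x)
    (hg2 : ∀ x, ‖iteratedFDeriv ℝ 2 g x‖ ≤ B * tail α x) (x : Sp d) :
    Integrable (fun z => |secondDiff g x z| * weight α z) ∧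
      ∫ z, |secondDiff g x z| * weight α z ≤ secondDiffConst d α * B * tail α x := by
  have hB : 0 ≤ B := nonneg_of_mul_nonneg_left ((abs_nonneg _).trans (hg0 0)) (tail_pos α 0)
  have hle := abs_secondDiff_mul_weight_le hα.1 hg hg0 hg2 x
  have i1 := (integrable_sq_mul_nearWeight hd hα.2).const_mul (tail α x)
  have i2 := integrable_tail_mul_tail hα.1 x
  have i3 := integrable_tail_mul_tail_sub hα.1 x
  have i4 := (integrable_tail (d := d) hα.1).const_mul (2 * tail α x)
  have i23 : Integrable fun z => tail α z * tail α (x + z) + tail α z * tail α (x - z) :=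
    i2.add i3
  have i24 : Integrable fun z => tail α z * tail α (x + z) + tail α z * tail α (x - z) +
      2 * tail α x * tail α z := i23.add i4
  have i14 : Integrable fun z => tail α x * (‖z‖ ^ 2 * nearWeight α z) +
      (tail α z * tail α (x + z) + tail α z * tail α (x - z) + 2 * tail α x * tail α z) :=
    i1.add i24
  have i5 := (i14.const_mul (2 ^ ((d : ℝ) + α))).const_mul B
  have hint : Integrable (fun z => |secondDiff g x z| * weight α z) :=
    i5.mono' ((continuous_secondDiff hg.continuous x).abs.measurable.mul
      (measurable_weight α)).aestronglyMeasurable (ae_of_all _ fun z => by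
        rw [Real.norm_of_nonneg (mul_nonneg (abs_nonneg _) (weight_nonneg α z))]
        exact hle z)
  refine ⟨hint, (integral_mono hint i5 hle).trans ?_⟩
  have e3 : ∫ z, tail α z * tail α (x - z) = ∫ z, tail α z * tail α (x + z) := by
    rw [← integral_neg_eq_self]
    simp only [tail_neg, sub_neg_eq_add]
  have hconv := integral_tail_mul_tail_le hα.1 x
  rw [integral_const_mul, integral_const_mul, integral_add i1 i24,
    integral_add i23 i4, integral_add i2 i3, integral_const_mul, integral_const_mul, e3]
  have h0 : 0 ≤ B * 2 ^ ((d : ℝ) + α) := by positivity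
  calc _ ≤ B * 2 ^ ((d : ℝ) + α) * (tail α x * nearMoment d α +
        (2 ^ ((d : ℝ) + α) * (2 * ∫ z : Sp d, tail α z) * tail α x +
          2 ^ ((d : ℝ) + α) * (2 * ∫ z : Sp d, tail α z) * tail α x +
          2 * tail α x * ∫ z : Sp d, tail α z)) := by
        rw [← mul_assoc]
        refine mul_le_mul_of_nonneg_left ?_ h0
        rw [nearMoment]
        linarith
    _ = _ := by rw [secondDiffConst, tailConst]; ring

end SecondDifferences

/-! ### Scaling and the Lipschitz estimates at all times -/

section AllTimes

open scoped FourierTransform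

variable {d : ℕ} {α κ₀ κ₁ : ℝ} {κ κ' : Sp d → ℝ}

/-- The factor `2π` in Mathlib's characters absorbs the constant `(2π)^{-d}`. -/
theorem heatKernel_one_eq (hd : 1 ≤ d) (hα : α ∈ Set.Ioo (0 : ℝ) 2) (h0 : 0 < κ₀)
    (h : IsKernel κ₀ κ₁ κ) (x : Sp d) : heatKernel α κ 1 x = (𝓕 (charOne α κ) x).re := by
  have h1 := integral_comp_smul_pos
    (fun ξ : Sp d => Real.cos ⟪ξ, x⟫ * Real.exp (-1 * exponent α κ ξ)) (s := 2 * Real.pi)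
    (by positivity)
  rw [Real.rpow_neg (by positivity), Real.rpow_natCast] at h1
  rw [heatKernel, ← h1, Real.fourier_eq']
  have hi : Integrable fun v : Sp d =>
      Complex.exp (↑(-2 * Real.pi * ⟪v, x⟫) * Complex.I) • charOne α κ v := by
    have := integrable_character_smul (integrable_charOne hd hα h0 h) x
    refine this.congr (ae_of_all _ fun v => ?_)
    simp only [Circle.smul_def, Real.fourierChar_apply]
    congr 3
    push_cast; ring
  have hre := Complex.reCLM.integral_comp_comm hi
  rw [Complex.reCLM_apply] at hre
  rw [← hre]
  refine integral_congr_ae (ae_of_all _ fun v => ?_)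
  simp only [Complex.reCLM_apply, charOne, smul_eq_mul, Complex.re_mul_ofReal,
    Complex.exp_ofReal_mul_I_re]
  rw [inner_smul_left, conj_trivial, neg_one_mul, ← Real.cos_neg]
  congr 2
  ring

theorem heatKernel_one_eq_comp (hd : 1 ≤ d) (hα : α ∈ Set.Ioo (0 : ℝ) 2) (h0 : 0 < κ₀)
    (h : IsKernel κ₀ κ₁ κ) : heatKernel α κ 1 = fun x => Complex.reCLM (𝓕 (charOne α κ) x) :=
  funext fun x => heatKernel_one_eq hd hα h0 h x

theorem contDiff_heatKernel_one (hd : 1 ≤ d) (hα : α ∈ Set.Ioo (0 : ℝ) 2) (h0 : 0 < κ₀)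
    (h : IsKernel κ₀ κ₁ κ) : ContDiff ℝ ∞ (heatKernel α κ 1) := by
  rw [heatKernel_one_eq_comp hd hα h0 h]
  exact Complex.reCLM.contDiff.comp (contDiff_fourier_charOne hd hα h0 h)

theorem norm_iteratedFDeriv_re_le {f : Sp d → ℂ} (hf : ContDiff ℝ ∞ f) (n : ℕ) (x : Sp d) :
    ‖iteratedFDeriv ℝ n (fun y => Complex.reCLM (f y)) x‖ ≤ ‖iteratedFDeriv ℝ n f x‖ := by
  have h := Complex.reCLM.norm_iteratedFDeriv_comp_left (x := x) hf.contDiffAt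
    (natCast_le_infty n)
  rwa [Complex.reCLM_norm, one_mul] at h

theorem exists_abs_heatKernel_one_le (hd : 1 ≤ d) (hα : α ∈ Set.Ioo (0 : ℝ) 2) (h0 : 0 < κ₀)
    (κ₁ : ℝ) : ∃ C, 0 ≤ C ∧ ∀ κ : Sp d → ℝ, IsKernel κ₀ κ₁ κ → ∀ x,
      |heatKernel α κ 1 x| ≤ C * tail α x := by
  obtain ⟨C, hC, hb⟩ := exists_norm_iteratedFDeriv_charOne_le hd hα h0 κ₁ 0
  refine ⟨C, hC, fun κ h x => ?_⟩
  have := hb κ h x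
  rw [norm_iteratedFDeriv_zero] at this
  rw [heatKernel_one_eq hd hα h0 h]
  exact (Complex.abs_re_le_norm _).trans this

/-- The Lipschitz estimate at time one, for the derivatives of all orders. -/
theorem exists_norm_iteratedFDeriv_heatKernel_one_sub_le (hd : 1 ≤ d)
    (hα : α ∈ Set.Ioo (0 : ℝ) 2) (h0 : 0 < κ₀) (κ₁ : ℝ) (n : ℕ) :
    ∃ C, 0 ≤ C ∧ ∀ κ κ' : Sp d → ℝ, IsKernel κ₀ κ₁ κ → IsKernel κ₀ κ₁ κ' → ∀ ε, ε ≤ κ₁ →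
      (∀ᵐ z, |κ z - κ' z| ≤ ε) → ∀ x,
      ‖iteratedFDeriv ℝ n (fun y => heatKernel α κ 1 y - heatKernel α κ' 1 y) x‖ ≤
        C * ε * tail α x := by
  obtain ⟨C, hC, hb⟩ := exists_norm_iteratedFDeriv_charOne_sub_le hd hα h0 κ₁ n
  refine ⟨C, hC, fun κ κ' h h' ε hε hae x => ?_⟩
  have hc := contDiff_fourier_charOne hd hα h0 h
  have hc' := contDiff_fourier_charOne hd hα h0 h'
  have e : (fun y => heatKernel α κ 1 y - heatKernel α κ' 1 y) =
      fun y => Complex.reCLM ((𝓕 (charOne α κ) - 𝓕 (charOne α κ')) y) := by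
    funext y
    rw [heatKernel_one_eq hd hα h0 h, heatKernel_one_eq hd hα h0 h']
    simp
  rw [e]
  refine (norm_iteratedFDeriv_re_le (hc.sub hc') n x).trans ?_
  have e2 : iteratedFDeriv ℝ n (𝓕 (charOne α κ) - 𝓕 (charOne α κ')) x =
      iteratedFDeriv ℝ n (𝓕 (charOne α κ)) x - iteratedFDeriv ℝ n (𝓕 (charOne α κ')) x :=
    iteratedFDeriv_sub_apply (hc.of_le (natCast_le_infty n)).contDiffAt
      (hc'.of_le (natCast_le_infty n)).contDiffAt
  refine (le_of_eq (congrArg norm e2)).trans ?_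
  exact hb κ κ' h h' ε hε hae x

/-- Scaling of the heat kernel: the kernel at time `s^α` is the rescaled kernel at time one for the
dilated jump kernel, which satisfies the same bounds. -/
theorem heatKernel_scaling {s : ℝ} (hs : 0 < s) (κ : Sp d → ℝ) (x : Sp d) :
    heatKernel α κ (s ^ α) x =
      s ^ (-(d : ℝ)) * heatKernel α (fun z => κ (s • z)) 1 (s⁻¹ • x) := by
  have h1 := integral_comp_smul_pos (fun ξ : Sp d => Real.cos ⟪ξ, s⁻¹ • x⟫ *
    Real.exp (-1 * exponent α (fun z => κ (s • z)) ξ)) hs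
  rw [heatKernel, heatKernel, mul_left_comm, ← h1]
  congr 2; funext ξ
  rw [exponent_smul hs, inner_smul_left, inner_smul_right, conj_trivial,
    mul_inv_cancel_left₀ hs.ne']
  congr 2; ring

theorem heatKernel_eq_scaled (hα : 0 < α) {t : ℝ} (ht : 0 < t) (κ : Sp d → ℝ) (x : Sp d) :
    heatKernel α κ t x = (t ^ (1 / α)) ^ (-(d : ℝ)) *
      heatKernel α (fun z => κ (t ^ (1 / α) • z)) 1 ((t ^ (1 / α))⁻¹ • x) := by
  rw [← heatKernel_scaling (by positivity), ← Real.rpow_mul ht.le,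
    one_div_mul_cancel hα.ne', Real.rpow_one]

theorem tail_inv_smul {s : ℝ} (hs : 0 < s) (x : Sp d) :
    tail α (s⁻¹ • x) = s ^ ((d : ℝ) + α) * (s + ‖x‖) ^ (-(d : ℝ) - α) := by
  have e : 1 + ‖s⁻¹ • x‖ = s⁻¹ * (s + ‖x‖) := by
    rw [norm_smul, Real.norm_of_nonneg (by positivity)]; field_simp
  rw [tail, e, Real.mul_rpow (by positivity) (by positivity), Real.inv_rpow hs.le,
    ← Real.rpow_neg hs.le]
  congr 2; ring

theorem rho_zero_eq {t : ℝ} (γ : ℝ) (x : Sp d) :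
    rho α 0 γ t x = t ^ (γ / α) * (t ^ (1 / α) + ‖x‖) ^ (-(d : ℝ) - α) := by
  simp [rho]

theorem rho_nonneg {t : ℝ} (ht : 0 ≤ t) (β γ : ℝ) (x : Sp d) : 0 ≤ rho α β γ t x := by
  unfold rho; positivity

/-- As the kernels are bounded, `supNorm` of their difference is finite, and it is an almost
everywhere bound. -/
theorem supNorm_bounds (h0 : 0 < κ₀) (h : IsKernel κ₀ κ₁ κ) (h' : IsKernel κ₀ κ₁ κ') :
    0 ≤ supNorm (fun z => κ z - κ' z) ∧ supNorm (fun z => κ z - κ' z) ≤ κ₁ ∧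
      ∀ᵐ z, |κ z - κ' z| ≤ supNorm (fun z => κ z - κ' z) := by
  have hb : ∀ z, |κ z - κ' z| ≤ κ₁ := fun z =>
    abs_le.2 ⟨by linarith [h.pos h0 z, h'.upper z], by linarith [h'.pos h0 z, h.upper z]⟩
  have hle : eLpNorm (fun z => κ z - κ' z) ⊤ volume ≤ ENNReal.ofReal κ₁ := by
    rw [eLpNorm_exponent_top]
    exact eLpNormEssSup_le_of_ae_bound (ae_of_all _ hb)
  refine ⟨ENNReal.toReal_nonneg, ENNReal.toReal_le_of_le_ofReal (h.le_nonneg h0) hle, ?_⟩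
  filter_upwards [ae_le_eLpNormEssSup (f := fun z => κ z - κ' z) (μ := volume)] with z hz
  rw [← Real.norm_eq_abs, ← toReal_enorm, supNorm, eLpNorm_exponent_top]
  rw [eLpNorm_exponent_top] at hle
  exact ENNReal.toReal_mono (ne_top_of_le_ne_top ENNReal.ofReal_ne_top hle) hz

theorem ae_comp_smul {p : Sp d → Prop} (hp : ∀ᵐ z, p z) {s : ℝ} (hs : s ≠ 0) :
    ∀ᵐ z, p (s • z) := by
  rw [ae_iff] at hp ⊢
  have := Measure.addHaar_preimage_smul (volume : Measure (Sp d)) hs {z | ¬p z}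
  rw [hp, mul_zero] at this
  exact this

theorem secondDiff_comp_smul (g : Sp d → ℝ) (c s : ℝ) (x z : Sp d) :
    secondDiff (fun y => c * g (s • y)) x z = c * secondDiff g (s • x) (s • z) := by
  simp only [secondDiff, smul_add, smul_sub]; ring

theorem secondDiff_sub (f g : Sp d → ℝ) (x z : Sp d) :
    secondDiff (fun y => f y - g y) x z = secondDiff f x z - secondDiff g x z := by
  simp only [secondDiff]; ring

theorem norm_gradient_sub {f g : Sp d → ℝ} {x : Sp d} (hf : DifferentiableAt ℝ f x)
    (hg : DifferentiableAt ℝ g x) :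
    ‖gradient f x - gradient g x‖ = ‖fderiv ℝ (fun y => f y - g y) x‖ := by
  rw [fderiv_fun_sub hf hg, gradient, gradient, ← map_sub, LinearIsometryEquiv.norm_map]

theorem contDiff_heatKernel (hd : 1 ≤ d) (hα : α ∈ Set.Ioo (0 : ℝ) 2) (h0 : 0 < κ₀)
    (h : IsKernel κ₀ κ₁ κ) {t : ℝ} (ht : 0 < t) : ContDiff ℝ ∞ (heatKernel α κ t) := by
  rw [funext (heatKernel_eq_scaled hα.1 ht κ)]
  exact contDiff_const.mul ((contDiff_heatKernel_one hd hα h0 (h.comp_smul _)).comp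
    (contDiff_const_smul _))

/-- The continuous dependence estimates, from those at time one by scaling; the summand
`ϱ^γ_{α-γ}` is not needed. -/
theorem exists_heatKernel_sub_le (hd : 1 ≤ d) (hα : α ∈ Set.Ioo (0 : ℝ) 2) (h0 : 0 < κ₀)
    (κ₁ : ℝ) : ∃ C > 0, ∀ κ κ' : Sp d → ℝ, IsKernel κ₀ κ₁ κ → IsKernel κ₀ κ₁ κ' →
      ∀ t > 0, ∀ x : Sp d,
        |heatKernel α κ t x - heatKernel α κ' t x| ≤
          C * supNorm (fun z => κ z - κ' z) * rho α 0 α t x ∧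
        ‖gradient (heatKernel α κ t) x - gradient (heatKernel α κ' t) x‖ ≤
          C * supNorm (fun z => κ z - κ' z) * t ^ (-1 / α) * rho α 0 α t x ∧
        Integrable (fun z => |secondDiff (heatKernel α κ t) x z -
          secondDiff (heatKernel α κ' t) x z| * weight α z) ∧
        ∫ z, |secondDiff (heatKernel α κ t) x z -
            secondDiff (heatKernel α κ' t) x z| * weight α z ≤
          C * supNorm (fun z => κ z - κ' z) * rho α 0 0 t x := by
  obtain ⟨C₀, hC₀, hb₀⟩ := exists_norm_iteratedFDeriv_heatKernel_one_sub_le (d := d) hd hα h0 κ₁ 0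
  obtain ⟨C₁, hC₁, hb₁⟩ := exists_norm_iteratedFDeriv_heatKernel_one_sub_le (d := d) hd hα h0 κ₁ 1
  obtain ⟨C₂, hC₂, hb₂⟩ := exists_norm_iteratedFDeriv_heatKernel_one_sub_le (d := d) hd hα h0 κ₁ 2
  have hS := secondDiffConst_nonneg d α
  refine ⟨1 + C₀ + C₁ + secondDiffConst d α * (C₀ + C₂), by positivity,
    fun κ κ' h h' t ht x => ?_⟩
  -- the dilated kernels differ by at most `ε` too, since dilations preserve null sets
  obtain ⟨hε, hεκ, hae⟩ := supNorm_bounds h0 h h'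
  set ε := supNorm (fun z => κ z - κ' z)
  set C := 1 + C₀ + C₁ + secondDiffConst d α * (C₀ + C₂) with hC
  have hCC : 0 ≤ secondDiffConst d α * (C₀ + C₂) := by positivity
  set s := t ^ (1 / α) with hs_def
  have hs : 0 < s := by positivity
  have hst : s ^ α = t := by
    rw [← Real.rpow_mul ht.le, one_div_mul_cancel hα.1.ne', Real.rpow_one]
  have hsi : t ^ (-1 / α) = s⁻¹ := by
    rw [hs_def, ← Real.rpow_neg ht.le, neg_div]
  have hk := h.comp_smul s
  have hk' := h'.comp_smul s
  have hae' := ae_comp_smul hae hs.ne'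
  let G : Sp d → ℝ := fun y => heatKernel α (fun z => κ (s • z)) 1 y -
    heatKernel α (fun z => κ' (s • z)) 1 y
  have hG : ContDiff ℝ ∞ G := (contDiff_heatKernel_one hd hα h0 hk).sub
    (contDiff_heatKernel_one hd hα h0 hk')
  have hdiff : (fun y => heatKernel α κ t y - heatKernel α κ' t y) =
      fun y => s ^ (-(d : ℝ)) * G (s⁻¹ • y) := by
    funext y
    rw [← hst, heatKernel_scaling hs, heatKernel_scaling hs, ← mul_sub]
  have hG0 : ∀ y, |G y| ≤ C₀ * ε * tail α y := fun y => by
    have := hb₀ _ _ hk hk' ε hεκ hae' y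
    rwa [norm_iteratedFDeriv_zero, Real.norm_eq_abs] at this
  have hG1 : ∀ y, ‖fderiv ℝ G y‖ ≤ C₁ * ε * tail α y := fun y => by
    have := hb₁ _ _ hk hk' ε hεκ hae' y
    rwa [← norm_iteratedFDeriv_fderiv, norm_iteratedFDeriv_zero] at this
  have hG2 := hb₂ _ _ hk hk' ε hεκ hae'
  have hr : rho α 0 α t x = s ^ (-(d : ℝ)) * tail α (s⁻¹ • x) := by
    rw [rho_zero_eq, div_self hα.1.ne', Real.rpow_one, tail_inv_smul hs, ← mul_assoc,
      ← Real.rpow_add hs, neg_add_cancel_left, hst]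
  have hr0 : rho α 0 0 t x = s ^ (-(d : ℝ) - α) * tail α (s⁻¹ • x) := by
    rw [rho_zero_eq, zero_div, Real.rpow_zero, tail_inv_smul hs, ← mul_assoc,
      ← Real.rpow_add hs, show -(d : ℝ) - α + (d + α) = 0 by ring, Real.rpow_zero, one_mul]
  have hsd : 0 ≤ s ^ (-(d : ℝ)) := by positivity
  have ht0 := (tail_pos α (s⁻¹ • x)).le
  have hC0 : C₀ ≤ C := by linarith
  have hC1 : C₁ ≤ C := by linarith
  refine ⟨?_, ?_, ?_⟩
  · have e : heatKernel α κ t x - heatKernel α κ' t x = s ^ (-(d : ℝ)) * G (s⁻¹ • x) :=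
      congrFun hdiff x
    rw [e, abs_mul, abs_of_nonneg hsd, hr]
    calc _ ≤ s ^ (-(d : ℝ)) * (C₀ * ε * tail α (s⁻¹ • x)) := by gcongr; exact hG0 _
      _ ≤ s ^ (-(d : ℝ)) * (C * ε * tail α (s⁻¹ • x)) := by gcongr
      _ = _ := by ring
  · have hd1 := fun {κ : Sp d → ℝ} (hκ : IsKernel κ₀ κ₁ κ) =>
      (contDiff_heatKernel hd hα h0 hκ ht).differentiable (by simp) x
    have hGd : Differentiable ℝ G := hG.differentiable (by simp)
    have hGs : DifferentiableAt ℝ (fun y => G (s⁻¹ • y)) x :=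
      (hGd _).comp x (differentiable_id.const_smul s⁻¹ x)
    rw [norm_gradient_sub (hd1 h) (hd1 h'), hdiff, fderiv_const_mul hGs, fderiv_comp_smul,
      norm_smul, norm_smul, Real.norm_of_nonneg hsd, Real.norm_of_nonneg (inv_nonneg.2 hs.le),
      hr, hsi]
    calc _ ≤ s ^ (-(d : ℝ)) * (s⁻¹ * (C₁ * ε * tail α (s⁻¹ • x))) := by gcongr; exact hG1 _
      _ ≤ s ^ (-(d : ℝ)) * (s⁻¹ * (C * ε * tail α (s⁻¹ • x))) := by gcongr
      _ = _ := by ring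
  · have hB : ∀ {y : Sp d} {D r : ℝ}, D ≤ C₀ + C₂ → r ≤ D * ε * tail α y →
        r ≤ (C₀ + C₂) * ε * tail α y := fun {y D r} hD hr => hr.trans (by
      have := (tail_pos α y).le
      gcongr)
    obtain ⟨hI, hle⟩ := integrable_and_integral_secondDiff_le (B := (C₀ + C₂) * ε) hd hα
      (contDiff_infty.1 hG 2) (fun y => hB (by linarith) (hG0 y))
      (fun y => hB (by linarith) (hG2 y)) (s⁻¹ • x)
    have e : (fun z => |secondDiff (heatKernel α κ t) x z -
        secondDiff (heatKernel α κ' t) x z| * weight α z) = fun z =>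
        s ^ (-(d : ℝ)) * s ^ (-(d : ℝ) - α) *
          (|secondDiff G (s⁻¹ • x) (s⁻¹ • z)| * weight α (s⁻¹ • z)) := by
      funext z
      have hwz : weight α z = s ^ (-(d : ℝ) - α) * weight α (s⁻¹ • z) := by
        rw [← weight_smul hs, smul_inv_smul₀ hs.ne']
      rw [← secondDiff_sub, hdiff, secondDiff_comp_smul, abs_mul, abs_of_nonneg hsd, hwz]
      ring
    rw [e]
    refine ⟨(hI.comp_smul (inv_ne_zero hs.ne')).const_mul _, ?_⟩
    have hsc := integral_comp_smul_pos
      (fun u => |secondDiff G (s⁻¹ • x) u| * weight α u) (inv_pos.2 hs)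
    rw [integral_const_mul, hsc, hr0, Real.inv_rpow hs.le, Real.rpow_neg hs.le, inv_inv]
    have hsp : 0 < s ^ (d : ℝ) := by positivity
    calc _ = s ^ (-(d : ℝ) - α) * ∫ u, |secondDiff G (s⁻¹ • x) u| * weight α u := by
          field_simp
      _ ≤ s ^ (-(d : ℝ) - α) * (secondDiffConst d α * ((C₀ + C₂) * ε) * tail α (s⁻¹ • x)) := by
          gcongr
      _ = s ^ (-(d : ℝ) - α) * (secondDiffConst d α * (C₀ + C₂) * ε * tail α (s⁻¹ • x)) := by
          ring
      _ ≤ s ^ (-(d : ℝ) - α) * (C * ε * tail α (s⁻¹ • x)) := by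
          gcongr; linarith
      _ = _ := by ring

end AllTimes

/-! ### Symbols with nonnegative Fourier transform -/

section NonnegativeFourier

open scoped FourierTransform

variable {d : ℕ} {α κ₀ κ₁ : ℝ} {κ : Sp d → ℝ}

/-- The Fourier transform of `m` is real and nonnegative. -/
def NonnegFourier (m : Sp d → ℂ) : Prop := ∀ x, 0 ≤ (𝓕 m x).re ∧ (𝓕 m x).im = 0

theorem NonnegFourier.of_tendsto {m : ℕ → Sp d → ℂ} {m' : Sp d → ℂ} {b : Sp d → ℝ}
    (h : ∀ n, NonnegFourier (m n)) (hm : ∀ n, Continuous (m n)) (hb : Integrable b)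
    (hle : ∀ n ξ, ‖m n ξ‖ ≤ b ξ) (hlim : ∀ ξ, Tendsto (fun n => m n ξ) atTop (𝓝 (m' ξ))) :
    NonnegFourier m' := by
  intro x
  have hI : ∀ n, Integrable (m n) := fun n =>
    hb.mono' (hm n).aestronglyMeasurable (ae_of_all _ (hle n))
  have ht : Tendsto (fun n => 𝓕 (m n) x) atTop (𝓝 (𝓕 m' x)) :=
    tendsto_integral_of_dominated_convergence b
      (fun n => (integrable_character_smul (hI n) x).aestronglyMeasurable) hb
      (fun n => ae_of_all _ fun ξ => by
        rw [Circle.norm_smul]; exact hle n ξ)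
      (ae_of_all _ fun ξ => (hlim ξ).const_smul _)
  refine ⟨ge_of_tendsto' ((Complex.continuous_re.tendsto _).comp ht) fun n => (h n x).1, ?_⟩
  exact tendsto_nhds_unique ((Complex.continuous_im.tendsto _).comp ht)
    ((tendsto_congr fun n => (h n x).2).2 tendsto_const_nhds)

theorem NonnegFourier.cosTransform_smul {m : Sp d → ℂ} (h : NonnegFourier m) (hm : Integrable m)
    {f : Sp d → ℝ} (hf : Integrable f) (heven : ∀ z, f (-z) = f z) (hnn : ∀ z, 0 ≤ f z) :
    NonnegFourier fun ξ => (cosTransform f ξ : ℂ) • m ξ := by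
  intro x
  rw [fourier_cosTransform_smul hf heven hm]
  have e : ∀ z, (f z : ℂ) • 𝓕 m (x + z) = ((f z * (𝓕 m (x + z)).re : ℝ) : ℂ) := fun z => by
    apply Complex.ext
    · simp
    · simp [(h (x + z)).2]
  simp_rw [e]
  rw [integral_complex_ofReal]
  exact ⟨integral_nonneg fun z => mul_nonneg (hnn z) (h _).1, Complex.ofReal_im _⟩

/-- Compound Poisson transition operators preserve positivity. -/
theorem NonnegFourier.exp_neg_symb_smul {m : Sp d → ℂ} (h : NonnegFourier m) (hm : Integrable m)
    {f : Sp d → ℝ} (hf : Integrable f) (heven : ∀ z, f (-z) = f z) (hnn : ∀ z, 0 ≤ f z) :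
    NonnegFourier fun ξ => (Real.exp (-symb f ξ) : ℂ) • m ξ := by
  have hpow : ∀ n : ℕ, NonnegFourier fun ξ => ((cosTransform f ξ ^ n : ℝ) : ℂ) • m ξ := by
    intro n
    induction n with
    | zero => simpa using h
    | succ n ih =>
      have hi : Integrable fun ξ => ((cosTransform f ξ ^ n : ℝ) : ℂ) • m ξ :=
        integrable_smul_of_bounded ((continuous_cosTransform hf).pow n)
          (M := (∫ z, |f z|) ^ n) (fun ξ => by
            rw [abs_pow]
            exact pow_le_pow_left₀ (abs_nonneg _) (abs_cosTransform_le hf ξ) n) hm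
      have h1 := ih.cosTransform_smul hi hf heven hnn
      have e : (fun ξ => ((cosTransform f ξ ^ (n + 1) : ℝ) : ℂ) • m ξ) =
          fun ξ => (cosTransform f ξ : ℂ) • ((cosTransform f ξ ^ n : ℝ) : ℂ) • m ξ := by
        funext ξ
        rw [smul_smul, pow_succ', Complex.ofReal_mul]
      rw [e]; exact h1
  intro x
  have hs := hasSum_fourier_exp_smul (continuous_cosTransform hf) (abs_cosTransform_le hf) hm x
  have e : 𝓕 (fun ξ => (Real.exp (-symb f ξ) : ℂ) • m ξ) x =
      (Real.exp (-∫ z, f z) : ℂ) * 𝓕 (fun ξ => (Real.exp (cosTransform f ξ) : ℂ) • m ξ) x := by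
    rw [Real.fourier_eq, Real.fourier_eq, ← integral_const_mul]
    congr 1; funext ξ
    rw [symb_eq_sub_cosTransform hf, mul_smul_comm, smul_eq_mul, smul_eq_mul, ← mul_assoc,
      ← Complex.ofReal_mul, ← Real.exp_add]
    congr 4; ring
  have hre := Complex.hasSum_re hs
  have him := Complex.hasSum_im hs
  have hfac : ∀ (n : ℕ) (w : ℂ), ((n.factorial : ℂ)⁻¹ • w).re = (n.factorial : ℝ)⁻¹ * w.re ∧
      ((n.factorial : ℂ)⁻¹ • w).im = (n.factorial : ℝ)⁻¹ * w.im := fun n w => by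
    have : ((n.factorial : ℂ)⁻¹) = (((n.factorial : ℝ)⁻¹ : ℝ) : ℂ) := by push_cast; rfl
    rw [this, smul_eq_mul]
    exact ⟨Complex.re_ofReal_mul _ _, Complex.im_ofReal_mul _ _⟩
  have h1 : 0 ≤ (𝓕 (fun ξ => (Real.exp (cosTransform f ξ) : ℂ) • m ξ) x).re :=
    hre.nonneg fun n => by
      rw [(hfac n _).1]; exact mul_nonneg (by positivity) (hpow n x).1
  have h2 : (𝓕 (fun ξ => (Real.exp (cosTransform f ξ) : ℂ) • m ξ) x).im = 0 := by
    refine him.unique ?_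
    have : (fun n : ℕ => ((n.factorial : ℂ)⁻¹ •
        𝓕 (fun ξ => ((cosTransform f ξ ^ n : ℝ) : ℂ) • m ξ) x).im) = fun _ => 0 := by
      funext n; rw [(hfac n _).2, (hpow n x).2, mul_zero]
    rw [this]; exact hasSum_zero
  rw [e, Complex.re_ofReal_mul, Complex.im_ofReal_mul, h2, mul_zero]
  exact ⟨mul_nonneg (Real.exp_pos _).le h1, rfl⟩

/-- The Gaussian `e^{-b|ξ|²}`, with complex values. -/
def gauss (b : ℝ) (ξ : Sp d) : ℂ := Complex.exp (-(b : ℂ) * ‖ξ‖ ^ 2)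

theorem gauss_eq (b : ℝ) (ξ : Sp d) : gauss b ξ = (Real.exp (-b * ‖ξ‖ ^ 2) : ℂ) := by
  rw [gauss]; push_cast; rfl

theorem norm_gauss (b : ℝ) (ξ : Sp d) : ‖gauss b ξ‖ = Real.exp (-b * ‖ξ‖ ^ 2) := by
  rw [gauss_eq, Complex.norm_real, Real.norm_eq_abs, Real.abs_exp]

theorem continuous_gauss (b : ℝ) : Continuous (gauss b : Sp d → ℂ) := by
  unfold gauss; fun_prop

theorem integrable_gauss {b : ℝ} (hb : 0 < b) : Integrable (gauss b : Sp d → ℂ) := by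
  have := GaussianFourier.integrable_cexp_neg_mul_sq_norm_add (V := Sp d) (b := (b : ℂ))
    (by simpa using hb) 0 0
  refine this.congr (ae_of_all _ fun v => ?_)
  simp [gauss]

theorem nonnegFourier_gauss {b : ℝ} (hb : 0 < b) : NonnegFourier (gauss b : Sp d → ℂ) := by
  intro x
  have h := fourier_gaussian_innerProductSpace (V := Sp d) (b := (b : ℂ)) (by simpa using hb) x
  have e : 𝓕 (gauss b : Sp d → ℂ) x =
      (((Real.pi / b) ^ ((d : ℝ) / 2) * Real.exp (-Real.pi ^ 2 * ‖x‖ ^ 2 / b) : ℝ) : ℂ) := by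
    refine h.trans ?_
    rw [finrank_euclideanSpace, Fintype.card_fin]
    push_cast
    rw [Complex.ofReal_cpow (by positivity)]
    push_cast
    rfl
  rw [e]
  exact ⟨by rw [Complex.ofReal_re]; positivity, Complex.ofReal_im _⟩

end NonnegativeFourier

/-! ### Positivity, mass and concentration of the heat kernel -/

section Positivity

open scoped FourierTransform

variable {d : ℕ} {α κ₀ κ₁ : ℝ} {κ : Sp d → ℝ}

/-- The density of the jumps of size larger than `1/n`. -/
def truncJump (α : ℝ) (κ : Sp d → ℝ) (n : ℕ) : Sp d → ℝ :=
  Set.indicator {z | 1 < n * ‖z‖} fun z => κ z * weight α z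

theorem measurable_truncJump (h : Measurable κ) (n : ℕ) : Measurable (truncJump α κ n) :=
  (h.mul (measurable_weight α)).indicator (measurableSet_lt (by fun_prop) (by fun_prop))

theorem truncJump_nonneg (h0 : 0 < κ₀) (h : IsKernel κ₀ κ₁ κ) (n : ℕ) (z : Sp d) :
    0 ≤ truncJump α κ n z :=
  Set.indicator_nonneg (fun z _ => mul_nonneg (h.pos h0 z).le (weight_nonneg α z)) z

theorem truncJump_le (h0 : 0 < κ₀) (h : IsKernel κ₀ κ₁ κ) (n : ℕ) (z : Sp d) :
    truncJump α κ n z ≤ κ z * weight α z :=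
  Set.indicator_le_self' (fun _ _ => mul_nonneg (h.pos h0 z).le (weight_nonneg α z)) z

theorem truncJump_neg (h : IsKernel κ₀ κ₁ κ) (n : ℕ) (z : Sp d) :
    truncJump α κ n (-z) = truncJump α κ n z := by
  simp [truncJump, Set.indicator, weight_neg, ← h.symm z]

theorem integrable_truncJump (hd : 1 ≤ d) (hα : α ∈ Set.Ioo (0 : ℝ) 2) (h0 : 0 < κ₀)
    (h : IsKernel κ₀ κ₁ κ) (n : ℕ) : Integrable (truncJump α κ n) := by
  refine (((integrable_levyWeight hd hα).const_mul ((n : ℝ) ^ 2)).const_mul κ₁).mono'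
    (measurable_truncJump h.measurable n).aestronglyMeasurable (ae_of_all _ fun z => ?_)
  rw [Real.norm_of_nonneg (truncJump_nonneg h0 h n z)]
  have hn := nearWeight_nonneg α z
  have hf := farWeight_nonneg α z
  refine Set.indicator_apply_le' (fun hz => ?_) (fun _ => ?_)
  · have hz' : 1 < n * ‖z‖ := hz
    have hn1 : (1 : ℝ) ≤ n := by
      rcases Nat.eq_zero_or_pos n with rfl | hn
      · norm_num at hz'
      · exact_mod_cast hn
    refine mul_le_mul (h.upper z) ?_ (weight_nonneg α z) (h.le_nonneg h0)
    rw [← nearWeight_add_farWeight, levyWeight]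
    have h1 : 1 ≤ (n * ‖z‖) ^ 2 := one_le_pow₀ hz'.le
    have h2 : (1 : ℝ) ≤ n ^ 2 := one_le_pow₀ hn1
    nlinarith [mul_le_mul_of_nonneg_right h1 hn, mul_le_mul_of_nonneg_right h2 hf]
  · exact mul_nonneg (h.le_nonneg h0) (mul_nonneg (sq_nonneg _) (levyWeight_nonneg α z))

theorem symb_truncJump_nonneg (h0 : 0 < κ₀) (h : IsKernel κ₀ κ₁ κ) (n : ℕ) (ξ : Sp d) :
    0 ≤ symb (truncJump α κ n) ξ :=
  integral_nonneg fun z => mul_nonneg (by linarith [Real.cos_le_one (2 * Real.pi * ⟪z, ξ⟫)])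
    (truncJump_nonneg h0 h n z)

theorem tendsto_symb_truncJump (hd : 1 ≤ d) (hα : α ∈ Set.Ioo (0 : ℝ) 2) (h0 : 0 < κ₀)
    (h : IsKernel κ₀ κ₁ κ) (ξ : Sp d) :
    Tendsto (fun n => symb (truncJump α κ n) ξ) atTop
      (𝓝 (exponent α κ ((2 * Real.pi) • ξ))) := by
  rw [exponent_two_pi_smul]
  have hmk : Measurable fun z : Sp d => κ z * weight α z := h.measurable.mul (measurable_weight α)
  have hle : ∀ z, |κ z * weight α z| ≤ κ₁ * weight α z := fun z => by
    rw [abs_mul, abs_of_nonneg (weight_nonneg α z)]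
    exact mul_le_mul_of_nonneg_right (h.abs_le h0 z) (weight_nonneg α z)
  refine tendsto_integral_of_dominated_convergence _ (fun n => ?_)
    (integrable_symb_integrand hd hα hmk (h.le_nonneg h0) hle ξ).norm
    (fun n => ae_of_all _ fun z => ?_) (ae_of_all _ fun z => ?_)
  · have := measurable_truncJump (α := α) h.measurable n
    fun_prop
  · rw [norm_mul, norm_mul, Real.norm_of_nonneg (truncJump_nonneg h0 h n z),
      Real.norm_of_nonneg (mul_nonneg (h.pos h0 z).le (weight_nonneg α z))]
    exact mul_le_mul_of_nonneg_left (truncJump_le h0 h n z) (norm_nonneg _)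
  · rcases eq_or_ne z 0 with rfl | hz
    · simp
    · refine tendsto_const_nhds.congr' ?_
      have hz' : 0 < ‖z‖ := norm_pos_iff.2 hz
      filter_upwards [(tendsto_natCast_atTop_atTop (R := ℝ)).eventually_gt_atTop (1 / ‖z‖)]
        with n hn
      have : z ∈ {z : Sp d | 1 < n * ‖z‖} := (div_lt_iff₀ hz').1 hn
      rw [truncJump, Set.indicator_of_mem this]

/-- The Lévy process is approximated by compound Poisson processes; the Gaussian factor provides
the integrability that their characteristic functions lack. -/
theorem nonnegFourier_charOne_smul_gauss (hd : 1 ≤ d) (hα : α ∈ Set.Ioo (0 : ℝ) 2) (h0 : 0 < κ₀)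
    (h : IsKernel κ₀ κ₁ κ) {b : ℝ} (hb : 0 < b) :
    NonnegFourier fun ξ => charOne α κ ξ • gauss b ξ := by
  refine NonnegFourier.of_tendsto
    (m := fun n ξ => (Real.exp (-symb (truncJump α κ n) ξ) : ℂ) • gauss b ξ)
    (fun n => (nonnegFourier_gauss hb).exp_neg_symb_smul (integrable_gauss hb)
      (integrable_truncJump hd hα h0 h n) (truncJump_neg h n) (truncJump_nonneg h0 h n))
    (fun n => ?_) (integrable_gauss hb).norm (fun n ξ => ?_) fun ξ => ?_
  · exact (Complex.continuous_ofReal.comp (Real.continuous_exp.comp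
      (continuous_symb (integrable_truncJump hd hα h0 h n)).neg)).smul (continuous_gauss b)
  · rw [norm_smul, Complex.norm_real, Real.norm_eq_abs, Real.abs_exp]
    exact mul_le_of_le_one_left (norm_nonneg _)
      (Real.exp_le_one_iff.2 (by linarith [symb_truncJump_nonneg (α := α) h0 h n ξ]))
  · exact ((Complex.continuous_ofReal.tendsto _).comp ((Real.continuous_exp.tendsto _).comp
      (tendsto_symb_truncJump hd hα h0 h ξ).neg)).smul_const _

/-- The Gaussian factor is removed by letting its width tend to infinity. -/
theorem nonnegFourier_charOne (hd : 1 ≤ d) (hα : α ∈ Set.Ioo (0 : ℝ) 2) (h0 : 0 < κ₀)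
    (h : IsKernel κ₀ κ₁ κ) : NonnegFourier (charOne α κ) := by
  refine NonnegFourier.of_tendsto
    (m := fun n ξ => charOne α κ ξ • gauss (1 / ((n : ℝ) + 1)) ξ)
    (fun n => nonnegFourier_charOne_smul_gauss hd hα h0 h (by positivity))
    (fun n => (continuous_charOne hd hα h0 h).smul (continuous_gauss _))
    (integrable_charOne hd hα h0 h).norm (fun n ξ => ?_) fun ξ => ?_
  · rw [norm_smul, norm_gauss]
    refine mul_le_of_le_one_right (norm_nonneg _) (Real.exp_le_one_iff.2 ?_)
    rw [neg_mul, neg_nonpos]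
    positivity
  · have h1 : Tendsto (fun n : ℕ => Real.exp (-(1 / ((n : ℝ) + 1)) * ‖ξ‖ ^ 2)) atTop (𝓝 1) := by
      have := ((tendsto_one_div_add_atTop_nhds_zero_nat (𝕜 := ℝ)).neg.mul_const (‖ξ‖ ^ 2))
      rw [neg_zero, zero_mul] at this
      simpa [Function.comp_def] using (Real.continuous_exp.tendsto _).comp this
    have h2 := ((Complex.continuous_ofReal.tendsto _).comp h1).const_smul (charOne α κ ξ)
    simp only [Complex.ofReal_one, smul_eq_mul, mul_one] at h2
    refine h2.congr fun n => ?_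
    rw [gauss_eq, smul_eq_mul, Function.comp_apply]

theorem heatKernel_nonneg (hd : 1 ≤ d) (hα : α ∈ Set.Ioo (0 : ℝ) 2) (h0 : 0 < κ₀)
    (h : IsKernel κ₀ κ₁ κ) {t : ℝ} (ht : 0 < t) (x : Sp d) : 0 ≤ heatKernel α κ t x := by
  rw [heatKernel_eq_scaled hα.1 ht, heatKernel_one_eq hd hα h0 (h.comp_smul _)]
  exact mul_nonneg (by positivity) (nonnegFourier_charOne hd hα h0 (h.comp_smul _) _).1

theorem integrable_heatKernel_one (hd : 1 ≤ d) (hα : α ∈ Set.Ioo (0 : ℝ) 2) (h0 : 0 < κ₀)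
    (h : IsKernel κ₀ κ₁ κ) : Integrable (heatKernel α κ 1) := by
  obtain ⟨C, -, hC⟩ := exists_abs_heatKernel_one_le hd hα h0 κ₁
  exact ((integrable_tail hα.1).const_mul C).mono'
    (contDiff_heatKernel_one hd hα h0 h).continuous.aestronglyMeasurable (ae_of_all _ (hC κ h))

theorem integrable_heatKernel (hd : 1 ≤ d) (hα : α ∈ Set.Ioo (0 : ℝ) 2) (h0 : 0 < κ₀)
    (h : IsKernel κ₀ κ₁ κ) {t : ℝ} (ht : 0 < t) : Integrable (heatKernel α κ t) := by
  rw [funext (heatKernel_eq_scaled hα.1 ht κ)]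
  exact ((integrable_heatKernel_one hd hα h0 (h.comp_smul _)).comp_smul
    (by positivity)).const_mul _

/-- The heat kernel has mass one: its integral is the characteristic function at the origin. -/
theorem integral_heatKernel_one (hd : 1 ≤ d) (hα : α ∈ Set.Ioo (0 : ℝ) 2) (h0 : 0 < κ₀)
    (h : IsKernel κ₀ κ₁ κ) : ∫ x, heatKernel α κ 1 x = 1 := by
  have e : 𝓕 (charOne α κ) = fun x => (heatKernel α κ 1 x : ℂ) := by
    funext x
    rw [heatKernel_one_eq hd hα h0 h]
    exact Complex.ext rfl (nonnegFourier_charOne hd hα h0 h x).2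
  have hI : Integrable (𝓕 (charOne α κ)) := by
    rw [e]; exact (integrable_heatKernel_one hd hα h0 h).ofReal
  have h1 := congrFun ((continuous_charOne hd hα h0 h).fourierInv_fourier_eq
    (integrable_charOne hd hα h0 h) hI) 0
  rw [e, Real.fourierInv_eq] at h1
  have h2 : charOne α κ (0 : Sp d) = 1 := by simp [charOne, exponent]
  simp only [inner_zero_right, AddChar.map_zero_eq_one, one_smul, h2] at h1
  rw [integral_complex_ofReal] at h1
  exact_mod_cast h1

/-- In the rescaled variable `t^{-1/α} x` the heat kernel is dominated by a multiple of `tail` that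
is independent of `t`, although the rescaled kernel `κ` changes with `t`. -/
theorem tendsto_integral_heatKernel_mul (hd : 1 ≤ d) (hα : α ∈ Set.Ioo (0 : ℝ) 2) (h0 : 0 < κ₀)
    (h : IsKernel κ₀ κ₁ κ) {f : Sp d → ℝ} (hf : Continuous f) {M : ℝ} (hM : ∀ x, |f x| ≤ M) :
    Tendsto (fun t => ∫ x, heatKernel α κ t x * f x) (𝓝[>] 0) (𝓝 (f 0)) := by
  obtain ⟨C, hC0, hC⟩ := exists_abs_heatKernel_one_le hd hα h0 κ₁
  have hs : Tendsto (fun t : ℝ => t ^ (1 / α)) (𝓝[>] 0) (𝓝 0) := by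
    have h1 : 0 < 1 / α := one_div_pos.2 hα.1
    have := (Real.continuousAt_rpow_const 0 (1 / α) (Or.inr h1.le)).tendsto
    rw [Real.zero_rpow h1.ne'] at this
    exact this.mono_left nhdsWithin_le_nhds
  have hlim : Tendsto (fun t : ℝ => ∫ y : Sp d, C * tail α y * |f (t ^ (1 / α) • y) - f 0|)
      (𝓝[>] 0) (𝓝 (∫ _ : Sp d, (0 : ℝ))) := by
    refine tendsto_integral_filter_of_dominated_convergence (fun y => C * tail α y * (2 * M))
      (Eventually.of_forall fun t => ?_) (Eventually.of_forall fun t => ae_of_all _ fun y => ?_)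
      (((integrable_tail hα.1).const_mul C).mul_const _) (ae_of_all _ fun y => ?_)
    · have := continuous_tail (d := d) α
      exact Continuous.aestronglyMeasurable (by fun_prop)
    · have := (tail_pos α y).le
      rw [Real.norm_of_nonneg (by positivity)]
      gcongr
      linarith [abs_sub (f (t ^ (1 / α) • y)) (f 0), hM (t ^ (1 / α) • y), hM 0]
    · have h1 : Tendsto (fun t : ℝ => t ^ (1 / α) • y) (𝓝[>] 0) (𝓝 0) := by
        simpa using hs.smul_const y
      have h2 := ((((hf.tendsto 0).comp h1).sub_const (f 0)).abs).const_mul (C * tail α y)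
      simpa using h2
  rw [integral_zero] at hlim
  rw [tendsto_iff_dist_tendsto_zero]
  refine squeeze_zero' (Eventually.of_forall fun _ => dist_nonneg) ?_ hlim
  filter_upwards [self_mem_nhdsWithin] with t ht
  have ht : 0 < t := ht
  have hst : 0 < t ^ (1 / α) := by positivity
  set s := t ^ (1 / α) with hsdef
  set P := heatKernel α (fun z => κ (s • z)) 1 with hP
  have hk := h.comp_smul s
  have hPi : Integrable P := integrable_heatKernel_one hd hα h0 hk
  have hPc : Continuous P := (contDiff_heatKernel_one hd hα h0 hk).continuous
  have hPf : Integrable fun y => P y * f (s • y) :=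
    hPi.mul_bdd (c := M) (Continuous.aestronglyMeasurable (by fun_prop)) (ae_of_all _ fun y => hM _)
  have e1 : ∫ x, heatKernel α κ t x * f x = ∫ y, P y * f (s • y) := by
    have := integral_comp_smul_pos (fun x => heatKernel α κ t x * f x) hst
    rw [eq_comm, Real.rpow_neg hst.le, inv_mul_eq_iff_eq_mul₀ (by positivity)] at this
    rw [this, ← integral_const_mul]
    refine integral_congr_ae (ae_of_all _ fun y => ?_)
    simp only
    rw [heatKernel_eq_scaled hα.1 ht, ← hsdef, inv_smul_smul₀ hst.ne', ← hP,
      Real.rpow_neg hst.le]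
    field_simp
  have e2 : f 0 = ∫ y, P y * f 0 := by
    rw [integral_mul_const, integral_heatKernel_one hd hα h0 hk, one_mul]
  rw [e1, Real.dist_eq]
  nth_rw 1 [e2]
  rw [← integral_sub hPf (hPi.mul_const _)]
  rw [← Real.norm_eq_abs]
  refine norm_integral_le_of_norm_le ?_ (ae_of_all _ fun y => ?_)
  · refine (((integrable_tail hα.1).const_mul C).mul_bdd (c := 2 * M)
      (Continuous.aestronglyMeasurable (by fun_prop)) (ae_of_all _ fun y => ?_))
    rw [Real.norm_eq_abs, abs_abs]
    linarith [abs_sub (f (s • y)) (f 0), hM (s • y), hM 0]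
  · rw [← mul_sub, norm_mul]
    exact mul_le_mul_of_nonneg_right (hC _ hk y) (abs_nonneg _)

end Positivity

/-! ### The heat equation -/

section HeatEquation

open scoped FourierTransform

variable {d : ℕ} {α κ₀ κ₁ : ℝ} {κ : Sp d → ℝ}

theorem integrable_sq_add_two_mul_exp_exponent (hd : 1 ≤ d) (hα : α ∈ Set.Ioo (0 : ℝ) 2)
    (h0 : 0 < κ₀) (h : IsKernel κ₀ κ₁ κ) {t : ℝ} (ht : 0 < t) :
    Integrable fun ξ : Sp d => (‖ξ‖ ^ 2 + 2) * Real.exp (-t * exponent α κ ξ) := by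
  obtain ⟨c, hc, hle⟩ := exists_le_exponent hd hα h0 κ₁
  have hE := continuous_exponent hd hα h0 h
  refine ((integrable_pow_mul_exp hα.1 (mul_pos ht hc) 2).const_mul 2).mono'
    (Continuous.aestronglyMeasurable (by fun_prop)) (ae_of_all _ fun ξ => ?_)
  rw [Real.norm_of_nonneg (by positivity), ← mul_assoc]
  refine mul_le_mul ?_ (Real.exp_le_exp.2 ?_) (Real.exp_pos _).le (by positivity)
  · nlinarith [norm_nonneg ξ]
  · nlinarith [hle κ h ξ]

theorem integrable_cos_mul_exp_exponent (hd : 1 ≤ d) (hα : α ∈ Set.Ioo (0 : ℝ) 2)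
    (h0 : 0 < κ₀) (h : IsKernel κ₀ κ₁ κ) {t : ℝ} (ht : 0 < t) (x : Sp d) :
    Integrable fun ξ : Sp d => Real.cos ⟪ξ, x⟫ * Real.exp (-t * exponent α κ ξ) := by
  have hE := continuous_exponent hd hα h0 h
  refine (integrable_sq_add_two_mul_exp_exponent hd hα h0 h ht).mono'
    (Continuous.aestronglyMeasurable (by fun_prop)) (ae_of_all _ fun ξ => ?_)
  rw [norm_mul, Real.norm_eq_abs, Real.norm_eq_abs, Real.abs_exp]
  refine mul_le_mul_of_nonneg_right ?_ (Real.exp_pos _).le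
  nlinarith [Real.abs_cos_le_one ⟪ξ, x⟫, norm_nonneg ξ]

theorem secondDiff_heatKernel (hd : 1 ≤ d) (hα : α ∈ Set.Ioo (0 : ℝ) 2)
    (h0 : 0 < κ₀) (h : IsKernel κ₀ κ₁ κ) {t : ℝ} (ht : 0 < t) (x z : Sp d) :
    secondDiff (heatKernel α κ t) x z = ((2 * Real.pi) ^ d)⁻¹ * ∫ ξ : Sp d,
      -2 * (Real.cos ⟪ξ, x⟫ * Real.exp (-t * exponent α κ ξ)) * (1 - Real.cos ⟪ξ, z⟫) := by
  have hi := integrable_cos_mul_exp_exponent hd hα h0 h ht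
  simp only [secondDiff, heatKernel]
  rw [← mul_add, ← integral_add (hi _) (hi _), mul_left_comm, ← mul_sub, ← integral_const_mul,
    ← integral_sub ((hi (x + z)).fun_add (hi (x - z))) ((hi x).const_mul 2)]
  congr 2; funext ξ
  rw [inner_add_right, inner_sub_right, Real.cos_add, Real.cos_sub]
  ring

/-- The integrand of `levyOp α κ (heatKernel α κ t) x` after Fourier inversion. -/
def levyOpKernel (α : ℝ) (κ : Sp d → ℝ) (t : ℝ) (x : Sp d) (z ξ : Sp d) : ℝ :=
  ((2 * Real.pi) ^ d)⁻¹ * (-2 * (Real.cos ⟪ξ, x⟫ * Real.exp (-t * exponent α κ ξ)) *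
    ((1 - Real.cos ⟪ξ, z⟫) * κ z * weight α z))

theorem integral_levyOpKernel_right (hd : 1 ≤ d) (hα : α ∈ Set.Ioo (0 : ℝ) 2)
    (h0 : 0 < κ₀) (h : IsKernel κ₀ κ₁ κ) {t : ℝ} (ht : 0 < t) (x z : Sp d) :
    ∫ ξ, levyOpKernel α κ t x z ξ = secondDiff (heatKernel α κ t) x z * κ z * weight α z := by
  rw [secondDiff_heatKernel hd hα h0 h ht, mul_assoc, mul_assoc, ← integral_mul_const,
    ← integral_const_mul]
  congr 1; funext ξ
  rw [levyOpKernel]; ring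

theorem integral_levyOpKernel_left (t : ℝ) (x ξ : Sp d) :
    ∫ z, levyOpKernel α κ t x z ξ = ((2 * Real.pi) ^ d)⁻¹ *
      (-2 * (Real.cos ⟪ξ, x⟫ * Real.exp (-t * exponent α κ ξ)) * exponent α κ ξ) := by
  simp only [levyOpKernel]
  rw [integral_const_mul, integral_const_mul, exponent]

theorem integrable_levyOpKernel (hd : 1 ≤ d) (hα : α ∈ Set.Ioo (0 : ℝ) 2)
    (h0 : 0 < κ₀) (h : IsKernel κ₀ κ₁ κ) {t : ℝ} (ht : 0 < t) (x : Sp d) :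
    Integrable (fun q : Sp d × Sp d => levyOpKernel α κ t x q.1 q.2) (volume.prod volume) := by
  have hE := continuous_exponent hd hα h0 h
  have hκ := h.measurable
  have hw := measurable_weight (d := d) α
  have hm : Measurable fun q : Sp d × Sp d => levyOpKernel α κ t x q.1 q.2 := by
    have hE' := hE.measurable
    unfold levyOpKernel
    fun_prop
  refine ((((integrable_levyWeight hd hα).mul_prod
    (integrable_sq_add_two_mul_exp_exponent hd hα h0 h ht)).const_mul
      (((2 * Real.pi) ^ d)⁻¹ * 2 * κ₁))).mono' hm.aestronglyMeasurable
      (ae_of_all _ fun q => ?_)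
  have h1 := norm_exponent_integrand_le (α := α) h0 h q.2 q.1
  have h2 := Real.abs_cos_le_one ⟪q.2, x⟫
  rw [levyOpKernel, norm_mul, norm_mul, norm_mul, norm_mul, Real.norm_of_nonneg (by positivity),
    Real.norm_eq_abs (Real.cos _), Real.norm_eq_abs (Real.exp _), Real.abs_exp, norm_neg,
    Real.norm_ofNat]
  calc _ ≤ ((2 * Real.pi) ^ d)⁻¹ * (2 * (1 * Real.exp (-t * exponent α κ q.2)) *
        (κ₁ * ((‖q.2‖ ^ 2 + 2) * levyWeight α q.1))) := by gcongr
    _ = _ := by ring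

theorem integrable_secondDiff_heatKernel (hd : 1 ≤ d) (hα : α ∈ Set.Ioo (0 : ℝ) 2)
    (h0 : 0 < κ₀) (h : IsKernel κ₀ κ₁ κ) {t : ℝ} (ht : 0 < t) (x : Sp d) :
    Integrable fun z => secondDiff (heatKernel α κ t) x z * κ z * weight α z :=
  (integrable_levyOpKernel hd hα h0 h ht x).integral_prod_left.congr
    (ae_of_all _ fun z => integral_levyOpKernel_right hd hα h0 h ht x z)

theorem levyOp_heatKernel (hd : 1 ≤ d) (hα : α ∈ Set.Ioo (0 : ℝ) 2)
    (h0 : 0 < κ₀) (h : IsKernel κ₀ κ₁ κ) {t : ℝ} (ht : 0 < t) (x : Sp d) :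
    levyOp α κ (heatKernel α κ t) x = ((2 * Real.pi) ^ d)⁻¹ * ∫ ξ : Sp d,
      Real.cos ⟪ξ, x⟫ * (Real.exp (-t * exponent α κ ξ) * -exponent α κ ξ) := by
  rw [levyOp]
  simp_rw [← integral_levyOpKernel_right hd hα h0 h ht x]
  rw [integral_integral_swap (integrable_levyOpKernel hd hα h0 h ht x)]
  simp_rw [integral_levyOpKernel_left]
  rw [← integral_const_mul, ← integral_const_mul]
  congr 1; funext ξ; ring

/-- The heat equation, by differentiation under the Fourier integral. -/
theorem hasDerivAt_heatKernel (hd : 1 ≤ d) (hα : α ∈ Set.Ioo (0 : ℝ) 2)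
    (h0 : 0 < κ₀) (h : IsKernel κ₀ κ₁ κ) {t : ℝ} (ht : 0 < t) (x : Sp d) :
    HasDerivAt (fun s => heatKernel α κ s x) (levyOp α κ (heatKernel α κ t) x) t := by
  have hE := continuous_exponent hd hα h0 h
  rw [levyOp_heatKernel hd hα h0 h ht]
  refine HasDerivAt.const_mul _ ?_
  refine (hasDerivAt_integral_of_dominated_loc_of_deriv_le (μ := (volume : Measure (Sp d)))
    (F := fun s ξ => Real.cos ⟪ξ, x⟫ * Real.exp (-s * exponent α κ ξ))
    (F' := fun s ξ => Real.cos ⟪ξ, x⟫ * (Real.exp (-s * exponent α κ ξ) * -exponent α κ ξ))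
    (bound := fun ξ => κ₁ * (∫ z : Sp d, levyWeight α z) *
      ((‖ξ‖ ^ 2 + 2) * Real.exp (-(t / 2) * exponent α κ ξ)))
    (Metric.ball_mem_nhds t (half_pos ht))
    (Eventually.of_forall fun s => Continuous.aestronglyMeasurable (by fun_prop))
    (integrable_cos_mul_exp_exponent hd hα h0 h ht x)
    (Continuous.aestronglyMeasurable (by fun_prop)) (ae_of_all _ fun ξ s hs => ?_)
    ((integrable_sq_add_two_mul_exp_exponent hd hα h0 h (half_pos ht)).const_mul _)
    (ae_of_all _ fun ξ s _ => ?_)).2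
  · have hs' : t / 2 < s := by
      rw [Metric.mem_ball, Real.dist_eq, abs_lt] at hs; linarith [hs.1]
    have hn := exponent_nonneg (α := α) h0 h ξ
    rw [norm_mul, norm_mul, norm_neg, Real.norm_of_nonneg hn, Real.norm_eq_abs, Real.norm_eq_abs,
      Real.abs_exp]
    calc _ ≤ 1 * (Real.exp (-(t / 2) * exponent α κ ξ) *
          (κ₁ * ((‖ξ‖ ^ 2 + 2) * ∫ z : Sp d, levyWeight α z))) := by
          gcongr
          · exact Real.abs_cos_le_one _
          · exact exponent_le hd hα h0 h ξ
      _ = _ := by ring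
  · refine HasDerivAt.const_mul _ ?_
    have := (((hasDerivAt_id s).neg.mul_const (exponent α κ ξ)).exp)
    simpa using this

theorem isHeatKernel_heatKernel (hd : 1 ≤ d) (hα : α ∈ Set.Ioo (0 : ℝ) 2)
    (h0 : 0 < κ₀) (h : IsKernel κ₀ κ₁ κ) : IsHeatKernel α κ (heatKernel α κ) where
  smooth _ ht := contDiff_heatKernel hd hα h0 h ht
  nonneg _ ht := heatKernel_nonneg hd hα h0 h ht
  integrable _ ht := integrable_heatKernel hd hα h0 h ht
  integrable_secondDiff _ ht := integrable_secondDiff_heatKernel hd hα h0 h ht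
  equation _ ht := hasDerivAt_heatKernel hd hα h0 h ht
  initial _ hf hM := tendsto_integral_heatKernel_mul hd hα h0 h hf hM.choose_spec

end HeatEquation

end

end StableLike

open StableLike in
theorem theorem2p5 (d : ℕ) (hd : 1 ≤ d) (α : ℝ) (hα : α ∈ Set.Ioo (0 : ℝ) 2)
    (κ₀ κ₁ : ℝ) (hκ₀ : 0 < κ₀) :
    (∀ κ : Sp d → ℝ, IsKernel κ₀ κ₁ κ → IsHeatKernel α κ (heatKernel α κ)) ∧
    ∀ γ ∈ Set.Ioo (0 : ℝ) (min α 1), ∃ C > 0,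
      ∀ κ κ' : Sp d → ℝ, IsKernel κ₀ κ₁ κ → IsKernel κ₀ κ₁ κ' →
      ∀ t ∈ Set.Ioc (0 : ℝ) 1, ∀ x : Sp d,
        |heatKernel α κ t x - heatKernel α κ' t x| ≤
          C * supNorm (fun z => κ z - κ' z) * (rho α 0 α t x + rho α γ (α - γ) t x) ∧
        ‖gradient (heatKernel α κ t) x - gradient (heatKernel α κ' t) x‖ ≤
          C * supNorm (fun z => κ z - κ' z) * t ^ (-1 / α) *
            (rho α 0 α t x + rho α γ (α - γ) t x) ∧
        Integrable (fun z => |secondDiff (heatKernel α κ t) x z -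
          secondDiff (heatKernel α κ' t) x z| * weight α z) ∧
        ∫ z, |secondDiff (heatKernel α κ t) x z -
            secondDiff (heatKernel α κ' t) x z| * weight α z ≤
          C * supNorm (fun z => κ z - κ' z) * (rho α 0 0 t x + rho α γ (-γ) t x) := by
  refine ⟨fun κ h => isHeatKernel_heatKernel hd hα hκ₀ h, fun γ _ => ?_⟩
  obtain ⟨C, hC, hmain⟩ := exists_heatKernel_sub_le hd hα hκ₀ κ₁
  refine ⟨C, hC, fun κ κ' h h' t ht x => ?_⟩
  obtain ⟨h1, h2, h3, h4⟩ := hmain κ κ' h h' t ht.1 x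
  have ht0 : 0 ≤ t := ht.1.le
  have hS : 0 ≤ supNorm (fun z => κ z - κ' z) := ENNReal.toReal_nonneg
  have hr : ∀ δ, 0 ≤ rho α γ δ t x := fun δ => rho_nonneg ht0 γ δ x
  refine ⟨h1.trans ?_, h2.trans ?_, h3, h4.trans ?_⟩
  · exact mul_le_mul_of_nonneg_left (le_add_of_nonneg_right (hr _)) (by positivity)
  · exact mul_le_mul_of_nonneg_left (le_add_of_nonneg_right (hr _)) (by positivity)
  · exact mul_le_mul_of_nonneg_left (le_add_of_nonneg_right (hr _)) (by positivity)
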